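/- **Setting.** Let $T>0$, $\mu_0>0$, and let $\Gamma(t)$, $t\in[0,T]$, be closed (compact, without boundary), connected, oriented smooth surfaces in $\mathbb{R}^3$ that move smoothly in time, with unit outward normal $\nu(\cdot,t)$ and scalar outward normal velocity $V_\Gamma^N(\cdot,t)$. Put $S_T=\bigcup_{t\in(0,T)}\Gamma(t)\times\{t\}$. Let $\pi(\cdot,t)$ be the closest point mapping onto $\Gamma(t)$ and $d(\cdot,t)$ the signed distance from $\Gamma(t)$, increasing in the direction of $\nu$, so that $x=\pi(x,t)+d(x,t)\,\nu(\pi(x,t),t)$ near $\Gamma(t)$. On $\Gamma(t)$ let $P_\Gamma=I_3-\nu\otimes\nu$. For a vector field $w$ on $\Gamma(t)$ let $\nabla_\Gamma w=P_\Gamma\nabla\tilde w$, where $\tilde w$ is any extension of $w$ to a neighborhood (for instance $w\circ\pi$) and $(\nabla F)_{ij}=\partial_iF_j$. Let $D^{tan}(w)=\tfrac12\{\nabla_\Gamma w+(\nabla_\Gamma w)^T\}$ and $H=-\mathrm{div}_\Gamma\nu=-\mathrm{tr}\,\nabla_\Gamma\nu$. For $\varepsilon>0$ let $\Omega_\varepsilon(t)=\{x\in\mathbb{R}^3\mid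 \mathrm{dist}(x,\Gamma(t))<\varepsilon\}$, with unit outward normal $\nu_\varepsilon$ and outward normal velocity $V_\varepsilon^N$ of $\partial\Omega_\varepsilon(t)$. Write $D(u)=\tfrac12\{\nabla u+(\nabla u)^T\}$, $\sigma=2\mu_0D(u)-pI_3$ and $|M|^2=\sum_{i,j}M_{ij}^2$. Let $\mathcal{H}^2$ be the two-dimensional Hausdorff measure (normalized to be the surface area). **Theorem 5.6.** For all sufficiently small $\varepsilon>0$ let $u=u^\varepsilon$ (vector-valued) and $p=p^\varepsilon$ (scalar) be functions on $\bigcup_{t\in(0,T)}\overline{\Omega_\varepsilon(t)}\times\{t\}$, smooth up to the lateral boundary, with the expansions $$u^\varepsilon(x,t)=v(\pi,t)+d\,v^1(\pi,t)+d^2\,v^2(\pi,t)+R(d^3),\qquad p^\varepsilon(x,t)=q(\pi,t)+d\,q^1(\pi,t)+R(d^2),$$ where $\pi=\pi(x,t)$, $d=d(x,t)$, and $v,v^1,v^2,q,q^1$ are smooth on $S_T$ and independent of $\varepsilon$. Here $R(d^k)$ denotes a remainder all of whose space-time derivatives of order $l\le k$ are bounded on $\Omega_\varepsilon(t)$ by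 $C|d(x,t)|^{k-l}$, with $C$ independent of $\varepsilon$ and uniform for $t$ in compact subintervals of $(0,T)$. Suppose that for all sufficiently small $\varepsilon>0$ and all $t\in(0,T)$ the functions $u=u^\varepsilon$, $p=p^\varepsilon$ satisfy the energy identity $$\frac{d}{dt}\int_{\Omega_\varepsilon(t)}\frac{|u|^2}{2}\,dx=-2\mu_0\int_{\Omega_\varepsilon(t)}|D(u)|^2\,dx+\int_{\partial\Omega_\varepsilon(t)}(\sigma\nu_\varepsilon\cdot\nu_\varepsilon)V_\varepsilon^N\,d\mathcal{H}^2$$ and the boundary conditions $$u\cdot\nu_\varepsilon=V_\varepsilon^N,\qquad D(u)\nu_\varepsilon-(D(u)\nu_\varepsilon\cdot\nu_\varepsilon)\nu_\varepsilon=0\qquad\text{on }\partial\Omega_\varepsilon(t).$$ Then for every $t\in(0,T)$ the function $s\mapsto\int_{\Gamma(s)}\frac{|v|^2}{2}\,d\mathcal{H}^2$ is differentiable at $t$ and $$\frac{d}{dt}\int_{\Gamma(t)}\frac{|v|^2}{2}\,d\mathcal{H}^2=-2\mu_0\int_{\Gamma(t)}|P_\Gamma D^{tan}(v)P_\Gamma|^2\,d\mathcal{H}^2+\int_{\Gamma(t)}(qH-q^1)V_\Gamma^N\,d\mathcal{H}^2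 .$$ -/

import Mathlib

open Set Filter Topology MeasureTheory
open scoped ContDiff

namespace ThinFluid

noncomputable section

/-- Three-dimensional Euclidean space. -/
abbrev E3 : Type := EuclideanSpace ℝ (Fin 3)

/-- The `i`-th standard basis vector of `ℝ³`. -/
def e (i : Fin 3) : E3 := EuclideanSpace.single i 1

/-- A smoothly moving closed (compact, without boundary) connected oriented surface `Γ(t)`,
`t ∈ [0, T]`, in `ℝ³`, together with its unit outward normal `ν` and its scalar outward normal
velocity `V`. Only the values of `ν` and `V` on the surface matter.

Smoothness in space and time: near each of its points the space-time set
`⋃ t, Γ(t) × {t}` is the zero set of a smooth function `φ` with `∇ₓ φ ≠ 0`, chosen to increase in the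
direction of `ν`, so that `ν = ∇ₓ φ / |∇ₓ φ|` and `V = - ∂ₜ φ / |∇ₓ φ|`. -/
structure MovingSurface (T : ℝ) where
  /-- the surface at time `t` -/
  Γ : ℝ → Set E3
  /-- the unit outward normal vector field -/
  ν : E3 → ℝ → E3
  /-- the scalar outward normal velocity -/
  V : E3 → ℝ → ℝ
  isCompact_spaceTime : IsCompact {z : E3 × ℝ | z.2 ∈ Icc 0 T ∧ z.1 ∈ Γ z.2}
  isConnected : ∀ t ∈ Icc 0 T, IsConnected (Γ t)
  exists_defining : ∀ t₀ ∈ Icc 0 T, ∀ y₀ ∈ Γ t₀,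
    ∃ (W : Set (E3 × ℝ)) (φ : E3 × ℝ → ℝ), IsOpen W ∧ (y₀, t₀) ∈ W ∧ ContDiffOn ℝ ∞ φ W ∧
      ∀ x t, (x, t) ∈ W → t ∈ Icc 0 T →
        gradient (fun y => φ (y, t)) x ≠ 0 ∧
        (x ∈ Γ t ↔ φ (x, t) = 0) ∧
        (x ∈ Γ t →
          ν x t = ‖gradient (fun y => φ (y, t)) x‖⁻¹ • gradient (fun y => φ (y, t)) x ∧
          V x t = -(‖gradient (fun y => φ (y, t)) x‖⁻¹ * deriv (fun s => φ (x, s)) t))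
  /-- `ν` points into the unbounded component of the complement of `Γ(t)`. -/
  outward : ∀ t ∈ Icc 0 T, ∀ y ∈ Γ t, ∀ᶠ s : ℝ in 𝓝[>] 0,
    ¬ Bornology.IsBounded (connectedComponentIn (Γ t)ᶜ (y + s • ν y t))

/-- A point of `K` closest to `x` (the closest point, where it is unique). -/
def closestPoint (K : Set E3) (x : E3) : E3 :=
  open Classical in
  if h : ∃ y ∈ K, dist x y = Metric.infDist x K then h.choose else x

/-- The gradient matrix `(∇ F)ᵢⱼ = ∂ᵢ Fⱼ`. -/
def gradMatrix (F : E3 → E3) (x : E3) : Matrix (Fin 3) (Fin 3) ℝ :=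
  Matrix.of fun i j => (fderiv ℝ F x (e i)) j

/-- The strain rate tensor `D(F) = (∇ F + (∇ F)ᵀ) / 2`. -/
def strain (F : E3 → E3) (x : E3) : Matrix (Fin 3) (Fin 3) ℝ :=
  (1 / 2 : ℝ) • (gradMatrix F x + (gradMatrix F x).transpose)

/-- The square `|M|² = ∑ᵢⱼ Mᵢⱼ²` of the Frobenius norm. -/
def frobSq (M : Matrix (Fin 3) (Fin 3) ℝ) : ℝ := ∑ i, ∑ j, M i j ^ 2

/-- The vector `M a`. -/
def matVec (M : Matrix (Fin 3) (Fin 3) ℝ) (a : E3) : E3 := WithLp.toLp 2 (M.mulVec a.ofLp)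

namespace MovingSurface

variable {T : ℝ} (S : MovingSurface T)

/-- The space-time hypersurface `S_T = ⋃_{t ∈ (0,T)} Γ(t) × {t}`. -/
def spaceTime : Set (E3 × ℝ) := {z | z.2 ∈ Ioo 0 T ∧ z.1 ∈ S.Γ z.2}

/-- The closest point mapping `π(·, t)` onto `Γ(t)`. -/
def proj (x : E3) (t : ℝ) : E3 := closestPoint (S.Γ t) x

/-- The signed distance `d(·, t)` from `Γ(t)`, increasing in the direction of `ν`:
the coefficient `d` in `x = π(x,t) + d(x,t) ν(π(x,t),t)`. -/
def sdist (x : E3) (t : ℝ) : ℝ := inner ℝ (x - S.proj x t) (S.ν (S.proj x t) t)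

/-- The moving thin domain `Ω_ε(t) = {x | dist(x, Γ(t)) < ε}`. -/
def Ω (ε t : ℝ) : Set E3 := {x | Metric.infDist x (S.Γ t) < ε}

/-- The unit outward normal of `∂Ω_ε(t)`, `Ω_ε(t)` being the sublevel set `{dist(·, Γ(t)) < ε}`:
the normalized gradient of `dist(·, Γ(t))`. -/
def bdryNormal (x : E3) (t : ℝ) : E3 :=
  ‖gradient (fun y => Metric.infDist y (S.Γ t)) x‖⁻¹ •
    gradient (fun y => Metric.infDist y (S.Γ t)) x

/-- The scalar outward normal velocity of `∂Ω_ε(t)`, `Ω_ε(t)` being the sublevel set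
`{dist(·, Γ(t)) < ε}`. -/
def bdryVelocity (x : E3) (t : ℝ) : ℝ :=
  -(‖gradient (fun y => Metric.infDist y (S.Γ t)) x‖⁻¹ *
    deriv (fun s => Metric.infDist x (S.Γ s)) t)

/-- The orthogonal projection `P_Γ = I₃ - ν ⊗ ν` onto the tangent plane. -/
def tanProj (y : E3) (t : ℝ) : Matrix (Fin 3) (Fin 3) ℝ :=
  1 - Matrix.of fun i j => S.ν y t i * S.ν y t j

/-- The tangential gradient matrix `∇_Γ G = P_Γ ∇ G̃` of a vector field `G` on the surface, computed
with the extension `G̃ = G ∘ π` that is constant in the normal direction. -/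
def tanGrad (G : E3 → ℝ → E3) (y : E3) (t : ℝ) : Matrix (Fin 3) (Fin 3) ℝ :=
  S.tanProj y t * gradMatrix (fun x => G (S.proj x t) t) y

/-- The tangential strain rate `D^tan(G) = (∇_Γ G + (∇_Γ G)ᵀ) / 2`. -/
def tanStrain (G : E3 → ℝ → E3) (y : E3) (t : ℝ) : Matrix (Fin 3) (Fin 3) ℝ :=
  (1 / 2 : ℝ) • (S.tanGrad G y t + (S.tanGrad G y t).transpose)

/-- (Twice) the mean curvature `H = - div_Γ ν`. -/
def meanCurv (y : E3) (t : ℝ) : ℝ := -(S.tanGrad S.ν y t).trace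

/-- The family `f ε`, `0 < ε ≪ 1`, of functions on `⋃ t, closure Ω_ε(t) × {t}` is smooth up to the
lateral boundary (`f ε` is smooth near each of these points) and has the expansion
`f ε (x,t) = c₀(π(x,t),t) + d c₁(π(x,t),t) + ⋯ + d^(k-1) c_(k-1)(π(x,t),t) + R(d^k)`
with smooth coefficients `c_j` on `S_T` that do not depend on `ε`. Here `R(d^k)` stands for a
remainder whose space-time derivatives of order `l ≤ k` are bounded by `C |d|^(k-l)`, with `C`
independent of `ε` and locally uniform in time. -/
structure HasExpansion {F : Type*} [NormedAddCommGroup F] [NormedSpace ℝ F] {k : ℕ}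
    (f : ℝ → E3 → ℝ → F) (c : Fin k → E3 → ℝ → F) : Prop where
  smooth : ∀ᶠ ε : ℝ in 𝓝[>] 0, ∀ t ∈ Ioo 0 T, ∀ x ∈ closure (S.Ω ε t),
    ContDiffAt ℝ ∞ (Function.uncurry (f ε)) (x, t)
  coeff_smooth : ∀ j, ContDiffOn ℝ ∞ (Function.uncurry (c j)) S.spaceTime
  remainder : ∀ a b : ℝ, 0 < a → b < T → ∃ C : ℝ, ∀ᶠ ε : ℝ in 𝓝[>] 0,
    ∀ t ∈ Icc a b, ∀ x ∈ S.Ω ε t, ∀ l ≤ k,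
      ‖iteratedFDeriv ℝ l
          (fun z : E3 × ℝ =>
            f ε z.1 z.2 - ∑ j : Fin k, S.sdist z.1 z.2 ^ (j : ℕ) • c j (S.proj z.1 z.2) z.2)
          (x, t)‖ ≤ C * |S.sdist x t| ^ (k - l)

/-- The impermeability condition `u · ν_ε = V_ε` on `∂Ω_ε(t)`, `t ∈ (0,T)`. -/
def Impermeable (ε : ℝ) (u : E3 → ℝ → E3) : Prop :=
  ∀ t ∈ Ioo 0 T, ∀ x ∈ frontier (S.Ω ε t), inner ℝ (u x t) (S.bdryNormal x t) = S.bdryVelocity x t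

/-- The perfect slip condition `[D(u) ν_ε]_tan = 0` on `∂Ω_ε(t)`, `t ∈ (0,T)`, where
`[a]_tan = a - (a · ν_ε) ν_ε`. -/
def PerfectSlip (ε : ℝ) (u : E3 → ℝ → E3) : Prop :=
  ∀ t ∈ Ioo 0 T, ∀ x ∈ frontier (S.Ω ε t),
    matVec (strain (fun y => u y t) x) (S.bdryNormal x t) -
      inner ℝ (matVec (strain (fun y => u y t) x) (S.bdryNormal x t)) (S.bdryNormal x t) •
        S.bdryNormal x t = 0

/-- The Cauchy stress tensor `σ = 2 μ₀ D(u) - p I₃`. -/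
def stress (μ₀ : ℝ) (u : E3 → ℝ → E3) (p : E3 → ℝ → ℝ) (x : E3) (t : ℝ) :
    Matrix (Fin 3) (Fin 3) ℝ :=
  (2 * μ₀) • strain (fun y => u y t) x - p x t • (1 : Matrix (Fin 3) (Fin 3) ℝ)

/-- The energy identity of the Navier-Stokes equations in `Ω_ε(t)`, `t ∈ (0,T)`:
`d/dt ∫_{Ω_ε} |u|²/2 = - 2 μ₀ ∫_{Ω_ε} |D(u)|² + ∫_{∂Ω_ε} (σ ν_ε · ν_ε) V_ε dℋ²`. -/
def BulkEnergyIdentity (μ₀ ε : ℝ) (u : E3 → ℝ → E3) (p : E3 → ℝ → ℝ) : Prop :=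
  ∀ t ∈ Ioo 0 T,
    HasDerivAt (fun s => ∫ x in S.Ω ε s, ‖u x s‖ ^ 2 / 2)
      (-(2 * μ₀) * (∫ x in S.Ω ε t, frobSq (strain (fun y => u y t) x)) +
        ∫ x in frontier (S.Ω ε t),
          inner ℝ (matVec (stress μ₀ u p x t) (S.bdryNormal x t)) (S.bdryNormal x t) *
            S.bdryVelocity x t ∂μHE[2])
      t

/-- The energy identity on `Γ(t)`, `t ∈ (0,T)`:
`d/dt ∫_Γ |v|²/2 dℋ² = - 2 μ₀ ∫_Γ |P_Γ D^tan(v) P_Γ|² dℋ² + ∫_Γ (q H - q¹) V dℋ²`. -/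
def SurfaceEnergyIdentity (μ₀ : ℝ) (v : E3 → ℝ → E3) (q q1 : E3 → ℝ → ℝ) : Prop :=
  ∀ t ∈ Ioo 0 T,
    HasDerivAt (fun s => ∫ y in S.Γ s, ‖v y s‖ ^ 2 / 2 ∂μHE[2])
      (-(2 * μ₀) *
          (∫ y in S.Γ t, frobSq (S.tanProj y t * S.tanStrain v y t * S.tanProj y t) ∂μHE[2]) +
        ∫ y in S.Γ t, (q y t * S.meanCurv y t - q1 y t) * S.V y t ∂μHE[2])
      t

end MovingSurface

end

end ThinFluid

/-!
In the normal coordinates `x = y + r ν(y,t)`, with `y ∈ Γ(t)` and `|r| < ε`, the volume element of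
`Ω_ε(t)` is `J(y,r) dℋ²(y) dr` with `J = 1 - r H + O(r²)`, and the two sheets `r = ±ε` of
`∂Ω_ε(t)` carry the surface element `J(y,±ε) dℋ²(y)`. Divide the energy identity by the thickness
`2ε` and let `ε → 0`, uniformly for `t` in compact subintervals of `(0,T)`.

Impermeability holds on `∂Ω_ε(t)` for every small `ε`, so the polynomial
`v·ν + r v¹·ν + r² v²·ν - V` in `r` is `O(r³)` and hence vanishes. Thus `D(u)ν·ν = 0` on `Γ(t)` in
the limit, perfect slip gives `D(u)ν = 0`, and the limit of `D(u)` is its tangential part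
`P D^tan(v) P`.

The same identity makes `σν_ε·ν_ε = -(q ± ε q¹) + O(ε²)` on the sheets `r = ±ε`, while
`V_ε = ±V`. Weighted with `J(y,±ε) = 1 ∓ ε H + O(ε²)`, the terms of order one cancel in the sum over
both sheets and the terms of order `ε` add up to `2ε (q H - q¹) V`.
-/

namespace ThinFluid

noncomputable section

open scoped ENNReal NNReal

/-! ### Measures determined by their infinitesimal behaviour -/

section Measure

theorem euclideanHausdorffMeasure_image_le_mul {α X Y : Type*} [MetricSpace X] [MeasurableSpace X]
    [BorelSpace X] [MetricSpace Y] [MeasurableSpace Y] [BorelSpace Y] (d : ℕ) {f : α → X}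
    {g : α → Y} {S : Set α} {K : ℝ≥0}
    (h : ∀ a ∈ S, ∀ b ∈ S, dist (f a) (f b) ≤ K * dist (g a) (g b)) :
    μHE[d] (f '' S) ≤ (K : ℝ≥0∞) ^ d * μHE[d] (g '' S) := by
  rcases S.eq_empty_or_nonempty with rfl | ⟨a₀, -⟩
  · simp
  have : Nonempty α := ⟨a₀⟩
  have factors : ∀ a ∈ S, f (Function.invFunOn g S (g a)) = f a := by
    intro a ha
    have hm : Function.invFunOn g S (g a) ∈ S := Function.invFunOn_mem ⟨a, ha, rfl⟩
    have he : g (Function.invFunOn g S (g a)) = g a := Function.invFunOn_eq ⟨a, ha, rfl⟩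
    have := h _ hm _ ha
    rw [he, dist_self, mul_zero] at this
    exact dist_le_zero.1 this
  have hlip : LipschitzOnWith K (fun y => f (Function.invFunOn g S y)) (g '' S) := by
    apply LipschitzOnWith.of_dist_le_mul
    rintro _ ⟨a, ha, rfl⟩ _ ⟨b, hb, rfl⟩
    simp only [factors a ha, factors b hb]
    exact h a ha b hb
  have himg : (fun y => f (Function.invFunOn g S y)) '' (g '' S) = f '' S := by
    rw [image_image]
    exact image_congr factors
  have := hlip.hausdorffMeasure_image_le (d := d) (Nat.cast_nonneg d)
  rw [himg, ENNReal.rpow_natCast] at this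
  simp only [Measure.euclideanHausdorffMeasure_def, Measure.smul_apply, ENNReal.smul_def,
    smul_eq_mul]
  rw [mul_left_comm]
  gcongr

variable {X Y : Type*} [TopologicalSpace X] [MeasurableSpace X] [TopologicalSpace Y]
  [MeasurableSpace Y]

theorem measure_le_mul_of_eventually_smallSets [SecondCountableTopology X] [OpensMeasurableSpace X]
    {μ ν : Measure X} {B : Set X} {c : ℝ≥0∞}
    (h : ∀ x ∈ B, ∀ᶠ S in (𝓝[B] x).smallSets, MeasurableSet S → μ S ≤ c * ν S) {S : Set X}
    (hS : MeasurableSet S) (hSB : S ⊆ B) : μ S ≤ c * ν S := by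
  have h_open : ∀ x ∈ B, ∃ U : Set X, IsOpen U ∧ x ∈ U ∧
      ∀ S ⊆ U ∩ B, MeasurableSet S → μ S ≤ c * ν S := by
    intro x hx
    obtain ⟨s, hs, hle⟩ := eventually_smallSets.1 (h x hx)
    obtain ⟨U, hU, hxU, hUs⟩ := mem_nhdsWithin.1 hs
    exact ⟨U, hU, hxU, fun S hSU => hle S (hSU.trans hUs)⟩
  choose! U hU hxU hle using h_open
  obtain ⟨D, hDB, hDc, hD⟩ := TopologicalSpace.countable_cover_nhdsWithin
    (fun x hx => mem_nhdsWithin_of_mem_nhds ((hU x hx).mem_nhds (hxU x hx)))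
  rcases D.eq_empty_or_nonempty with rfl | hne
  · simp [subset_empty_iff.1 (hSB.trans (by simpa using hD))]
  obtain ⟨x, rfl⟩ := hDc.exists_eq_range hne
  set V : ℕ → Set X := disjointed fun n => U (x n)
  have hVm : ∀ n, MeasurableSet (V n) :=
    fun n => MeasurableSet.disjointed (fun n => (hU _ (hDB ⟨n, rfl⟩)).measurableSet) n
  have hcov : S = ⋃ n, S ∩ V n := by
    rw [← inter_iUnion, iUnion_disjointed, eq_comm, inter_eq_left]
    exact hSB.trans (hD.trans (by simp))
  have hdisj : Pairwise (Function.onFun Disjoint fun n => S ∩ V n) := fun i j hij =>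
    (disjoint_disjointed _ hij).mono inter_subset_right inter_subset_right
  rw [hcov, measure_iUnion hdisj (fun n => hS.inter (hVm n)),
    measure_iUnion hdisj (fun n => hS.inter (hVm n)), ← ENNReal.tsum_mul_left]
  exact ENNReal.tsum_le_tsum fun n => hle _ (hDB ⟨n, rfl⟩) _
    (subset_inter (inter_subset_right.trans (disjointed_subset _ n)) (inter_subset_left.trans hSB))
    (hS.inter (hVm n))

theorem exists_one_lt_pow_le {c : ℝ≥0} (hc : 1 < c) (k : ℕ) : ∃ K : ℝ≥0, 1 < K ∧ K ^ k ≤ c := by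
  have ht : Tendsto (fun K : ℝ≥0 => K ^ k) (𝓝[>] 1) (𝓝 (1 ^ k)) :=
    ((continuous_pow k).tendsto (1 : ℝ≥0)).mono_left nhdsWithin_le_nhds
  rw [one_pow] at ht
  obtain ⟨K, hK, hK1⟩ := ((ht.eventually_lt_const hc).and self_mem_nhdsWithin).exists
  exact ⟨K, hK1, hK.le⟩

theorem le_of_forall_one_lt_le_mul {a b : ℝ≥0∞} (h : ∀ c : ℝ≥0, 1 < c → a ≤ c * b) : a ≤ b := by
  have ht : Tendsto (fun c : ℝ≥0 => (c : ℝ≥0∞) * b) (𝓝[>] 1) (𝓝 ((1 : ℝ≥0) * b)) :=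
    ENNReal.Tendsto.mul_const (ENNReal.tendsto_coe.2 nhdsWithin_le_nhds) (Or.inl (by simp))
  rw [ENNReal.coe_one, one_mul] at ht
  exact ge_of_tendsto ht (eventually_mem_nhdsWithin.mono h)

theorem eventually_smallSets_withDensity_comparable {ν : Measure X} {B : Set X} {J : X → ℝ≥0}
    {x : X} (hJ : ContinuousWithinAt J B x) (hJx : 0 < J x) {c : ℝ≥0} (hc : 1 < c) :
    ∀ᶠ S in (𝓝[B] x).smallSets, MeasurableSet S →
      (ν.withDensity fun y => J y) S ≤ c * (J x * ν S) ∧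
        J x * ν S ≤ c * (ν.withDensity fun y => J y) S := by
  have hup : ∀ᶠ y in 𝓝[B] x, J y < c * J x := hJ.eventually_lt_const (by nlinarith)
  have hlow : ∀ᶠ y in 𝓝[B] x, c⁻¹ * J x < J y := hJ.eventually_const_lt (by
    have : c⁻¹ < 1 := inv_lt_one_of_one_lt₀ hc
    nlinarith)
  filter_upwards [eventually_smallSets_forall.2 hup, eventually_smallSets_forall.2 hlow]
    with S hSup hSlow hS
  rw [withDensity_apply _ hS]
  constructor
  · rw [← mul_assoc, ← setLIntegral_const]
    exact setLIntegral_mono' hS fun y hy => mod_cast (hSup y hy).le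
  · rw [← setLIntegral_const, ← lintegral_const_mul' _ _ (by simp)]
    refine setLIntegral_mono' hS fun y hy => ?_
    have := (hSlow y hy).le
    rw [inv_mul_le_iff₀ (one_pos.trans hc)] at this
    exact_mod_cast this

theorem measure_eq_setLIntegral_of_eventually_smallSets [SecondCountableTopology X]
    [OpensMeasurableSpace X] {μ ν : Measure X} {B : Set X} {J : X → ℝ≥0} (hJ : ContinuousOn J B)
    (hJpos : ∀ x ∈ B, 0 < J x)
    (h : ∀ x ∈ B, ∀ c : ℝ≥0, 1 < c → ∀ᶠ S in (𝓝[B] x).smallSets, MeasurableSet S →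
      μ S ≤ c * (J x * ν S) ∧ J x * ν S ≤ c * μ S) {S : Set X}
    (hS : MeasurableSet S) (hSB : S ⊆ B) : μ S = ∫⁻ x in S, J x ∂ν := by
  have comparable : ∀ c : ℝ≥0, 1 < c → ∀ x ∈ B, ∀ᶠ S in (𝓝[B] x).smallSets, MeasurableSet S →
      μ S ≤ c * (ν.withDensity fun x => J x) S ∧ (ν.withDensity fun x => J x) S ≤ c * μ S := by
    intro c hc x hx
    obtain ⟨K, hK, hKc⟩ := exists_one_lt_pow_le hc 2
    have hKc' : ∀ a : ℝ≥0∞, K * (K * a) ≤ c * a := fun a => by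
      rw [← mul_assoc, ← sq]
      gcongr
      exact_mod_cast hKc
    filter_upwards [h x hx K hK,
      eventually_smallSets_withDensity_comparable (ν := ν) (hJ x hx) (hJpos x hx) hK]
      with S hμ hν hS
    constructor
    · exact (hμ hS).1.trans ((mul_le_mul_right (hν hS).2 _).trans (hKc' _))
    · exact (hν hS).1.trans ((mul_le_mul_right (hμ hS).2 _).trans (hKc' _))
  rw [← withDensity_apply _ hS]
  apply le_antisymm
  · exact le_of_forall_one_lt_le_mul fun c hc => measure_le_mul_of_eventually_smallSets
      (fun x hx => (comparable c hc x hx).mono fun S hle hS => (hle hS).1) hS hSB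
  · exact le_of_forall_one_lt_le_mul fun c hc => measure_le_mul_of_eventually_smallSets
      (fun x hx => (comparable c hc x hx).mono fun S hle hS => (hle hS).2) hS hSB

section Image

variable [PolishSpace X] [BorelSpace X] {ν : Measure X} {B : Set X} {J : X → ℝ≥0} {φ : X → Y}

theorem measure_image_eq_setLIntegral_of_eventually_smallSets [T2Space Y] [BorelSpace Y]
    [SecondCountableTopology Y]
    {μ : Measure Y} (hB : MeasurableSet B) (hφ : ContinuousOn φ B)
    (hinj : InjOn φ B) (hJ : ContinuousOn J B) (hJpos : ∀ x ∈ B, 0 < J x)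
    (h : ∀ x ∈ B, ∀ c : ℝ≥0, 1 < c → ∀ᶠ S in (𝓝[B] x).smallSets, MeasurableSet S →
      μ (φ '' S) ≤ c * (J x * ν S) ∧ J x * ν S ≤ c * μ (φ '' S)) {S : Set X}
    (hS : MeasurableSet S) (hSB : S ⊆ B) : μ (φ '' S) = ∫⁻ x in S, J x ∂ν := by
  have hemb := hφ.measurableEmbedding hB hinj
  have hval := MeasurableEmbedding.subtype_coe hB
  set μ' : Measure X := (μ.comap (B.domRestrict φ)).map Subtype.val with hμ'
  have pullback : ∀ S ⊆ B, μ' S = μ (φ '' S) := by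
    intro S hSB
    rw [hμ', hval.map_apply, hemb.comap_apply]
    congr 1
    ext x
    constructor
    · rintro ⟨z, hz, rfl⟩
      exact ⟨z, hz, rfl⟩
    · rintro ⟨z, hz, rfl⟩
      exact ⟨⟨z, hSB hz⟩, hz, rfl⟩
  rw [← pullback S hSB]
  refine measure_eq_setLIntegral_of_eventually_smallSets hJ hJpos (fun x hx c hc => ?_) hS hSB
  filter_upwards [h x hx c hc, eventually_smallSets_subset.2 self_mem_nhdsWithin] with S hle hSB
  rwa [pullback S hSB]

theorem setIntegral_image_of_measure_image [T2Space Y] [BorelSpace Y] [SecondCountableTopology Y]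
    {μ : Measure Y} {F : Type*} [NormedAddCommGroup F] [NormedSpace ℝ F]
    [SecondCountableTopology F] (hB : MeasurableSet B) (hφ : ContinuousOn φ B) (hinj : InjOn φ B)
    (hJ : ContinuousOn J B)
    (h : ∀ S, MeasurableSet S → S ⊆ B → μ (φ '' S) = ∫⁻ x in S, J x ∂ν) (f : Y → F)
    (hf : ContinuousOn f (φ '' B)) :
    ∫ x in φ '' B, f x ∂μ = ∫ z in B, J z • f (φ z) ∂ν := by
  have hφm : AEMeasurable φ ((ν.restrict B).withDensity fun x => J x) :=
    (hφ.aemeasurable hB).mono_ac (withDensity_absolutelyContinuous _ _)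
  have hmap : Measure.map φ ((ν.restrict B).withDensity fun x => J x) = μ.restrict (φ '' B) := by
    ext s hs
    have hpre : MeasurableSet (φ ⁻¹' s ∩ B) := by
      have := (MeasurableEmbedding.subtype_coe hB).measurableSet_image'
        ((continuousOn_iff_continuous_domRestrict.1 hφ).measurable hs)
      convert this using 1
      ext x
      simp [and_comm]
    rw [Measure.map_apply_of_aemeasurable hφm hs, Measure.restrict_apply hs,
      ← restrict_withDensity hB, Measure.restrict_apply' hB, withDensity_apply _ hpre,
      ← h _ hpre inter_subset_right, image_preimage_inter]
  have himg : MeasurableSet (φ '' B) := hB.image_of_continuousOn_injOn hφ hinj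
  rw [← hmap, integral_map hφm (hmap ▸ hf.aestronglyMeasurable himg),
    integral_withDensity_eq_integral_smul₀ (hJ.aemeasurable hB)]

end Image

end Measure

/-! ### Volume and hyperplanes -/

section Hyperplane

open Module

variable {E : Type*} [NormedAddCommGroup E] [InnerProductSpace ℝ E]

/-- The orthogonal projection onto the hyperplane orthogonal to `n`, as a linear map of the ambient
space. -/
def hyperplaneProj (n : E) : E →L[ℝ] E := (ℝ ∙ n)ᗮ.starProjection

theorem hyperplaneProj_apply {n : E} (hn : ‖n‖ = 1) (x : E) :
    hyperplaneProj n x = x - inner ℝ n x • n := by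
  rw [hyperplaneProj, Submodule.starProjection_orthogonal_val,
    Submodule.starProjection_unit_singleton ℝ hn]

theorem hyperplaneProj_mem (n x : E) : hyperplaneProj n x ∈ (ℝ ∙ n)ᗮ :=
  Submodule.starProjection_apply_mem _ x

theorem inner_hyperplaneProj (n x : E) : inner ℝ n (hyperplaneProj n x) = 0 :=
  Submodule.mem_orthogonal_singleton_iff_inner_right.1 (hyperplaneProj_mem n x)

theorem norm_hyperplaneProj_le (n x : E) : ‖hyperplaneProj n x‖ ≤ ‖x‖ :=
  Submodule.norm_starProjection_apply_le _ x

theorem norm_hyperplaneProj_add_smul_sq {n : E} (hn : ‖n‖ = 1) (x : E) (r : ℝ) :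
    ‖hyperplaneProj n x + r • n‖ ^ 2 = ‖hyperplaneProj n x‖ ^ 2 + r ^ 2 := by
  rw [norm_add_sq_real, inner_smul_right, real_inner_comm, inner_hyperplaneProj, norm_smul, hn]
  simp

/-- The map `(y, r) ↦ P y + r n`, where `P` is the orthogonal projection onto the hyperplane
orthogonal to `n`: it straightens a normal tube around a graph over that hyperplane. -/
def flatten (n : E) (z : E × ℝ) : E := hyperplaneProj n z.1 + z.2 • n

theorem continuous_flatten (n : E) : Continuous (flatten n) := by
  unfold flatten
  fun_prop

theorem flatten_sub (n : E) (z w : E × ℝ) : flatten n (z - w) = flatten n z - flatten n w := by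
  simp only [flatten, Prod.fst_sub, Prod.snd_sub, map_sub, sub_smul]
  abel

theorem inner_flatten {n : E} (hn : ‖n‖ = 1) (z : E × ℝ) : inner ℝ n (flatten n z) = z.2 := by
  simp [flatten, inner_add_right, inner_hyperplaneProj, inner_smul_right, hn]

theorem flatten_inter_slice {n : E} (hn : ‖n‖ = 1) (S : Set (E × ℝ)) (r : ℝ) :
    flatten n '' S ∩ {x | inner ℝ n x = r} =
      (fun x => r • n + x) '' (hyperplaneProj n '' ((fun y => (y, r)) ⁻¹' S)) := by
  ext x
  constructor
  · rintro ⟨⟨z, hz, rfl⟩, hx⟩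
    rw [mem_ofPred_eq, inner_flatten hn] at hx
    subst hx
    exact ⟨_, ⟨z.1, hz, rfl⟩, add_comm _ _⟩
  · rintro ⟨_, ⟨y, hy, rfl⟩, rfl⟩
    have : r • n + hyperplaneProj n y = flatten n (y, r) := add_comm _ _
    simp only [this]
    exact ⟨⟨_, hy, rfl⟩, inner_flatten hn _⟩

variable {d : ℕ} [hd : Fact (finrank ℝ E = d + 1)]

theorem finrank_orthogonal_singleton {n : E} (hn : ‖n‖ = 1) : finrank ℝ (ℝ ∙ n)ᗮ = d :=
  Submodule.finrank_orthogonal_span_singleton (by rintro rfl; simp at hn)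

variable [FiniteDimensional ℝ E]

theorem det_restrict_hyperplane {n : E} {L : E →L[ℝ] E}
    (hL : ∀ x, inner ℝ n (L x) = inner ℝ n x) (hmaps : ∀ x ∈ (ℝ ∙ n)ᗮ, L x ∈ (ℝ ∙ n)ᗮ) :
    (L.toLinearMap.restrict hmaps).det = L.det := by
  have hquot : (ℝ ∙ n)ᗮ.mapQ (ℝ ∙ n)ᗮ L.toLinearMap hmaps = LinearMap.id := by
    refine Submodule.linearMap_qext _ (LinearMap.ext fun x => ?_)
    simp only [LinearMap.coe_comp, Function.comp_apply, Submodule.mkQ_apply, Submodule.mapQ_apply,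
      LinearMap.id_coe, id_eq, Submodule.Quotient.eq,
      Submodule.mem_orthogonal_singleton_iff_inner_right, inner_sub_right]
    exact sub_eq_zero.2 (hL x)
  rw [ContinuousLinearMap.det, LinearMap.det_eq_det_mul_det _ _ hmaps, hquot, LinearMap.det_id,
    mul_one]

variable [MeasurableSpace E] [BorelSpace E]

theorem volume_eq_lintegral_slice {n : E} (hn : ‖n‖ = 1) {t : Set E} (ht : MeasurableSet t) :
    volume t = ∫⁻ r : ℝ, μHE[d] (t ∩ {x | inner ℝ n x = r}) := by
  have h := EuclideanGeometry.euclideanHausdorffMeasure_eq_lintegral (0 : E) (v := n)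
    (by rintro rfl; simp at hn) ht
  have hn' : ‖n‖ₑ = 1 := by rw [← ofReal_norm, hn]; simp
  rw [InnerProductSpace.euclideanHausdorffMeasure_eq_volume, hd.out, Nat.add_sub_cancel, hn',
    one_mul] at h
  rw [h]
  refine lintegral_congr fun r => ?_
  congr 2
  ext x
  simp only [vadd_eq_add, add_zero, SetLike.mem_coe, AffineSubspace.mem_mk', vsub_eq_sub,
    Submodule.mem_orthogonal_singleton_iff_inner_right, inner_sub_right, inner_smul_right,
    real_inner_self_eq_norm_sq, hn, mem_ofPred_eq, one_pow, mul_one, sub_eq_zero]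

theorem volume_flatten_image {n : E} (hn : ‖n‖ = 1) {S : Set (E × ℝ)}
    (hS : MeasurableSet (flatten n '' S)) :
    volume (flatten n '' S) =
      ∫⁻ r : ℝ, μHE[d] (hyperplaneProj n '' ((fun y => (y, r)) ⁻¹' S)) := by
  rw [volume_eq_lintegral_slice (d := d) hn hS]
  refine lintegral_congr fun r => ?_
  rw [flatten_inter_slice hn]
  exact (isometry_add_left (r • n)).euclideanHausdorffMeasure_image _

theorem euclideanHausdorffMeasure_hyperplane_lt_top {n : E} (hn : ‖n‖ = 1) {X : Set E}
    (hX : Bornology.IsBounded X) (hX0 : X ⊆ (ℝ ∙ n)ᗮ) : μHE[d] X < ⊤ := by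
  have hval : Isometry (Subtype.val : (ℝ ∙ n)ᗮ → E) := isometry_subtype_coe
  obtain ⟨X, rfl⟩ : ∃ X' : Set (ℝ ∙ n)ᗮ, Subtype.val '' X' = X :=
    subset_range_iff_exists_image_eq.1 (hX0.trans Subtype.range_coe.superset)
  rw [hval.euclideanHausdorffMeasure_image,
    ← finrank_orthogonal_singleton (d := d) hn,
    InnerProductSpace.euclideanHausdorffMeasure_eq_volume]
  rw [← preimage_image_eq X Subtype.val_injective]
  exact (hval.antilipschitz.isBounded_preimage hX).measure_lt_top

theorem euclideanHausdorffMeasure_image_hyperplane {n : E} (hn : ‖n‖ = 1) {L : E →L[ℝ] E}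
    (hL : ∀ x, inner ℝ n (L x) = inner ℝ n x) {X : Set E} (hX0 : X ⊆ (ℝ ∙ n)ᗮ) :
    μHE[d] (L '' X) = ENNReal.ofReal |L.det| * μHE[d] X := by
  have hmaps : ∀ x ∈ (ℝ ∙ n)ᗮ, L x ∈ (ℝ ∙ n)ᗮ := fun x hx => by
    rw [Submodule.mem_orthogonal_singleton_iff_inner_right] at *
    exact (hL x).trans hx
  have hval : Isometry (Subtype.val : (ℝ ∙ n)ᗮ → E) := isometry_subtype_coe
  obtain ⟨X, rfl⟩ : ∃ X' : Set (ℝ ∙ n)ᗮ, Subtype.val '' X' = X :=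
    subset_range_iff_exists_image_eq.1 (hX0.trans Subtype.range_coe.superset)
  have himg : L '' (Subtype.val '' X) = Subtype.val '' (L.toLinearMap.restrict hmaps '' X) := by
    simp only [image_image]
    rfl
  rw [himg, hval.euclideanHausdorffMeasure_image, hval.euclideanHausdorffMeasure_image,
    ← finrank_orthogonal_singleton (d := d) hn, LinearMap.euclideanHausdorffMeasure_image,
    LinearMap.normDet_eq_norm_det, det_restrict_hyperplane hL, Real.norm_eq_abs]

end Hyperplane

/-! ### Normal displacement of a hypersurface -/

section NormalField

open Asymptotics Module

theorem eventually_norm_le_mul_of_isEquivalent {α F : Type*} [NormedAddCommGroup F] {l : Filter α}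
    {u v : α → F} (h : u ~[l] v) {K : ℝ} (hK : 1 < K) :
    ∀ᶠ x in l, ‖u x‖ ≤ K * ‖v x‖ ∧ ‖v x‖ ≤ K * ‖u x‖ := by
  filter_upwards [h.isLittleO.bound (sub_pos.2 hK), h.symm.isLittleO.bound (sub_pos.2 hK)]
    with x huv hvu
  simp only [Pi.sub_apply] at huv hvu
  constructor
  · linarith [norm_le_insert' (u x) (v x)]
  · linarith [norm_le_insert' (v x) (u x)]

theorem tendsto_fst_prod_fst {X Y : Type*} [TopologicalSpace X] [TopologicalSpace Y] (s : Set X)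
    (x : X) (y : Y) :
    Tendsto (fun p : (X × Y) × (X × Y) => (p.1.1, p.2.1))
      (𝓝[(s ×ˢ univ) ×ˢ (s ×ˢ univ)] ((x, y), (x, y))) (𝓝[s ×ˢ s] (x, x)) :=
  (Continuous.continuousWithinAt (by fun_prop)).tendsto_nhdsWithin fun _ hp => ⟨hp.1.1, hp.2.1⟩

variable {E : Type*} [NormedAddCommGroup E] [InnerProductSpace ℝ E]

/-- `N` restricts to a unit normal field of the compact `C²` hypersurface `Γ`, with derivative `A`
on `Γ`. The field `N` is extended off `Γ` constantly along the normals, whence `A N = 0`; that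
`Γ` is a surface normal to `N` is encoded by `flat`: chords of `Γ` near `y` are asymptotically
orthogonal to `N y`. -/
structure NormalField (Γ : Set E) (N : E → E) (A : E → E →L[ℝ] E) : Prop where
  isCompact : IsCompact Γ
  norm_eq_one : ∀ y ∈ Γ, ‖N y‖ = 1
  hasStrictFDerivAt : ∀ y ∈ Γ, HasStrictFDerivAt N (A y) y
  deriv_normal : ∀ y ∈ Γ, A y (N y) = 0
  inner_deriv : ∀ y ∈ Γ, ∀ h, inner ℝ (N y) (A y h) = 0
  continuousOn_deriv : ContinuousOn A Γ
  flat : ∀ y ∈ Γ, (fun p : E × E => inner ℝ (N y) (p.1 - p.2)) =o[𝓝[Γ ×ˢ Γ] (y, y)]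
    fun p => p.1 - p.2

/-- The normal displacement `(y, r) ↦ y + r N(y)`. -/
def displace (N : E → E) (z : E × ℝ) : E := z.1 + z.2 • N z.1

/-- The tangential derivative `1 + r A` of the normal displacement. -/
def displaceDeriv (A : E → E →L[ℝ] E) (z : E × ℝ) : E →L[ℝ] E :=
  ContinuousLinearMap.id ℝ E + z.2 • A z.1

/-- The Jacobian `|det (1 + r A)|` of the normal displacement. -/
def displaceJac (A : E → E →L[ℝ] E) (z : E × ℝ) : ℝ≥0 := ‖(displaceDeriv A z).det‖₊

namespace NormalField

variable {Γ : Set E} {N : E → E} {A : E → E →L[ℝ] E} (hN : NormalField Γ N A)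
include hN

theorem continuousOn_normal : ContinuousOn N Γ := fun y hy =>
  (hN.hasStrictFDerivAt y hy).continuousAt.continuousWithinAt

theorem continuousOn_displace : ContinuousOn (displace N) (Γ ×ˢ univ) :=
  continuousOn_fst.add (continuousOn_snd.smul
    (hN.continuousOn_normal.comp continuousOn_fst fun _ hz => hz.1))

theorem continuousOn_displaceJac : ContinuousOn (displaceJac A) (Γ ×ˢ univ) := by
  have h : ContinuousOn (displaceDeriv A) (Γ ×ˢ univ) :=
    continuousOn_const.add (continuousOn_snd.smul
      (hN.continuousOn_deriv.comp continuousOn_fst fun _ hz => hz.1))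
  exact ((ContinuousLinearMap.continuous_det (𝕜 := ℝ) (E := E)).comp_continuousOn h).nnnorm

theorem continuousOn_displace_slice (r : ℝ) : ContinuousOn (fun y => displace N (y, r)) Γ :=
  hN.continuousOn_displace.comp (by fun_prop) fun _ hy => ⟨hy, mem_univ _⟩

theorem continuousOn_displaceJac_slice (r : ℝ) :
    ContinuousOn (fun y => displaceJac A (y, r)) Γ :=
  hN.continuousOn_displaceJac.comp (by fun_prop) fun _ hy => ⟨hy, mem_univ _⟩

theorem displaceDeriv_normal {y : E} (hy : y ∈ Γ) (r : ℝ) :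
    displaceDeriv A (y, r) (N y) = N y := by
  simp [displaceDeriv, hN.deriv_normal y hy]

theorem inner_displaceDeriv {y : E} (hy : y ∈ Γ) (r : ℝ) (x : E) :
    inner ℝ (N y) (displaceDeriv A (y, r) x) = inner ℝ (N y) x := by
  simp [displaceDeriv, inner_add_right, inner_smul_right, hN.inner_deriv y hy]

theorem hasStrictFDerivAt_displace {y : E} (hy : y ∈ Γ) (r : ℝ) :
    HasStrictFDerivAt (displace N)
      ((displaceDeriv A (y, r)).comp (ContinuousLinearMap.fst ℝ E ℝ) +
        (ContinuousLinearMap.snd ℝ E ℝ).smulRight (N y)) (y, r) := by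
  have h1 : HasStrictFDerivAt (fun z : E × ℝ => N z.1)
      ((A y).comp (ContinuousLinearMap.fst ℝ E ℝ)) (y, r) :=
    HasStrictFDerivAt.comp (f := Prod.fst) (y, r) (hN.hasStrictFDerivAt y hy) hasStrictFDerivAt_fst
  have h2 := (hasStrictFDerivAt_fst (𝕜 := ℝ) (p := (y, r))).add
    ((hasStrictFDerivAt_snd (𝕜 := ℝ) (p := (y, r))).smul h1)
  convert! h2 using 1
  ext z <;> simp [displaceDeriv]

theorem isEquivalent_hyperplaneProj_sub {y : E} (hy : y ∈ Γ) :
    (fun p : E × E => hyperplaneProj (N y) (p.1 - p.2)) ~[𝓝[Γ ×ˢ Γ] (y, y)]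
      fun p => p.1 - p.2 := by
  have : (fun p : E × E => inner ℝ (N y) (p.1 - p.2) • N y) =o[𝓝[Γ ×ˢ Γ] (y, y)]
      fun p => p.1 - p.2 :=
    IsBigO.trans_isLittleO
      (IsBigO.of_bound ‖N y‖ (Eventually.of_forall fun p => by rw [norm_smul, mul_comm]))
      (hN.flat y hy)
  refine this.neg_left.congr_left fun p => ?_
  rw [Pi.sub_apply, hyperplaneProj_apply (hN.norm_eq_one y hy)]
  abel

theorem displace_sub_isLittleO {y : E} (hy : y ∈ Γ) (r : ℝ) :
    (fun p : (E × ℝ) × (E × ℝ) => displace N p.1 - displace N p.2 -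
        displaceDeriv A (y, r) (flatten (N y) (p.1 - p.2)))
      =o[𝓝[(Γ ×ˢ univ) ×ˢ (Γ ×ˢ univ)] ((y, r), (y, r))] fun p => p.1 - p.2 := by
  have h1 := (hN.hasStrictFDerivAt_displace hy r).isLittleO.mono
    (nhdsWithin_le_nhds (s := (Γ ×ˢ univ) ×ˢ (Γ ×ˢ univ)))
  have h2 := ((hN.isEquivalent_hyperplaneProj_sub hy).isLittleO.comp_tendsto
    (tendsto_fst_prod_fst Γ y r)).trans_isBigO
      (IsBigO.of_bound' (Eventually.of_forall fun p => norm_fst_le (p.1 - p.2)))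
  refine (h1.sub h2).congr_left fun p => ?_
  simp only [flatten, hyperplaneProj_apply (hN.norm_eq_one y hy), Function.comp_apply,
    Pi.sub_apply, map_add, map_sub, map_smul, hN.displaceDeriv_normal hy, Prod.fst_sub,
    Prod.snd_sub, add_apply, ContinuousLinearMap.comp_apply, ContinuousLinearMap.smulRight_apply,
    ContinuousLinearMap.coe_fst', ContinuousLinearMap.coe_snd']
  module

theorem sub_isBigO_flatten_sub {y : E} (hy : y ∈ Γ) (r : ℝ) :
    (fun p : (E × ℝ) × (E × ℝ) => p.1 - p.2)
      =O[𝓝[(Γ ×ˢ univ) ×ˢ (Γ ×ˢ univ)] ((y, r), (y, r))] fun p => flatten (N y) (p.1 - p.2) := by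
  have hn := hN.norm_eq_one y hy
  have hsq (p : (E × ℝ) × (E × ℝ)) : ‖flatten (N y) (p.1 - p.2)‖ ^ 2 = _ :=
    norm_hyperplaneProj_add_smul_sq hn (p.1.1 - p.2.1) (p.1.2 - p.2.2)
  refine IsBigO.prod_left ?_ ?_
  · refine ((hN.isEquivalent_hyperplaneProj_sub hy).isBigO_symm.comp_tendsto
      (tendsto_fst_prod_fst Γ y r)).trans (IsBigO.of_bound' (Eventually.of_forall fun p => ?_))
    exact le_of_sq_le_sq ((hsq p).symm ▸ le_add_of_nonneg_right (sq_nonneg _)) (norm_nonneg _)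
  · refine IsBigO.of_bound' (Eventually.of_forall fun p => le_of_sq_le_sq ?_ (norm_nonneg _))
    rw [Real.norm_eq_abs, sq_abs]
    exact (hsq p).symm ▸ le_add_of_nonneg_left (sq_nonneg _)

theorem eventually_smallSets_bilipschitz_hyperplaneProj {y : E} (hy : y ∈ Γ) {K : ℝ} (hK : 1 < K) :
    ∀ᶠ S in (𝓝[Γ] y).smallSets, ∀ a ∈ S, ∀ b ∈ S,
      ‖a - b‖ ≤ K * ‖hyperplaneProj (N y) (a - b)‖ := by
  have h := eventually_norm_le_mul_of_isEquivalent (hN.isEquivalent_hyperplaneProj_sub hy) hK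
  rw [nhdsWithin_prod_eq, eventually_prod_self_iff'] at h
  obtain ⟨s, hs, h⟩ := h
  exact eventually_smallSets.2 ⟨s, hs, fun S hS a ha b hb => (h a (hS ha) b (hS hb)).2⟩

variable [FiniteDimensional ℝ E]

theorem isEquivalent_displace_sub {y : E} (hy : y ∈ Γ) {r : ℝ}
    (hdet : (displaceDeriv A (y, r)).det ≠ 0) :
    (fun p : (E × ℝ) × (E × ℝ) => displace N p.1 - displace N p.2)
      ~[𝓝[(Γ ×ˢ univ) ×ˢ (Γ ×ˢ univ)] ((y, r), (y, r))]
        fun p => displaceDeriv A (y, r) (flatten (N y) (p.1 - p.2)) :=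
  (hN.displace_sub_isLittleO hy r).trans_isBigO <| (hN.sub_isBigO_flatten_sub hy r).trans <|
    ((displaceDeriv A (y, r)).toContinuousLinearEquivOfDetNeZero hdet).isBigO_comp_rev _ _

theorem eventually_smallSets_bilipschitz_displace {y : E} (hy : y ∈ Γ) {r : ℝ}
    (hdet : (displaceDeriv A (y, r)).det ≠ 0) {K : ℝ} (hK : 1 < K) :
    ∀ᶠ S in (𝓝[Γ ×ˢ univ] (y, r)).smallSets, ∀ a ∈ S, ∀ b ∈ S,
      ‖displace N a - displace N b‖ ≤ K * ‖displaceDeriv A (y, r) (flatten (N y) (a - b))‖ ∧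
      ‖displaceDeriv A (y, r) (flatten (N y) (a - b))‖ ≤ K * ‖displace N a - displace N b‖ := by
  have h := eventually_norm_le_mul_of_isEquivalent (hN.isEquivalent_displace_sub hy hdet) hK
  rw [nhdsWithin_prod_eq, eventually_prod_self_iff'] at h
  obtain ⟨s, hs, h⟩ := h
  exact eventually_smallSets.2 ⟨s, hs, fun S hS a ha b hb => h a (hS ha) b (hS hb)⟩

end NormalField

end NormalField

/-! ### The area and volume formulas for normal displacements -/

section AreaFormula

open Module

variable {E : Type*} [NormedAddCommGroup E] [InnerProductSpace ℝ E]

section Projection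

variable {n : E} {K : ℝ≥0} {S : Set E}

theorem injOn_hyperplaneProj (h : ∀ a ∈ S, ∀ b ∈ S, ‖a - b‖ ≤ K * ‖hyperplaneProj n (a - b)‖) :
    InjOn (hyperplaneProj n) S := by
  intro a ha b hb hab
  have := h a ha b hb
  rw [map_sub, hab, sub_self, norm_zero, mul_zero] at this
  exact sub_eq_zero.1 (norm_le_zero_iff.1 this)

theorem injOn_flatten (hn : ‖n‖ = 1) {S : Set (E × ℝ)}
    (h : ∀ r, InjOn (hyperplaneProj n) ((fun y => (y, r)) ⁻¹' S)) : InjOn (flatten n) S := by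
  rintro ⟨a, r⟩ ha ⟨b, s⟩ hb hab
  obtain rfl : r = s := by
    have := inner_flatten hn (a, r)
    rwa [hab, inner_flatten hn, eq_comm] at this
  rw [flatten, flatten, add_left_inj] at hab
  exact Prod.ext (h r ha hb hab) rfl

variable [MeasurableSpace E] [BorelSpace E]

theorem euclideanHausdorffMeasure_hyperplaneProj_image_le (n : E) (S : Set E) (k : ℕ) :
    μHE[k] (hyperplaneProj n '' S) ≤ μHE[k] S := by
  have := euclideanHausdorffMeasure_image_le_mul k (f := hyperplaneProj n) (g := id) (S := S)
    (K := 1) (fun a _ b _ => by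
      rw [dist_eq_norm, ← map_sub, NNReal.coe_one, one_mul, id, id, dist_eq_norm]
      exact norm_hyperplaneProj_le n _)
  simpa using this

theorem euclideanHausdorffMeasure_le_hyperplaneProj_image
    (h : ∀ a ∈ S, ∀ b ∈ S, ‖a - b‖ ≤ K * ‖hyperplaneProj n (a - b)‖) (k : ℕ) :
    μHE[k] S ≤ (K : ℝ≥0∞) ^ k * μHE[k] (hyperplaneProj n '' S) := by
  have := euclideanHausdorffMeasure_image_le_mul k (f := id) (g := hyperplaneProj n) (S := S)
    (K := K) (fun a ha b hb => by
      rw [id, id, dist_eq_norm, dist_eq_norm, ← map_sub]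
      exact h a ha b hb)
  simpa using this

end Projection

theorem le_mul_and_mul_le_of_comparable {K c : ℝ≥0} {J a a' b : ℝ≥0∞} {k m : ℕ} (hK : 1 ≤ K)
    (hKc : K ^ (k + m) ≤ c) (hb : b ≤ K ^ m * (J * a')) (hb' : J * a' ≤ K ^ m * b) (ha : a' ≤ a)
    (ha' : a ≤ K ^ k * a') : b ≤ c * (J * a) ∧ J * a ≤ c * b := by
  have hKc' : (K : ℝ≥0∞) ^ (k + m) ≤ c := by exact_mod_cast hKc
  have hKm : (K : ℝ≥0∞) ^ m ≤ c :=
    (pow_le_pow_right₀ (by exact_mod_cast hK) (Nat.le_add_left m k)).trans hKc'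
  constructor
  · refine hb.trans ?_
    gcongr
  · calc J * a ≤ J * (K ^ k * a') := by gcongr
      _ = K ^ k * (J * a') := by ring
      _ ≤ K ^ k * (K ^ m * b) := mul_le_mul_right hb' _
      _ = K ^ (k + m) * b := by ring
      _ ≤ c * b := by gcongr

theorem prod_restrict_apply_eq_lintegral_slice {X Y : Type*} [MeasurableSpace X] [MeasurableSpace Y]
    {μ : Measure X} {ν : Measure Y} {Γ : Set X} [SFinite (μ.restrict Γ)] [SFinite ν]
    {S : Set (X × Y)} (hS : MeasurableSet S) (hSΓ : S ⊆ Γ ×ˢ univ) :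
    (μ.restrict Γ).prod ν S = ∫⁻ y, μ ((fun x => (x, y)) ⁻¹' S) ∂ν := by
  rw [Measure.prod_apply_symm hS]
  refine lintegral_congr fun y => ?_
  rw [Measure.restrict_apply ((by fun_prop : Measurable fun x => (x, y)) hS), inter_eq_left.2]
  exact fun x hx => (hSΓ hx).1

namespace NormalField

variable [FiniteDimensional ℝ E] [MeasurableSpace E] [BorelSpace E] {Γ : Set E} {N : E → E}
  {A : E → E →L[ℝ] E} (hN : NormalField Γ N A)
include hN

theorem eventually_smallSets_displace_comparable {y : E} (hy : y ∈ Γ) {r : ℝ}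
    (hdet : (displaceDeriv A (y, r)).det ≠ 0) {K : ℝ≥0} (hK : 1 < K) (k : ℕ) :
    ∀ᶠ S in (𝓝[Γ ×ˢ univ] (y, r)).smallSets,
      μHE[k] (displace N '' S) ≤
        K ^ k * μHE[k] (displaceDeriv A (y, r) '' (flatten (N y) '' S)) ∧
      μHE[k] (displaceDeriv A (y, r) '' (flatten (N y) '' S)) ≤
        K ^ k * μHE[k] (displace N '' S) := by
  filter_upwards [hN.eventually_smallSets_bilipschitz_displace hy hdet (K := K)
    (by exact_mod_cast hK)] with S hS
  rw [image_image]
  constructor <;>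
  · refine euclideanHausdorffMeasure_image_le_mul k fun a ha b hb => ?_
    simp only [dist_eq_norm]
    rw [← map_sub, ← flatten_sub]
    first | exact (hS a ha b hb).1 | exact (hS a ha b hb).2

variable {d : ℕ} [Fact (finrank ℝ E = d + 1)]

theorem measure_lt_top : μHE[d] Γ < ⊤ := by
  refine hN.isCompact.measure_lt_top_of_nhdsWithin fun y hy => ?_
  obtain ⟨s, hs, h⟩ :=
    eventually_smallSets.1 (hN.eventually_smallSets_bilipschitz_hyperplaneProj hy one_lt_two)
  refine ⟨s ∩ Γ, inter_mem hs self_mem_nhdsWithin, ?_⟩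
  refine (euclideanHausdorffMeasure_le_hyperplaneProj_image (n := N y) (K := 2)
    (h _ inter_subset_left) d).trans_lt (ENNReal.mul_lt_top (by simp) ?_)
  refine euclideanHausdorffMeasure_hyperplane_lt_top (hN.norm_eq_one y hy)
    ((hN.isCompact.image (hyperplaneProj (N y)).continuous).isBounded.subset
      (image_mono inter_subset_right)) ?_
  rintro _ ⟨x, _, rfl⟩
  exact hyperplaneProj_mem _ x

theorem isFiniteMeasure_restrict : IsFiniteMeasure ((μHE[d] : Measure E).restrict Γ) :=
  ⟨by simpa using hN.measure_lt_top⟩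

theorem eventually_smallSets_measure_displace_slice {y : E} (hy : y ∈ Γ) {r : ℝ}
    (hdet : (displaceDeriv A (y, r)).det ≠ 0) {c : ℝ≥0} (hc : 1 < c) :
    ∀ᶠ S in (𝓝[Γ] y).smallSets,
      μHE[d] ((fun a => displace N (a, r)) '' S) ≤ c * (displaceJac A (y, r) * μHE[d] S) ∧
      displaceJac A (y, r) * μHE[d] S ≤ c * μHE[d] ((fun a => displace N (a, r)) '' S) := by
  obtain ⟨K, hK, hKc⟩ := exists_one_lt_pow_le hc (d + d)
  have hn := hN.norm_eq_one y hy
  have hincl : Tendsto (fun a : E => (a, r)) (𝓝[Γ] y) (𝓝[Γ ×ˢ univ] (y, r)) :=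
    (Continuous.continuousWithinAt (by fun_prop)).tendsto_nhdsWithin fun _ ha => ⟨ha, mem_univ _⟩
  filter_upwards [hincl.image_smallSets.eventually
      (hN.eventually_smallSets_displace_comparable hy hdet hK d),
    hN.eventually_smallSets_bilipschitz_hyperplaneProj hy (K := K) (by exact_mod_cast hK)]
    with S hS hSK
  set P := hyperplaneProj (N y) with hP
  have hflat : μHE[d] (displaceDeriv A (y, r) '' (flatten (N y) '' ((fun a => (a, r)) '' S))) =
      displaceJac A (y, r) * μHE[d] (P '' S) := by
    have hshift : flatten (N y) '' ((fun a => (a, r)) '' S) = (r • N y + ·) '' (P '' S) := by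
      simp only [image_image, flatten, add_comm, hP]
    have hdisp : displaceDeriv A (y, r) '' (flatten (N y) '' ((fun a => (a, r)) '' S)) =
        (r • N y + ·) '' (displaceDeriv A (y, r) '' (P '' S)) := by
      rw [hshift, image_image, image_image (g := (r • N y + ·))]
      simp only [map_add, map_smul, hN.displaceDeriv_normal hy]
    rw [hdisp, (isometry_add_left (r • N y)).euclideanHausdorffMeasure_image,
      euclideanHausdorffMeasure_image_hyperplane hn (hN.inner_displaceDeriv hy r), displaceJac,
      ← Real.norm_eq_abs, ofReal_norm]
    · rfl
    · rintro _ ⟨x, _, rfl⟩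
      exact hyperplaneProj_mem _ x
  rw [hflat, image_image] at hS
  exact le_mul_and_mul_le_of_comparable hK.le hKc hS.1 hS.2
    (euclideanHausdorffMeasure_hyperplaneProj_image_le _ S d)
    (euclideanHausdorffMeasure_le_hyperplaneProj_image hSK d)

theorem volume_flatten_image_comparable {y : E} (hy : y ∈ Γ) {K : ℝ≥0} {S : Set (E × ℝ)}
    (hS : MeasurableSet S) (hSΓ : S ⊆ Γ ×ˢ univ)
    (h : ∀ a ∈ S, ∀ b ∈ S, ‖a.1 - b.1‖ ≤ K * ‖hyperplaneProj (N y) (a.1 - b.1)‖) :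
    volume (flatten (N y) '' S) ≤ (μHE[d].restrict Γ).prod (volume : Measure ℝ) S ∧
      (μHE[d].restrict Γ).prod (volume : Measure ℝ) S ≤ K ^ d * volume (flatten (N y) '' S) := by
  have := hN.isFiniteMeasure_restrict (d := d)
  have hn := hN.norm_eq_one y hy
  have hslice : ∀ r : ℝ, ∀ a ∈ (fun y : E => (y, r)) ⁻¹' S, ∀ b ∈ (fun y : E => (y, r)) ⁻¹' S,
      ‖a - b‖ ≤ K * ‖hyperplaneProj (N y) (a - b)‖ :=
    fun r a ha b hb => h (a, r) ha (b, r) hb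
  have hm : MeasurableSet (flatten (N y) '' S) :=
    hS.image_of_continuousOn_injOn (continuous_flatten (N y)).continuousOn
      (injOn_flatten hn fun r => injOn_hyperplaneProj (hslice r))
  rw [volume_flatten_image (d := d) hn hm, prod_restrict_apply_eq_lintegral_slice hS hSΓ]
  constructor
  · exact lintegral_mono fun r => euclideanHausdorffMeasure_hyperplaneProj_image_le _ _ d
  · rw [← lintegral_const_mul' _ _ (by simp)]
    exact lintegral_mono fun r => euclideanHausdorffMeasure_le_hyperplaneProj_image (hslice r) d

theorem eventually_smallSets_volume_displace {y : E} (hy : y ∈ Γ) {r : ℝ}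
    (hdet : (displaceDeriv A (y, r)).det ≠ 0) {c : ℝ≥0} (hc : 1 < c) :
    ∀ᶠ S in (𝓝[Γ ×ˢ univ] (y, r)).smallSets, MeasurableSet S →
      volume (displace N '' S) ≤
        c * (displaceJac A (y, r) * (μHE[d].restrict Γ).prod (volume : Measure ℝ) S) ∧
      displaceJac A (y, r) * (μHE[d].restrict Γ).prod (volume : Measure ℝ) S ≤
        c * volume (displace N '' S) := by
  obtain ⟨K, hK, hKc⟩ := exists_one_lt_pow_le hc (d + (d + 1))
  have hfst : Tendsto Prod.fst (𝓝[Γ ×ˢ (univ : Set ℝ)] (y, r)) (𝓝[Γ] y) :=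
    continuous_fst.continuousWithinAt.tendsto_nhdsWithin fun _ hz => hz.1
  filter_upwards [hN.eventually_smallSets_displace_comparable hy hdet hK (d + 1),
    hfst.image_smallSets.eventually
      (hN.eventually_smallSets_bilipschitz_hyperplaneProj hy (K := K) (by exact_mod_cast hK)),
    eventually_smallSets_subset.2 self_mem_nhdsWithin] with S hdisp hproj hSΓ hS
  have hflat := hN.volume_flatten_image_comparable (d := d) hy hS hSΓ fun a ha b hb =>
    hproj _ (mem_image_of_mem _ ha) _ (mem_image_of_mem _ hb)
  rw [← (Fact.out : finrank ℝ E = d + 1), InnerProductSpace.euclideanHausdorffMeasure_eq_volume,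
    Measure.addHaar_image_continuousLinearMap, ← Real.norm_eq_abs, ofReal_norm,
    (Fact.out : finrank ℝ E = d + 1)] at hdisp
  exact le_mul_and_mul_le_of_comparable hK.le hKc hdisp.1 hdisp.2 hflat.1 hflat.2

theorem measure_displace_slice {r : ℝ} (hdet : ∀ y ∈ Γ, (displaceDeriv A (y, r)).det ≠ 0)
    (hinj : InjOn (fun y => displace N (y, r)) Γ) {S : Set E} (hS : MeasurableSet S)
    (hSΓ : S ⊆ Γ) :
    μHE[d] ((fun y => displace N (y, r)) '' S) = ∫⁻ y in S, displaceJac A (y, r) ∂μHE[d] :=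
  measure_image_eq_setLIntegral_of_eventually_smallSets hN.isCompact.isClosed.measurableSet
    (hN.continuousOn_displace_slice r) hinj (hN.continuousOn_displaceJac_slice r)
    (fun y hy => nnnorm_pos.2 (hdet y hy))
    (fun y hy _ hc => (hN.eventually_smallSets_measure_displace_slice hy (hdet y hy) hc).mono
      fun _ h _ => h) hS hSΓ

theorem measure_displace_slice_lt_top {r : ℝ} (hdet : ∀ y ∈ Γ, (displaceDeriv A (y, r)).det ≠ 0)
    (hinj : InjOn (fun y => displace N (y, r)) Γ) :
    μHE[d] ((fun y => displace N (y, r)) '' Γ) < ⊤ := by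
  have hΓ := hN.isCompact.isClosed.measurableSet
  rw [hN.measure_displace_slice hdet hinj hΓ Subset.rfl]
  obtain ⟨M, hM⟩ := hN.isCompact.bddAbove_image (hN.continuousOn_displaceJac_slice r)
  exact setLIntegral_lt_top_of_bddAbove hN.measure_lt_top.ne ⟨M, hM⟩

theorem setIntegral_displace_slice {F : Type*} [NormedAddCommGroup F] [NormedSpace ℝ F]
    [SecondCountableTopology F] {r : ℝ} (hdet : ∀ y ∈ Γ, (displaceDeriv A (y, r)).det ≠ 0)
    (hinj : InjOn (fun y => displace N (y, r)) Γ) {f : E → F}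
    (hf : ContinuousOn f ((fun y => displace N (y, r)) '' Γ)) :
    ∫ x in (fun y => displace N (y, r)) '' Γ, f x ∂μHE[d] =
      ∫ y in Γ, displaceJac A (y, r) • f (displace N (y, r)) ∂μHE[d] :=
  setIntegral_image_of_measure_image hN.isCompact.isClosed.measurableSet
    (hN.continuousOn_displace_slice r) hinj (hN.continuousOn_displaceJac_slice r)
    (fun _ hS hSB => hN.measure_displace_slice hdet hinj hS hSB) f hf

theorem setIntegral_displace {F : Type*} [NormedAddCommGroup F] [NormedSpace ℝ F]
    [SecondCountableTopology F] {I : Set ℝ} (hI : MeasurableSet I)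
    (hdet : ∀ z ∈ Γ ×ˢ I, (displaceDeriv A z).det ≠ 0)
    (hinj : InjOn (displace N) (Γ ×ˢ I)) {f : E → F}
    (hf : ContinuousOn f (displace N '' (Γ ×ˢ I))) :
    ∫ x in displace N '' (Γ ×ˢ I), f x =
      ∫ z in Γ ×ˢ I, displaceJac A z • f (displace N z)
        ∂((μHE[d].restrict Γ).prod (volume : Measure ℝ)) := by
  have hΓI : Γ ×ˢ I ⊆ Γ ×ˢ univ := prod_mono_right (subset_univ I)
  have hdisp := hN.continuousOn_displace.mono hΓI
  have hJ := hN.continuousOn_displaceJac.mono hΓI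
  have hB := hN.isCompact.isClosed.measurableSet.prod hI
  refine setIntegral_image_of_measure_image hB hdisp hinj hJ (fun S hS hSB => ?_) f hf
  exact measure_image_eq_setLIntegral_of_eventually_smallSets hB hdisp hinj hJ
    (fun z hz => nnnorm_pos.2 (hdet z hz)) (fun z hz c hc =>
      (hN.eventually_smallSets_volume_displace hz.1 (hdet z hz) hc).filter_mono
        (monotone_smallSets (nhdsWithin_mono _ hΓI))) hS hSB

end NormalField

end AreaFormula

/-! ### Coordinates along a transversal vector field -/

section TransversalCoordinates

variable {E P : Type*} [NormedAddCommGroup E] [NormedSpace ℝ E] [NormedAddCommGroup P]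
  [NormedSpace ℝ P]

/-- The map `(y, r, t) ↦ (y + r n(y, t), φ(y, t), t)`, which straightens the hypersurface
`{φ = 0}` and the field `n` simultaneously when `n` is transversal to the hypersurface. -/
def straighten (n : E × P → E) (φ : E × P → ℝ) (p : E × ℝ × P) : E × ℝ × P :=
  (p.1 + p.2.1 • n (p.1, p.2.2), φ (p.1, p.2.2), p.2.2)

/-- The derivative `(w, a, s) ↦ (w + a n, ℓ(w, s), s)` of `straighten` on the hypersurface. -/
def straightenDeriv (n : E) (ℓ : E × P →L[ℝ] ℝ) (hn : ℓ (n, 0) ≠ 0) :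
    (E × ℝ × P) ≃L[ℝ] (E × ℝ × P) :=
  let fst := ContinuousLinearMap.fst ℝ E (ℝ × P)
  let mid := (ContinuousLinearMap.fst ℝ ℝ P).comp (ContinuousLinearMap.snd ℝ E (ℝ × P))
  let snd := (ContinuousLinearMap.snd ℝ ℝ P).comp (ContinuousLinearMap.snd ℝ E (ℝ × P))
  let coeff := (ℓ (n, 0))⁻¹ • (ℓ.comp (fst.prod snd) - mid)
  ContinuousLinearEquiv.equivOfInverse
    ((fst + mid.smulRight n).prod ((ℓ.comp (fst.prod snd)).prod snd))
    ((fst - coeff.smulRight n).prod (coeff.prod snd))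
    (fun p => by
      have h : ℓ (p.1 + p.2.1 • n, p.2.2) = ℓ (p.1, p.2.2) + p.2.1 * ℓ (n, 0) := by
        rw [← smul_eq_mul, ← map_smul, ← map_add]
        simp
      have : (ℓ (n, 0))⁻¹ * (ℓ (p.1 + p.2.1 • n, p.2.2) - ℓ (p.1, p.2.2)) = p.2.1 := by
        rw [h]
        field_simp
        ring
      simp [fst, mid, snd, coeff, this])
    (fun p => by
      have h (c : ℝ) : ℓ (p.1 - c • n, p.2.2) = ℓ (p.1, p.2.2) - c * ℓ (n, 0) := by
        rw [← smul_eq_mul, ← map_smul, ← map_sub]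
        simp
      have : ℓ (p.1, p.2.2) - (ℓ (n, 0))⁻¹ * (ℓ (p.1, p.2.2) - p.2.1) * ℓ (n, 0) = p.2.1 := by
        field_simp
        ring
      simp [fst, mid, snd, coeff, h, this])

variable {n : E × P → E} {φ : E × P → ℝ} {z₀ : E × P} {k : WithTop ℕ∞}

theorem contDiffAt_straighten (hn : ContDiffAt ℝ k n z₀) (hφ : ContDiffAt ℝ k φ z₀) (r : ℝ) :
    ContDiffAt ℝ k (straighten n φ) (z₀.1, r, z₀.2) := by
  have hproj : ContDiffAt ℝ k (fun p : E × ℝ × P => (p.1, p.2.2)) (z₀.1, r, z₀.2) := by fun_prop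
  have hn' : ContDiffAt ℝ k (fun p : E × ℝ × P => n (p.1, p.2.2)) (z₀.1, r, z₀.2) :=
    ContDiffAt.comp (g := n) _ hn hproj
  have hφ' : ContDiffAt ℝ k (fun p : E × ℝ × P => φ (p.1, p.2.2)) (z₀.1, r, z₀.2) :=
    ContDiffAt.comp (g := φ) _ hφ hproj
  exact (contDiffAt_fst.add (ContDiffAt.smul (by fun_prop) hn')).prodMk
    (hφ'.prodMk (by fun_prop))

theorem hasFDerivAt_straighten (hn : DifferentiableAt ℝ n z₀) (hφ : DifferentiableAt ℝ φ z₀)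
    (htrans : fderiv ℝ φ z₀ (n z₀, 0) ≠ 0) :
    HasFDerivAt (straighten n φ)
      (straightenDeriv (n z₀) (fderiv ℝ φ z₀) htrans : (E × ℝ × P) →L[ℝ] (E × ℝ × P))
      (z₀.1, 0, z₀.2) := by
  have hid := hasFDerivAt_id (𝕜 := ℝ) (z₀.1, (0 : ℝ), z₀.2)
  have hfst := hid.fst
  have hmid := hid.snd.fst
  have hsnd := hid.snd.snd
  have hn' := HasFDerivAt.comp (g := n) (z₀.1, (0 : ℝ), z₀.2) hn.hasFDerivAt (hfst.prodMk hsnd)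
  have hφ' := HasFDerivAt.comp (g := φ) (z₀.1, (0 : ℝ), z₀.2) hφ.hasFDerivAt (hfst.prodMk hsnd)
  convert! (hfst.add (hmid.smul hn')).prodMk (hφ'.prodMk hsnd) using 1
  ext p <;> simp [straightenDeriv]

variable [CompleteSpace E] [CompleteSpace P]

theorem exists_transversal_coordinates (hn : ContDiffAt ℝ k n z₀) (hφ : ContDiffAt ℝ k φ z₀)
    (hk : k ≠ 0) (htrans : fderiv ℝ φ z₀ (n z₀, 0) ≠ 0) (hz₀ : φ z₀ = 0) :
    ∃ Q : E × P → E × ℝ, ContDiffAt ℝ k Q z₀ ∧ Q z₀ = (z₀.1, 0) ∧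
      (∀ᶠ z in 𝓝 z₀, (Q z).1 + (Q z).2 • n ((Q z).1, z.2) = z.1 ∧ φ ((Q z).1, z.2) = 0) ∧
      ∀ᶠ p : E × ℝ × P in 𝓝 (z₀.1, 0, z₀.2), φ (p.1, p.2.2) = 0 →
        Q (p.1 + p.2.1 • n (p.1, p.2.2), p.2.2) = (p.1, p.2.1) := by
  have hG := contDiffAt_straighten hn hφ 0
  have hG' := hasFDerivAt_straighten (hn.differentiableAt hk) (hφ.differentiableAt hk) htrans
  have hfix : straighten n φ (z₀.1, 0, z₀.2) = (z₀.1, 0, z₀.2) := by simp [straighten, hz₀]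
  set g := hG.localInverse hG' hk
  have hg_smooth : ContDiffAt ℝ k g (z₀.1, 0, z₀.2) := by
    simpa only [hfix] using hG.to_localInverse hG' hk
  have hg_fix : g (z₀.1, 0, z₀.2) = (z₀.1, 0, z₀.2) := by
    simpa only [hfix] using hG.localInverse_apply_image hG' hk
  have hright : ∀ᶠ p in 𝓝 (z₀.1, (0 : ℝ), z₀.2), straighten n φ (g p) = p := by
    have := (hG.hasStrictFDerivAt' hG' hk).eventually_right_inverse
    rwa [hfix] at this
  have hincl : ContDiffAt ℝ k (fun z : E × P => (z.1, (0 : ℝ), z.2)) z₀ := by fun_prop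
  have hg_incl : ContDiffAt ℝ k (fun z : E × P => g (z.1, 0, z.2)) z₀ :=
    ContDiffAt.comp (g := g) z₀ hg_smooth hincl
  refine ⟨fun z => ((g (z.1, 0, z.2)).1, (g (z.1, 0, z.2)).2.1),
    hg_incl.fst.prodMk hg_incl.snd.fst, by simp [hg_fix], ?_, ?_⟩
  · filter_upwards [hincl.continuousAt.eventually hright] with z hz
    simp only [straighten, Prod.mk.injEq] at hz
    obtain ⟨hy, hφy, ht⟩ := hz
    rw [ht] at hy hφy
    exact ⟨hy, hφy⟩
  · filter_upwards [(hG.hasStrictFDerivAt' hG' hk).eventually_left_inverse] with p hp hφp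
    have : g (p.1 + p.2.1 • n (p.1, p.2.2), 0, p.2.2) = p := by
      rw [← hφp]
      exact hp
    simp only [this]

end TransversalCoordinates

/-! ### The closest point mapping and the signed distance -/

section Calculus

variable {E P F : Type*} [NormedAddCommGroup E] [NormedSpace ℝ E] [NormedAddCommGroup P]
  [NormedSpace ℝ P] [NormedAddCommGroup F] [NormedSpace ℝ F] {f : E × P → F} {z : E × P}

theorem fderiv_prodMk_left (h : DifferentiableAt ℝ f z) :
    fderiv ℝ (fun y => f (y, z.2)) z.1 = (fderiv ℝ f z).comp (ContinuousLinearMap.inl ℝ E P) :=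
  (HasFDerivAt.comp (g := f) z.1 h.hasFDerivAt (hasFDerivAt_prodMk_left z.1 z.2)).fderiv

theorem contDiffAt_prodMk_left {n : WithTop ℕ∞} (h : ContDiffAt ℝ n f z) :
    ContDiffAt ℝ n (fun y => f (y, z.2)) z.1 :=
  ContDiffAt.comp (g := f) z.1 h (by fun_prop)

theorem deriv_prodMk_right {f : E × ℝ → F} {z : E × ℝ} (h : DifferentiableAt ℝ f z) :
    deriv (fun s => f (z.1, s)) z.2 = fderiv ℝ f z (0, 1) := by
  have hslice : HasFDerivAt (fun s => f (z.1, s))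
      ((fderiv ℝ f z).comp (ContinuousLinearMap.inr ℝ E ℝ)) z.2 :=
    HasFDerivAt.comp (g := f) z.2 h.hasFDerivAt (hasFDerivAt_prodMk_right z.1 z.2)
  simpa using hslice.hasDerivAt.deriv

end Calculus

section SpatialGradient

variable {E : Type*} [NormedAddCommGroup E] [InnerProductSpace ℝ E] [CompleteSpace E]

/-- The spatial gradient of a function on space-time. -/
def spaceGrad (φ : E × ℝ → ℝ) (z : E × ℝ) : E := gradient (fun y => φ (y, z.2)) z.1

/-- The normalized spatial gradient, a unit normal to the level sets of `φ(·, t)`. -/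
def unitGrad (φ : E × ℝ → ℝ) (z : E × ℝ) : E := ‖spaceGrad φ z‖⁻¹ • spaceGrad φ z

variable {φ : E × ℝ → ℝ} {z : E × ℝ}

theorem inner_spaceGrad (h : DifferentiableAt ℝ φ z) (w : E) :
    inner ℝ (spaceGrad φ z) w = fderiv ℝ φ z (w, 0) := by
  rw [spaceGrad, inner_gradient_left, fderiv_prodMk_left h, ContinuousLinearMap.comp_apply,
    ContinuousLinearMap.inl_apply]

theorem contDiffAt_spaceGrad (hφ : ContDiffAt ℝ ∞ φ z) : ContDiffAt ℝ ∞ (spaceGrad φ) z := by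
  have hderiv : ContDiffAt ℝ ∞ (fderiv ℝ φ) z := hφ.fderiv_right (by simp)
  have hdual : ContDiffAt ℝ ∞ (fun z => (InnerProductSpace.toDual ℝ E).symm
      ((fderiv ℝ φ z).comp (ContinuousLinearMap.inl ℝ E ℝ))) z :=
    (InnerProductSpace.toDual ℝ E).symm.contDiff.contDiffAt.comp z
      (hderiv.clm_comp contDiffAt_const)
  refine hdual.congr_of_eventuallyEq ?_
  filter_upwards [(hφ.of_le (mod_cast le_top) : ContDiffAt ℝ 1 φ z).eventually (by simp)] with w hw
  rw [spaceGrad, gradient, fderiv_prodMk_left (hw.differentiableAt (by simp))]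

theorem contDiffAt_unitGrad (hφ : ContDiffAt ℝ ∞ φ z) (hg : spaceGrad φ z ≠ 0) :
    ContDiffAt ℝ ∞ (unitGrad φ) z :=
  (((contDiffAt_spaceGrad hφ).norm ℝ hg).inv (norm_ne_zero_iff.2 hg)).smul (contDiffAt_spaceGrad hφ)

theorem norm_unitGrad (hg : spaceGrad φ z ≠ 0) : ‖unitGrad φ z‖ = 1 := by
  rw [unitGrad, norm_smul, norm_inv, norm_norm, inv_mul_cancel₀ (norm_ne_zero_iff.2 hg)]

theorem norm_smul_unitGrad (hg : spaceGrad φ z ≠ 0) :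
    ‖spaceGrad φ z‖ • unitGrad φ z = spaceGrad φ z := by
  rw [unitGrad, smul_smul, mul_inv_cancel₀ (norm_ne_zero_iff.2 hg), one_smul]

theorem fderiv_unitGrad_ne_zero (h : DifferentiableAt ℝ φ z) (hg : spaceGrad φ z ≠ 0) :
    fderiv ℝ φ z (unitGrad φ z, 0) ≠ 0 := by
  rw [← inner_spaceGrad h]
  nth_rewrite 1 [← norm_smul_unitGrad hg]
  rw [inner_smul_left, real_inner_self_eq_norm_sq, norm_unitGrad hg]
  simpa using hg

theorem exists_sub_eq_smul_of_isLocalMinOn_dist {ψ : E → ℝ} {g x y : E}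
    (hψ : HasStrictFDerivAt ψ (innerSL ℝ g) y) (hg : g ≠ 0)
    (hmin : IsLocalMinOn (dist x) {w | ψ w = ψ y} y) : ∃ c : ℝ, x - y = c • g := by
  have hmin_sq : IsLocalMinOn (fun w => ‖w - x‖ ^ 2) {w | ψ w = ψ y} y := by
    filter_upwards [hmin] with w hw
    rw [dist_comm, dist_eq_norm, dist_comm, dist_eq_norm] at hw
    exact pow_le_pow_left₀ (norm_nonneg _) hw 2
  have hsq : HasStrictFDerivAt (fun w => ‖w - x‖ ^ 2) (2 • innerSL ℝ (y - x)) y := by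
    simpa using! (hasStrictFDerivAt_norm_sq (y - x)).comp y ((hasStrictFDerivAt_id y).sub_const x)
  obtain ⟨a, b, hab, hlin⟩ :=
    IsLocalExtrOn.exists_multipliers_of_hasStrictFDerivAt_1d (.inl hmin_sq) hψ hsq
  have hvec : a • g + (2 * b) • (y - x) = 0 := by
    refine ext_inner_right ℝ fun w => ?_
    have := congrArg (fun f => f w) hlin
    simp only [add_apply, smul_apply, innerSL_apply_apply, smul_eq_mul, nsmul_eq_mul, zero_apply,
      Nat.cast_ofNat] at this
    simp only [inner_add_left, inner_smul_left, inner_zero_left, conj_trivial]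
    linarith
  have hb : b ≠ 0 := by
    rintro rfl
    simp only [mul_zero, zero_smul, add_zero, smul_eq_zero, hg, or_false] at hvec
    exact hab (by simp [hvec])
  refine ⟨(2 * b)⁻¹ * a, ?_⟩
  rw [mul_smul, eq_inv_smul_iff₀ (by simpa using hb), ← sub_eq_zero, ← neg_eq_zero, ← hvec]
  module

end SpatialGradient

theorem closestPoint_spec {K : Set E3} (hK : IsCompact K) (hne : K.Nonempty) (x : E3) :
    closestPoint K x ∈ K ∧ dist x (closestPoint K x) = Metric.infDist x K := by
  have h : ∃ y ∈ K, dist x y = Metric.infDist x K :=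
    (hK.exists_infDist_eq_dist hne x).imp fun _ hy => ⟨hy.1, hy.2.symm⟩
  rw [closestPoint, dif_pos h]
  exact h.choose_spec

namespace MovingSurface

variable {T : ℝ} (S : MovingSurface T)

/-- `φ` is a local defining function of the space-time hypersurface on the open set `W`, as in
`MovingSurface.exists_defining`. -/
structure IsDefiningOn (φ : E3 × ℝ → ℝ) (W : Set (E3 × ℝ)) : Prop where
  isOpen : IsOpen W
  contDiffOn : ContDiffOn ℝ ∞ φ W
  spaceGrad_ne_zero : ∀ z ∈ W, z.2 ∈ Icc 0 T → spaceGrad φ z ≠ 0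
  mem_iff : ∀ z ∈ W, z.2 ∈ Icc 0 T → (z.1 ∈ S.Γ z.2 ↔ φ z = 0)
  normal_eq : ∀ z ∈ W, z.2 ∈ Icc 0 T → z.1 ∈ S.Γ z.2 → S.ν z.1 z.2 = unitGrad φ z
  velocity_eq : ∀ z ∈ W, z.2 ∈ Icc 0 T → z.1 ∈ S.Γ z.2 →
    S.V z.1 z.2 = -(‖spaceGrad φ z‖⁻¹ * deriv (fun s => φ (z.1, s)) z.2)

theorem IsDefiningOn.contDiffAt {S : MovingSurface T} {φ : E3 × ℝ → ℝ} {W : Set (E3 × ℝ)}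
    (h : S.IsDefiningOn φ W) {z : E3 × ℝ} (hz : z ∈ W) : ContDiffAt ℝ ∞ φ z :=
  h.contDiffOn.contDiffAt (h.isOpen.mem_nhds hz)

theorem exists_isDefiningOn {t : ℝ} (ht : t ∈ Icc 0 T) {y : E3} (hy : y ∈ S.Γ t) :
    ∃ φ W, (y, t) ∈ W ∧ S.IsDefiningOn φ W := by
  obtain ⟨W, φ, hW, hmem, hφ, h⟩ := S.exists_defining t ht y hy
  exact ⟨φ, W, hmem, hW, hφ, fun z hz hzt => (h z.1 z.2 hz hzt).1,
    fun z hz hzt => (h z.1 z.2 hz hzt).2.1, fun z hz hzt hzΓ => ((h z.1 z.2 hz hzt).2.2 hzΓ).1,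
    fun z hz hzt hzΓ => ((h z.1 z.2 hz hzt).2.2 hzΓ).2⟩

theorem isCompact_spaceTime_of_isClosed {s : Set ℝ} (hs : IsClosed s) (hsT : s ⊆ Icc 0 T) :
    IsCompact {z : E3 × ℝ | z.2 ∈ s ∧ z.1 ∈ S.Γ z.2} := by
  convert S.isCompact_spaceTime.inter_right (hs.preimage continuous_snd) using 1
  ext z
  exact ⟨fun h => ⟨⟨hsT h.1, h.2⟩, h.1⟩, fun h => ⟨h.2, h.1.2⟩⟩

theorem isCompact_Γ {t : ℝ} (ht : t ∈ Icc 0 T) : IsCompact (S.Γ t) := by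
  convert (S.isCompact_spaceTime_of_isClosed isClosed_singleton
    (singleton_subset_iff.2 ht)).image continuous_fst
  ext x
  simp

theorem proj_mem {t : ℝ} (ht : t ∈ Icc 0 T) (x : E3) : S.proj x t ∈ S.Γ t :=
  (closestPoint_spec (S.isCompact_Γ ht) (S.isConnected t ht).nonempty x).1

theorem dist_proj {t : ℝ} (ht : t ∈ Icc 0 T) (x : E3) :
    dist x (S.proj x t) = Metric.infDist x (S.Γ t) :=
  (closestPoint_spec (S.isCompact_Γ ht) (S.isConnected t ht).nonempty x).2

theorem proj_of_mem {t : ℝ} (ht : t ∈ Icc 0 T) {y : E3} (hy : y ∈ S.Γ t) : S.proj y t = y := by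
  have := S.dist_proj ht y
  rw [Metric.infDist_zero_of_mem hy, dist_eq_zero] at this
  exact this.symm

theorem sdist_of_mem {t : ℝ} (ht : t ∈ Icc 0 T) {y : E3} (hy : y ∈ S.Γ t) : S.sdist y t = 0 := by
  rw [sdist, S.proj_of_mem ht hy, sub_self, inner_zero_left]

theorem norm_normal {t : ℝ} (ht : t ∈ Icc 0 T) {y : E3} (hy : y ∈ S.Γ t) : ‖S.ν y t‖ = 1 := by
  obtain ⟨φ, W, hmem, hφ⟩ := S.exists_isDefiningOn ht hy
  rw [hφ.normal_eq (y, t) hmem ht hy, norm_unitGrad (hφ.spaceGrad_ne_zero (y, t) hmem ht)]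

theorem exists_sub_proj_eq_smul {t : ℝ} (ht : t ∈ Icc 0 T) (x : E3) :
    ∃ c : ℝ, x - S.proj x t = c • S.ν (S.proj x t) t := by
  have hy := S.proj_mem ht x
  have hdist := S.dist_proj ht x
  set y := S.proj x t
  obtain ⟨φ, W, hmem, hφ⟩ := S.exists_isDefiningOn ht hy
  have hg := hφ.spaceGrad_ne_zero (y, t) hmem ht
  have hφy : φ (y, t) = 0 := (hφ.mem_iff (y, t) hmem ht).1 hy
  have hderiv : HasStrictFDerivAt (fun w => φ (w, t)) (innerSL ℝ (spaceGrad φ (y, t))) y := by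
    have := (contDiffAt_prodMk_left (hφ.contDiffAt hmem)).hasStrictFDerivAt (by simp)
    convert! this using 1
    ext w
    rw [innerSL_apply_apply, spaceGrad, inner_gradient_left]
  have hW : ∀ᶠ w in 𝓝 y, (w, t) ∈ W :=
    (by fun_prop : Continuous fun w : E3 => (w, t)).continuousAt.preimage_mem_nhds
      (hφ.isOpen.mem_nhds hmem)
  have hmin : IsLocalMinOn (dist x) {w | φ (w, t) = φ (y, t)} y := by
    filter_upwards [mem_nhdsWithin_of_mem_nhds hW, self_mem_nhdsWithin] with w hwW hwφ
    exact hdist.le.trans <| Metric.infDist_le_dist_of_mem <|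
      (hφ.mem_iff (w, t) hwW ht).2 (Eq.trans hwφ hφy)
  obtain ⟨c, hc⟩ := exists_sub_eq_smul_of_isLocalMinOn_dist hderiv hg hmin
  refine ⟨c * ‖spaceGrad φ (y, t)‖, ?_⟩
  rw [hc, hφ.normal_eq (y, t) hmem ht hy, mul_smul, norm_smul_unitGrad hg]

theorem sub_proj_eq_sdist_smul {t : ℝ} (ht : t ∈ Icc 0 T) (x : E3) :
    x - S.proj x t = S.sdist x t • S.ν (S.proj x t) t := by
  obtain ⟨c, hc⟩ := S.exists_sub_proj_eq_smul ht x
  rw [sdist, hc, inner_smul_left, real_inner_self_eq_norm_sq, S.norm_normal ht (S.proj_mem ht x)]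
  simp

theorem proj_add_sdist_smul {t : ℝ} (ht : t ∈ Icc 0 T) (x : E3) :
    S.proj x t + S.sdist x t • S.ν (S.proj x t) t = x := by
  rw [← S.sub_proj_eq_sdist_smul ht, add_sub_cancel]

theorem abs_sdist {t : ℝ} (ht : t ∈ Icc 0 T) (x : E3) :
    |S.sdist x t| = Metric.infDist x (S.Γ t) := by
  rw [← S.dist_proj ht, dist_eq_norm, S.sub_proj_eq_sdist_smul ht, norm_smul,
    S.norm_normal ht (S.proj_mem ht x), mul_one, Real.norm_eq_abs]

/-- The unit normal of a moving surface, extended to be constant in the normal direction. -/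
def normalExt (z : E3 × ℝ) : E3 := S.ν (S.proj z.1 z.2) z.2

theorem norm_normalExt {z : E3 × ℝ} (hz : z.2 ∈ Icc 0 T) : ‖S.normalExt z‖ = 1 :=
  S.norm_normal hz (S.proj_mem hz z.1)

theorem exists_forall_normal_fibre {z₀ : E3 × ℝ} (ht₀ : z₀.2 ∈ Ioo 0 T)
    {P : E3 × ℝ × ℝ → Prop} (hP : ∀ᶠ p in 𝓝 (z₀.1, 0, z₀.2), P p) :
    ∃ ρ > 0, ∀ᶠ z in 𝓝 z₀, ∀ y ∈ S.Γ z.2, ∀ r, |r| < ρ → y + r • S.ν y z.2 = z.1 →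
      P (y, r, z.2) := by
  obtain ⟨δ, hδ, hball⟩ := Metric.eventually_nhds_iff.1 hP
  refine ⟨δ / 2, half_pos hδ, ?_⟩
  filter_upwards [continuous_snd.continuousAt.preimage_mem_nhds (isOpen_Ioo.mem_nhds ht₀),
    Metric.ball_mem_nhds z₀ (half_pos hδ)] with z hzt hz y hy r hr hx
  have hz₁ : dist z.1 z₀.1 < δ / 2 := (le_max_left _ _).trans_lt hz
  have hz₂ : dist z.2 z₀.2 < δ / 2 := (le_max_right _ _).trans_lt hz
  have hyz : dist y z.1 = |r| := by
    rw [← hx, dist_self_add_right, norm_smul, S.norm_normal (Ioo_subset_Icc_self hzt) hy, mul_one,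
      Real.norm_eq_abs]
  refine hball ?_
  rw [Prod.dist_eq, Prod.dist_eq, Real.dist_0_eq_abs]
  refine max_lt ?_ (max_lt ?_ ?_)
  · linarith [dist_triangle y z.1 z₀.1]
  · linarith
  · linarith

/-- `Q` inverts `(y, r) ↦ y + r ν(y, t)` at `z = (x, t)` among `y ∈ Γ(t)` and `|r| < ρ`. The local
defining function `φ` of the surface near the foot point gives access to the normal and the normal
velocity there. -/
structure IsNormalCoordAt (φ : E3 × ℝ → ℝ) (W : Set (E3 × ℝ)) (Q : E3 × ℝ → E3 × ℝ) (ρ : ℝ)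
    (z : E3 × ℝ) : Prop where
  mem_Ioo : z.2 ∈ Ioo 0 T
  contDiffAt : ContDiffAt ℝ 1 Q z
  mem_domain : ((Q z).1, z.2) ∈ W
  mem_Γ : (Q z).1 ∈ S.Γ z.2
  abs_lt : |(Q z).2| < ρ
  add_smul : (Q z).1 + (Q z).2 • S.ν (Q z).1 z.2 = z.1
  unique : ∀ y ∈ S.Γ z.2, ∀ r, |r| < ρ → y + r • S.ν y z.2 = z.1 → Q z = (y, r)

theorem exists_isNormalCoordAt {z₀ : E3 × ℝ} (hz₀ : z₀ ∈ S.spaceTime) :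
    ∃ φ W, S.IsDefiningOn φ W ∧
      ∃ Q, ∃ ρ > 0, ∀ᶠ z in 𝓝 z₀, S.IsNormalCoordAt φ W Q ρ z := by
  obtain ⟨ht₀, hy₀⟩ := hz₀
  have ht₀' := Ioo_subset_Icc_self ht₀
  obtain ⟨φ, W, hmem, hφ⟩ := S.exists_isDefiningOn ht₀' hy₀
  have hg := hφ.spaceGrad_ne_zero z₀ hmem ht₀'
  have hφ₀ := hφ.contDiffAt hmem
  obtain ⟨Q, hQ, hQ₀, hright, hleft⟩ := exists_transversal_coordinates
    (contDiffAt_unitGrad hφ₀ hg) hφ₀ (by simp)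
    (fderiv_unitGrad_ne_zero (hφ₀.differentiableAt (by simp)) hg) ((hφ.mem_iff z₀ hmem ht₀').1 hy₀)
  have hdomain : ∀ᶠ p : E3 × ℝ × ℝ in 𝓝 (z₀.1, 0, z₀.2), (p.1, p.2.2) ∈ W :=
    (by fun_prop : Continuous fun p : E3 × ℝ × ℝ => (p.1, p.2.2)).continuousAt.preimage_mem_nhds
      (hφ.isOpen.mem_nhds hmem)
  obtain ⟨ρ, hρ, hfibre⟩ := S.exists_forall_normal_fibre ht₀ (hleft.and hdomain)
  have hQW : ∀ᶠ z in 𝓝 z₀, ((Q z).1, z.2) ∈ W :=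
    (hQ.continuousAt.fst.prodMk continuousAt_snd).preimage_mem_nhds
      (hφ.isOpen.mem_nhds (by rwa [hQ₀]))
  have hQρ : ∀ᶠ z in 𝓝 z₀, |(Q z).2| < ρ :=
    hQ.continuousAt.snd.abs.eventually_lt_const (by simpa [hQ₀] using hρ)
  have hQ₁ : ∀ᶠ z in 𝓝 z₀, ContDiffAt ℝ 1 Q z :=
    (hQ.of_le (mod_cast le_top)).eventually (by simp)
  refine ⟨φ, W, hφ, Q, ρ, hρ, ?_⟩
  filter_upwards [hright, hfibre, hQW, hQρ, hQ₁,
    continuous_snd.continuousAt.preimage_mem_nhds (isOpen_Ioo.mem_nhds ht₀)]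
    with z hzright hzfibre hzW hzρ hz₁ hzt
  have hzt' := Ioo_subset_Icc_self hzt
  have hzΓ : (Q z).1 ∈ S.Γ z.2 := (hφ.mem_iff _ hzW hzt').2 hzright.2
  refine ⟨hzt, hz₁, hzW, hzΓ, hzρ, ?_, fun y hy r hr hx => ?_⟩
  · rw [hφ.normal_eq _ hzW hzt' hzΓ, hzright.1]
  · obtain ⟨hQeq, hyW⟩ := hzfibre y hy r hr hx
    have h := hQeq ((hφ.mem_iff _ hyW hzt').1 hy)
    rw [← hφ.normal_eq _ hyW hzt' hy] at h
    rwa [hx] at h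

section NormalCoord

variable {S} {φ : E3 × ℝ → ℝ} {W : Set (E3 × ℝ)} {Q : E3 × ℝ → E3 × ℝ} {ρ : ℝ} {z : E3 × ℝ}

theorem IsNormalCoordAt.eq_proj_sdist (h : S.IsNormalCoordAt φ W Q ρ z) :
    Q z = (S.proj z.1 z.2, S.sdist z.1 z.2) := by
  have hzt := Ioo_subset_Icc_self h.mem_Ioo
  refine h.unique _ (S.proj_mem hzt z.1) _ ?_ (S.proj_add_sdist_smul hzt z.1)
  calc |S.sdist z.1 z.2| = Metric.infDist z.1 (S.Γ z.2) := S.abs_sdist hzt z.1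
    _ ≤ dist z.1 (Q z).1 := Metric.infDist_le_dist_of_mem h.mem_Γ
    _ = |(Q z).2| := by
      conv_lhs => rw [← h.add_smul]
      rw [dist_self_add_left, norm_smul, S.norm_normal hzt h.mem_Γ, mul_one, Real.norm_eq_abs]
    _ < ρ := h.abs_lt

theorem IsNormalCoordAt.inner_fderiv (hφ : S.IsDefiningOn φ W)
    (h : ∀ᶠ w in 𝓝 z, S.IsNormalCoordAt φ W Q ρ w) (w : E3 × ℝ) :
    inner ℝ (S.ν (Q z).1 z.2) (fderiv ℝ (fun z => (Q z).1) z w) = w.2 * S.V (Q z).1 z.2 := by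
  have hz := h.self_of_nhds
  have hzt := Ioo_subset_Icc_self hz.mem_Ioo
  set ξ : E3 × ℝ := ((Q z).1, z.2)
  have hφd : DifferentiableAt ℝ φ ξ := (hφ.contDiffAt hz.mem_domain).differentiableAt (by simp)
  have hcomp : HasFDerivAt (fun z : E3 × ℝ => φ ((Q z).1, z.2)) ((fderiv ℝ φ ξ).comp
      ((fderiv ℝ (fun z => (Q z).1) z).prod (ContinuousLinearMap.snd ℝ E3 ℝ))) z :=
    HasFDerivAt.comp (g := φ) z hφd.hasFDerivAt
      ((hz.contDiffAt.fst.differentiableAt (by simp)).hasFDerivAt.prodMk hasFDerivAt_snd)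
  have hzero : (fun z : E3 × ℝ => φ ((Q z).1, z.2)) =ᶠ[𝓝 z] fun _ => 0 :=
    h.mono fun w hw =>
      (hφ.mem_iff _ hw.mem_domain (Ioo_subset_Icc_self hw.mem_Ioo)).1 hw.mem_Γ
  set a := fderiv ℝ (fun z => (Q z).1) z w
  have hchain : fderiv ℝ φ ξ (a, w.2) = 0 := congrArg (fun L => L w)
    (hcomp.unique ((hasFDerivAt_const (0 : ℝ) z).congr_of_eventuallyEq hzero))
  have hsplit : ((a, w.2) : E3 × ℝ) = (a, 0) + w.2 • (0, 1) := by ext <;> simp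
  have hinner : inner ℝ (spaceGrad φ ξ) a = -(w.2 * deriv (fun s => φ ((Q z).1, s)) z.2) := by
    rw [hsplit, map_add, map_smul, ← inner_spaceGrad hφd, ← deriv_prodMk_right hφd,
      smul_eq_mul] at hchain
    linarith
  rw [hφ.normal_eq _ hz.mem_domain hzt hz.mem_Γ, hφ.velocity_eq _ hz.mem_domain hzt hz.mem_Γ,
    unitGrad, real_inner_smul_left, hinner]
  ring

end NormalCoord

/-- Regularity of the closest point mapping, the signed distance and the extended normal at a point
`z = (x, t)` of space-time, with uniqueness of the normal coordinates of `x` of height less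
than `ρ`. -/
structure RegularAt (ρ : ℝ) (z : E3 × ℝ) : Prop where
  mem_Ioo : z.2 ∈ Ioo 0 T
  proj_sdist_eq : ∀ y ∈ S.Γ z.2, ∀ r, |r| < ρ → y + r • S.ν y z.2 = z.1 →
    S.proj z.1 z.2 = y ∧ S.sdist z.1 z.2 = r
  contDiffAt_proj : ContDiffAt ℝ 1 (Function.uncurry S.proj) z
  contDiffAt_sdist : ContDiffAt ℝ 1 (Function.uncurry S.sdist) z
  contDiffAt_normalExt : ContDiffAt ℝ 1 S.normalExt z
  inner_fderiv_proj : ∀ w : E3 × ℝ, inner ℝ (S.normalExt z)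
    (fderiv ℝ (Function.uncurry S.proj) z w) = w.2 * S.V (S.proj z.1 z.2) z.2

variable {S} {ρ : ℝ} {z : E3 × ℝ}

theorem RegularAt.mono {ρ' : ℝ} (h : S.RegularAt ρ z) (hρ : ρ' ≤ ρ) : S.RegularAt ρ' z :=
  { h with proj_sdist_eq := fun y hy r hr => h.proj_sdist_eq y hy r (hr.trans_le hρ) }

theorem IsNormalCoordAt.regularAt {φ : E3 × ℝ → ℝ} {W : Set (E3 × ℝ)} {Q : E3 × ℝ → E3 × ℝ}
    (hφ : S.IsDefiningOn φ W) (h : ∀ᶠ w in 𝓝 z, S.IsNormalCoordAt φ W Q ρ w) :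
    S.RegularAt ρ z := by
  have hz := h.self_of_nhds
  have hzt := Ioo_subset_Icc_self hz.mem_Ioo
  have hQz : (Q z).1 = S.proj z.1 z.2 := congrArg Prod.fst hz.eq_proj_sdist
  have hproj : Function.uncurry S.proj =ᶠ[𝓝 z] fun z => (Q z).1 :=
    h.mono fun w hw => (congrArg Prod.fst hw.eq_proj_sdist).symm
  have hsdist : Function.uncurry S.sdist =ᶠ[𝓝 z] fun z => (Q z).2 :=
    h.mono fun w hw => (congrArg Prod.snd hw.eq_proj_sdist).symm
  have hnormal : S.normalExt =ᶠ[𝓝 z] fun z => unitGrad φ ((Q z).1, z.2) := by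
    filter_upwards [h] with w hw
    have hQw : (Q w).1 = S.proj w.1 w.2 := congrArg Prod.fst hw.eq_proj_sdist
    rw [normalExt, ← hQw]
    exact hφ.normal_eq _ hw.mem_domain (Ioo_subset_Icc_self hw.mem_Ioo) hw.mem_Γ
  refine ⟨hz.mem_Ioo, fun y hy r hr hx => ?_, hz.contDiffAt.fst.congr_of_eventuallyEq hproj,
    hz.contDiffAt.snd.congr_of_eventuallyEq hsdist, ?_, fun w => ?_⟩
  · exact Prod.mk_inj.1 (hz.eq_proj_sdist.symm.trans (hz.unique y hy r hr hx))
  · have hunit := contDiffAt_unitGrad (hφ.contDiffAt hz.mem_domain)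
      (hφ.spaceGrad_ne_zero _ hz.mem_domain hzt)
    exact (ContDiffAt.comp (g := unitGrad φ) z (hunit.of_le (mod_cast le_top))
      (hz.contDiffAt.fst.prodMk contDiffAt_snd)).congr_of_eventuallyEq hnormal
  · rw [normalExt, ← hQz, hproj.fderiv_eq]
    exact IsNormalCoordAt.inner_fderiv hφ h w

variable (S) in
theorem eventually_regularAt {z₀ : E3 × ℝ} (hz₀ : z₀ ∈ S.spaceTime) :
    ∃ ρ > 0, ∀ᶠ z in 𝓝 z₀, S.RegularAt ρ z := by
  obtain ⟨φ, W, hφ, Q, ρ, hρ, h⟩ := S.exists_isNormalCoordAt hz₀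
  exact ⟨ρ, hρ, h.eventually_nhds.mono fun z hz => IsNormalCoordAt.regularAt hφ hz⟩

variable (S) in
theorem exists_regularAt_of_isCompact {K : Set (E3 × ℝ)} (hK : IsCompact K)
    (hKS : K ⊆ S.spaceTime) : ∃ ρ > 0, ∀ z ∈ K, ∀ᶠ w in 𝓝 z, S.RegularAt ρ w := by
  refine hK.induction_on (p := fun s => ∃ ρ > 0, ∀ z ∈ s, ∀ᶠ w in 𝓝 z, S.RegularAt ρ w)
    ⟨1, one_pos, by simp⟩ ?_ ?_ ?_
  · rintro s t hst ⟨ρ, hρ, h⟩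
    exact ⟨ρ, hρ, fun z hz => h z (hst hz)⟩
  · rintro s t ⟨ρ, hρ, h⟩ ⟨ρ', hρ', h'⟩
    refine ⟨min ρ ρ', lt_min hρ hρ', fun z hz => hz.elim (fun hz => ?_) fun hz => ?_⟩
    · exact (h z hz).mono fun w hw => hw.mono (min_le_left _ _)
    · exact (h' z hz).mono fun w hw => hw.mono (min_le_right _ _)
  · intro z hz
    obtain ⟨ρ, hρ, h⟩ := S.eventually_regularAt (hKS hz)
    exact ⟨_, mem_nhdsWithin_of_mem_nhds h.eventually_nhds, ρ, hρ, fun w hw => hw⟩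

variable (S) in
theorem exists_regular_tube {a b : ℝ} (ha : 0 < a) (hb : b < T) :
    ∃ ε₀ > 0, ∀ t ∈ Icc a b, ∀ x, Metric.infDist x (S.Γ t) ≤ ε₀ →
      ∀ᶠ w in 𝓝 (x, t), S.RegularAt (2 * ε₀) w := by
  have habT : Icc a b ⊆ Icc 0 T := Icc_subset_Icc ha.le hb.le
  set K := {z : E3 × ℝ | z.2 ∈ Icc a b ∧ z.1 ∈ S.Γ z.2}
  have hK : IsCompact K := S.isCompact_spaceTime_of_isClosed isClosed_Icc habT
  have hKS : K ⊆ S.spaceTime := fun z hz => ⟨⟨ha.trans_le hz.1.1, hz.1.2.trans_lt hb⟩, hz.2⟩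
  obtain ⟨ρ, hρ, hreg⟩ := S.exists_regularAt_of_isCompact hK hKS
  obtain ⟨δ, hδ, hthick⟩ := hK.exists_cthickening_subset_open
    (isOpen_setOfPred_eventually_nhds : IsOpen {z | ∀ᶠ w in 𝓝 z, S.RegularAt ρ w}) hreg
  refine ⟨min δ (ρ / 2), lt_min hδ (half_pos hρ), fun t ht x hx => ?_⟩
  have hmem : (x, t) ∈ Metric.cthickening δ K := by
    refine Metric.mem_cthickening_of_dist_le (x, t) (S.proj x t, t) δ K
      ⟨ht, S.proj_mem (habT ht) x⟩ ?_
    rw [Prod.dist_eq, dist_self, S.dist_proj (habT ht)]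
    exact max_le (hx.trans (min_le_left _ _)) hδ.le
  refine (hthick hmem : ∀ᶠ w in 𝓝 (x, t), S.RegularAt ρ w).mono fun w hw => hw.mono ?_
  linarith [min_le_right δ (ρ / 2)]

theorem inner_fderiv_normalExt (hz : ∀ᶠ w in 𝓝 z, S.RegularAt ρ w) (w : E3 × ℝ) :
    inner ℝ (S.normalExt z) (fderiv ℝ S.normalExt z w) = 0 := by
  have hsq : HasFDerivAt (fun w => ‖S.normalExt w‖ ^ 2) _ z :=
    (hz.self_of_nhds.contDiffAt_normalExt.differentiableAt (by simp)).hasFDerivAt.norm_sq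
  have hconst : (fun w => ‖S.normalExt w‖ ^ 2) =ᶠ[𝓝 z] fun _ => 1 := by
    filter_upwards [hz] with w hw
    rw [S.norm_normalExt (Ioo_subset_Icc_self hw.mem_Ioo), one_pow]
  simpa using congrArg (fun L => L w)
    (hsq.unique ((hasFDerivAt_const (1 : ℝ) z).congr_of_eventuallyEq hconst))

theorem fderiv_sdist (hz : ∀ᶠ w in 𝓝 z, S.RegularAt ρ w) (w : E3 × ℝ) :
    fderiv ℝ (Function.uncurry S.sdist) z w =
      inner ℝ (S.normalExt z) w.1 - w.2 * S.V (S.proj z.1 z.2) z.2 := by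
  have hreg := hz.self_of_nhds
  have hnormal := (hreg.contDiffAt_normalExt.differentiableAt (by simp)).hasFDerivAt
  have hproj := (hreg.contDiffAt_proj.differentiableAt (by simp)).hasFDerivAt
  have hsdist := (hreg.contDiffAt_sdist.differentiableAt (by simp)).hasFDerivAt
  have hdecomp : (fun w : E3 × ℝ => w.1) =ᶠ[𝓝 z]
      (Function.uncurry S.proj + Function.uncurry S.sdist • S.normalExt) :=
    hz.mono fun w hw => (S.proj_add_sdist_smul (Ioo_subset_Icc_self hw.mem_Ioo) w.1).symm
  have hinner := congrArg (fun L => inner ℝ (S.normalExt z) (L w))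
    ((hasFDerivAt_fst (𝕜 := ℝ) (p := z)).unique
      ((hproj.add (hsdist.smul hnormal)).congr_of_eventuallyEq hdecomp))
  simp only [ContinuousLinearMap.coe_fst', add_apply, smul_apply,
    ContinuousLinearMap.smulRight_apply, inner_add_right, inner_smul_right,
    inner_fderiv_normalExt hz, real_inner_self_eq_norm_sq,
    S.norm_normalExt (Ioo_subset_Icc_self hreg.mem_Ioo), hreg.inner_fderiv_proj] at hinner
  linarith

theorem eventually_normal_line (hz : ∀ᶠ w in 𝓝 z, S.RegularAt ρ w) (hd : |S.sdist z.1 z.2| < ρ) :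
    ∀ᶠ s : ℝ in 𝓝 0, S.proj (z.1 + s • S.normalExt z) z.2 = S.proj z.1 z.2 ∧
      S.sdist (z.1 + s • S.normalExt z) z.2 = S.sdist z.1 z.2 + s := by
  have hline : Tendsto (fun s : ℝ => (z.1 + s • S.normalExt z, z.2)) (𝓝 0) (𝓝 z) := by
    simpa using (by fun_prop : Continuous fun s : ℝ => (z.1 + s • S.normalExt z, z.2)).tendsto 0
  have hheight : ∀ᶠ s : ℝ in 𝓝 0, |S.sdist z.1 z.2 + s| < ρ :=
    (by fun_prop : Continuous fun s : ℝ => |S.sdist z.1 z.2 + s|).continuousAt.eventually_lt_const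
      (by simpa using hd)
  have hzt := Ioo_subset_Icc_self hz.self_of_nhds.mem_Ioo
  filter_upwards [hline.eventually hz, hheight] with s hreg hs
  refine hreg.proj_sdist_eq _ (S.proj_mem hzt z.1) _ hs ?_
  conv_rhs => rw [← S.proj_add_sdist_smul hzt z.1]
  simp only [normalExt]
  module

theorem fderiv_comp_proj_normal {F : Type*} [NormedAddCommGroup F] [NormedSpace ℝ F]
    (hz : ∀ᶠ w in 𝓝 z, S.RegularAt ρ w) (hd : |S.sdist z.1 z.2| < ρ) {c : E3 → ℝ → F}
    (hc : DifferentiableAt ℝ (fun w : E3 × ℝ => c (S.proj w.1 w.2) w.2) z) :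
    fderiv ℝ (fun w : E3 × ℝ => c (S.proj w.1 w.2) w.2) z (S.normalExt z, 0) = 0 := by
  have hline : HasDerivAt (fun s : ℝ => (z.1 + s • S.normalExt z, z.2)) (S.normalExt z, 0) 0 := by
    refine HasDerivAt.prodMk ?_ (hasDerivAt_const 0 z.2)
    simpa using ((hasDerivAt_id (0 : ℝ)).smul_const (S.normalExt z)).const_add z.1
  have hcomp := HasFDerivAt.comp_hasDerivAt (l := fun w : E3 × ℝ => c (S.proj w.1 w.2) w.2) 0
    (by simpa using hc.hasFDerivAt) hline
  refine hcomp.unique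
    ((hasDerivAt_const (0 : ℝ) (c (S.proj z.1 z.2) z.2)).congr_of_eventuallyEq ?_)
  filter_upwards [eventually_normal_line hz hd] with s hs
  simp [hs.1]

end MovingSurface

/-! ### The volume element of a tubular neighbourhood -/

instance : Fact (Module.finrank ℝ E3 = 2 + 1) := ⟨by simp⟩

section Matrices

theorem sum_smul_e (a : E3) : ∑ i, a i • e i = a := by
  ext j
  fin_cases j <;> simp [e, Fin.sum_univ_three]

theorem sum_mul_gradMatrix (F : E3 → E3) (x a : E3) (j : Fin 3) :
    ∑ i, a i * gradMatrix F x i j = (fderiv ℝ F x a) j := by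
  conv_rhs => rw [← sum_smul_e a]
  simp [gradMatrix]

theorem abs_gradMatrix_le (F : E3 → E3) (x : E3) (i j : Fin 3) :
    |gradMatrix F x i j| ≤ ‖fderiv ℝ F x‖ := by
  calc |gradMatrix F x i j| ≤ ‖fderiv ℝ F x (e i)‖ := by
        simpa [gradMatrix] using PiLp.norm_apply_le (fderiv ℝ F x (e i)) j
    _ ≤ ‖fderiv ℝ F x‖ := (fderiv ℝ F x).unit_le_opNorm _ (by simp [e])

theorem det_one_add_smul_fderiv (F : E3 → E3) (x : E3) (r : ℝ) :
    (ContinuousLinearMap.id ℝ E3 + r • fderiv ℝ F x).det = (1 + r • gradMatrix F x).det := by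
  rw [ContinuousLinearMap.det, ← LinearMap.det_toMatrix (EuclideanSpace.basisFun (Fin 3) ℝ).toBasis,
    ← Matrix.det_transpose]
  congr 1
  ext i j
  simp only [Matrix.transpose_apply, LinearMap.toMatrix_apply, OrthonormalBasis.coe_toBasis,
    EuclideanSpace.basisFun_apply, OrthonormalBasis.coe_toBasis_repr_apply,
    EuclideanSpace.basisFun_repr, Matrix.add_apply, Matrix.smul_apply, gradMatrix, Matrix.of_apply,
    ContinuousLinearMap.coe_coe, add_apply, smul_apply, ContinuousLinearMap.id_apply,
    PiLp.add_apply, PiLp.smul_apply, e]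
  congr 1
  simp [Matrix.one_apply, eq_comm]

variable {M : Matrix (Fin 3) (Fin 3) ℝ} {B : ℝ}

theorem abs_trace_le (hM : ∀ i j, |M i j| ≤ B) : |M.trace| ≤ 3 * B := by
  rw [Matrix.trace, Fin.sum_univ_three]
  simp only [Matrix.diag_apply]
  linarith [abs_add_three (M 0 0) (M 1 1) (M 2 2), hM 0 0, hM 1 1, hM 2 2]

theorem abs_minor_le (hM : ∀ i j, |M i j| ≤ B) (i j : Fin 3) :
    |M i i * M j j - M i j * M j i| ≤ 2 * B ^ 2 := by
  have hmul : ∀ i j k l, |M i j * M k l| ≤ B ^ 2 := fun i j k l => by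
    rw [abs_mul, sq]
    exact mul_le_mul (hM _ _) (hM _ _) (abs_nonneg _) ((abs_nonneg _).trans (hM i j))
  linarith [abs_sub (M i i * M j j) (M i j * M j i), hmul i i j j, hmul i j j i]

theorem abs_det_one_add_smul_sub_le (hM : ∀ i j, |M i j| ≤ B) {r : ℝ} (hr : |r| ≤ 1) :
    |(1 + r • M).det - (1 + r * M.trace)| ≤ (6 * B ^ 2 + 6 * B ^ 3) * r ^ 2 := by
  have hdet : |M.det| ≤ 6 * B ^ 3 := by
    simpa [Nat.factorial] using Matrix.det_le (A := M) (abv := AbsoluteValue.abs) (x := B) hM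
  have hexp : (1 + r • M).det - (1 + r * M.trace) =
      ((M 0 0 * M 1 1 - M 0 1 * M 1 0) + (M 0 0 * M 2 2 - M 0 2 * M 2 0) +
        (M 1 1 * M 2 2 - M 1 2 * M 2 1) + r * M.det) * r ^ 2 := by
    simp only [Matrix.det_fin_three, Matrix.trace, Fin.sum_univ_three, Matrix.add_apply,
      Matrix.smul_apply, Matrix.diag_apply, Matrix.one_apply_eq, smul_eq_mul, ne_eq,
      Fin.reduceEq, not_false_eq_true, Matrix.one_apply_ne]
    ring
  have hrdet : |r * M.det| ≤ 6 * B ^ 3 := by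
    rw [abs_mul]
    exact (mul_le_of_le_one_left (abs_nonneg _) hr).trans hdet
  rw [hexp, abs_mul, abs_of_nonneg (sq_nonneg r)]
  gcongr
  linarith [abs_add_le ((M 0 0 * M 1 1 - M 0 1 * M 1 0) + (M 0 0 * M 2 2 - M 0 2 * M 2 0) +
      (M 1 1 * M 2 2 - M 1 2 * M 2 1)) (r * M.det),
    abs_add_three (M 0 0 * M 1 1 - M 0 1 * M 1 0) (M 0 0 * M 2 2 - M 0 2 * M 2 0)
      (M 1 1 * M 2 2 - M 1 2 * M 2 1), abs_minor_le hM 0 1, abs_minor_le hM 0 2,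
    abs_minor_le hM 1 2]

end Matrices

namespace MovingSurface

variable {T : ℝ} (S : MovingSurface T)

/-- The normal field of `MovingSurface.normalExt` at time `t`. -/
def normalAt (t : ℝ) (x : E3) : E3 := S.normalExt (x, t)

/-- The derivative of the extended normal field at time `t`; at points of the surface this is the
Weingarten map, extended by `0` to the normal direction. -/
def weingarten (t : ℝ) (x : E3) : E3 →L[ℝ] E3 := fderiv ℝ (S.normalAt t) x

theorem normalAt_of_mem {t : ℝ} (ht : t ∈ Icc 0 T) {y : E3} (hy : y ∈ S.Γ t) :
    S.normalAt t y = S.ν y t := by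
  rw [normalAt, normalExt, S.proj_of_mem ht hy]

theorem weingarten_eq {ρ : ℝ} {x : E3} {t : ℝ} (h : S.RegularAt ρ (x, t)) :
    S.weingarten t x = (fderiv ℝ S.normalExt (x, t)).comp (ContinuousLinearMap.inl ℝ E3 ℝ) :=
  fderiv_prodMk_left (h.contDiffAt_normalExt.differentiableAt (by simp))

theorem isLittleO_inner_normalAt {t : ℝ} (ht : t ∈ Ioo 0 T) {y : E3} (hy : y ∈ S.Γ t) :
    (fun p : E3 × E3 => inner ℝ (S.normalAt t y) (p.1 - p.2)) =o[𝓝[S.Γ t ×ˢ S.Γ t] (y, y)]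
      fun p => p.1 - p.2 := by
  have ht' := Ioo_subset_Icc_self ht
  obtain ⟨ρ, -, hz⟩ := S.eventually_regularAt (z₀ := (y, t)) ⟨ht, hy⟩
  have hreg := hz.self_of_nhds.contDiffAt_sdist
  have hgrad : ∀ w, fderiv ℝ (fun x => S.sdist x t) y w = inner ℝ (S.normalAt t y) w := fun w => by
    have h : fderiv ℝ (fun x => S.sdist x t) y = _ :=
      fderiv_prodMk_left (hreg.differentiableAt (by simp))
    rw [h, ContinuousLinearMap.comp_apply, fderiv_sdist hz]
    simp [normalAt]
  have hstrict := ((contDiffAt_prodMk_left hreg).hasStrictFDerivAt (by simp)).isLittleO.mono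
    (nhdsWithin_le_nhds (s := S.Γ t ×ˢ S.Γ t))
  refine hstrict.neg_left.congr' ?_ .rfl
  filter_upwards [self_mem_nhdsWithin] with p hp
  change -(S.sdist p.1 t - S.sdist p.2 t - fderiv ℝ (fun x => S.sdist x t) y (p.1 - p.2)) = _
  rw [S.sdist_of_mem ht' hp.1, S.sdist_of_mem ht' hp.2, hgrad, sub_self, zero_sub, neg_neg]

theorem normalField {t : ℝ} (ht : t ∈ Ioo 0 T) :
    NormalField (S.Γ t) (S.normalAt t) (S.weingarten t) := by
  have ht' := Ioo_subset_Icc_self ht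
  have hreg : ∀ y ∈ S.Γ t, ∃ ρ > 0, ∀ᶠ w in 𝓝 (y, t), S.RegularAt ρ w := fun y hy =>
    S.eventually_regularAt (z₀ := (y, t)) ⟨ht, hy⟩
  have hsmooth : ∀ y ∈ S.Γ t, ContDiffAt ℝ 1 (S.normalAt t) y := fun y hy => by
    obtain ⟨ρ, -, hz⟩ := hreg y hy
    exact contDiffAt_prodMk_left hz.self_of_nhds.contDiffAt_normalExt
  refine ⟨S.isCompact_Γ ht', fun y _ => S.norm_normalExt ht',
    fun y hy => (hsmooth y hy).hasStrictFDerivAt (by simp), fun y hy => ?_, fun y hy h => ?_,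
    fun y hy => ((hsmooth y hy).continuousAt_fderiv (by simp)).continuousWithinAt,
    fun y hy => S.isLittleO_inner_normalAt ht hy⟩
  · obtain ⟨ρ, hρ, hz⟩ := hreg y hy
    rw [S.weingarten_eq hz.self_of_nhds]
    exact fderiv_comp_proj_normal hz (by rwa [S.sdist_of_mem ht' hy, abs_zero]) (c := S.ν)
      (hz.self_of_nhds.contDiffAt_normalExt.differentiableAt (by simp))
  · obtain ⟨ρ, -, hz⟩ := hreg y hy
    rw [S.weingarten_eq hz.self_of_nhds]
    exact inner_fderiv_normalExt hz (h, 0)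

theorem tanProj_mul_gradMatrix {y : E3} {t : ℝ} {F : E3 → E3} (h : fderiv ℝ F y (S.ν y t) = 0) :
    S.tanProj y t * gradMatrix F y = gradMatrix F y := by
  rw [tanProj, Matrix.sub_mul, Matrix.one_mul, sub_eq_self]
  ext i j
  have hrow := sum_mul_gradMatrix F y (S.ν y t) j
  rw [h] at hrow
  simp only [Matrix.mul_apply, Matrix.of_apply, mul_assoc, ← Finset.mul_sum, hrow]
  simp

theorem meanCurv_eq {t : ℝ} (ht : t ∈ Ioo 0 T) {y : E3} (hy : y ∈ S.Γ t) :
    S.meanCurv y t = -(gradMatrix (S.normalAt t) y).trace := by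
  have h := (S.normalField ht).deriv_normal y hy
  rw [S.normalAt_of_mem (Ioo_subset_Icc_self ht) hy] at h
  have htan : S.tanGrad S.ν y t = gradMatrix (S.normalAt t) y := S.tanProj_mul_gradMatrix h
  rw [meanCurv, htan]

theorem exists_abs_gradMatrix_normalAt_le {a b : ℝ} (ha : 0 < a) (hb : b < T) :
    ∃ B, 0 ≤ B ∧ ∀ t ∈ Icc a b, ∀ y ∈ S.Γ t, ∀ i j, |gradMatrix (S.normalAt t) y i j| ≤ B := by
  obtain ⟨ε₁, hε₁, hreg⟩ := S.exists_regular_tube ha hb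
  have hregΓ : ∀ t ∈ Icc a b, ∀ y ∈ S.Γ t, S.RegularAt (2 * ε₁) (y, t) := fun t ht y hy =>
    (hreg t ht y (by rw [Metric.infDist_zero_of_mem hy]; exact hε₁.le)).self_of_nhds
  have hcont : ContinuousOn (fderiv ℝ S.normalExt)
      {z : E3 × ℝ | z.2 ∈ Icc a b ∧ z.1 ∈ S.Γ z.2} := fun z hz =>
    ((hregΓ z.2 hz.1 z.1 hz.2).contDiffAt_normalExt.continuousAt_fderiv
      (by simp)).continuousWithinAt
  obtain ⟨B, hB⟩ := (S.isCompact_spaceTime_of_isClosed isClosed_Icc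
    (Icc_subset_Icc ha.le hb.le)).exists_bound_of_continuousOn hcont
  refine ⟨|B|, abs_nonneg B, fun t ht y hy i j => ?_⟩
  have hslice : fderiv ℝ (S.normalAt t) y = _ := S.weingarten_eq (hregΓ t ht y hy)
  calc |gradMatrix (S.normalAt t) y i j| ≤ ‖fderiv ℝ (S.normalAt t) y‖ := abs_gradMatrix_le ..
    _ ≤ ‖fderiv ℝ S.normalExt (y, t)‖ * ‖ContinuousLinearMap.inl ℝ E3 ℝ‖ := by
      rw [hslice]
      exact ContinuousLinearMap.opNorm_comp_le _ _
    _ ≤ ‖fderiv ℝ S.normalExt (y, t)‖ := mul_le_of_le_one_right (norm_nonneg _)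
      (ContinuousLinearMap.norm_inl_le_one ℝ E3 ℝ)
    _ ≤ |B| := (hB (y, t) ⟨ht, hy⟩).trans (le_abs_self B)

theorem abs_det_displaceDeriv_sub_le {t : ℝ} (ht : t ∈ Ioo 0 T) {y : E3} (hy : y ∈ S.Γ t) {B : ℝ}
    (hB : ∀ i j, |gradMatrix (S.normalAt t) y i j| ≤ B) {r : ℝ} (hr : |r| ≤ 1) :
    |(displaceDeriv (S.weingarten t) (y, r)).det - (1 - r * S.meanCurv y t)| ≤
      (6 * B ^ 2 + 6 * B ^ 3) * r ^ 2 := by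
  have hdet : (displaceDeriv (S.weingarten t) (y, r)).det =
      (1 + r • gradMatrix (S.normalAt t) y).det := det_one_add_smul_fderiv _ _ _
  rw [hdet, S.meanCurv_eq ht hy, mul_neg, sub_neg_eq_add]
  exact abs_det_one_add_smul_sub_le hB hr

/-- Uniform bounds, for times in `[a, b] ⊂ (0, T)`, on the tubular neighbourhood of width `ε₀`: it
carries normal coordinates, and their volume element is `1 - r H + O(r²)`. -/
structure Tube (a b ε₀ C : ℝ) : Prop where
  pos_left : 0 < a
  lt_right : b < T
  pos : 0 < ε₀
  le_one : ε₀ ≤ 1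
  regular : ∀ t ∈ Icc a b, ∀ x, Metric.infDist x (S.Γ t) ≤ ε₀ →
      ∀ᶠ w in 𝓝 (x, t), S.RegularAt (2 * ε₀) w
  abs_meanCurv_le : ∀ t ∈ Icc a b, ∀ y ∈ S.Γ t, |S.meanCurv y t| ≤ C
  half_le_det : ∀ t ∈ Icc a b, ∀ y ∈ S.Γ t, ∀ r, |r| ≤ ε₀ →
    1 / 2 ≤ (displaceDeriv (S.weingarten t) (y, r)).det
  abs_jac_sub_le : ∀ t ∈ Icc a b, ∀ y ∈ S.Γ t, ∀ r, |r| ≤ ε₀ →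
    |(displaceJac (S.weingarten t) (y, r) : ℝ) - (1 - r * S.meanCurv y t)| ≤ C * r ^ 2

theorem half_le_of_abs_sub_le {J H C r ε : ℝ} (hJ : |J - (1 - r * H)| ≤ C * r ^ 2) (hH : |H| ≤ C)
    (hr : |r| ≤ ε) (hε : ε ≤ 1) (hεC : ε * (4 * C) ≤ 1) : 1 / 2 ≤ J := by
  have hC : 0 ≤ C := (abs_nonneg H).trans hH
  have hrH : |r * H| ≤ ε * C := by
    rw [abs_mul]
    exact mul_le_mul hr hH (abs_nonneg _) ((abs_nonneg r).trans hr)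
  have hr2 : C * r ^ 2 ≤ C * ε := by
    rw [← sq_abs]
    exact mul_le_mul_of_nonneg_left (by nlinarith [abs_nonneg r]) hC
  linarith [(abs_le.1 hJ).1, (abs_le.1 hrH).2]

theorem exists_tube {a b : ℝ} (ha : 0 < a) (hb : b < T) : ∃ ε₀ C, S.Tube a b ε₀ C := by
  obtain ⟨ε₁, hε₁, hreg⟩ := S.exists_regular_tube ha hb
  obtain ⟨B, hB₀, hB⟩ := S.exists_abs_gradMatrix_normalAt_le ha hb
  have hT : ∀ t ∈ Icc a b, t ∈ Ioo 0 T := fun t ht => ⟨ha.trans_le ht.1, ht.2.trans_lt hb⟩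
  set C := 6 * B ^ 2 + 6 * B ^ 3 + 3 * B
  have hcurv : ∀ t ∈ Icc a b, ∀ y ∈ S.Γ t, |S.meanCurv y t| ≤ C := fun t ht y hy => by
    rw [S.meanCurv_eq (hT t ht) hy, abs_neg]
    refine (abs_trace_le (hB t ht y hy)).trans ?_
    linarith [(by positivity : 0 ≤ 6 * B ^ 2 + 6 * B ^ 3)]
  have hC₁ : 0 < 4 * (C + 1) := by positivity
  set ε₀ := min (min ε₁ 1) (1 / (4 * (C + 1)))
  have hε₀ : 0 < ε₀ := lt_min (lt_min hε₁ one_pos) (one_div_pos.2 hC₁)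
  have hε₀₁ : ε₀ ≤ ε₁ := (min_le_left _ _).trans (min_le_left _ _)
  have hε₀_one : ε₀ ≤ 1 := (min_le_left _ _).trans (min_le_right _ _)
  have hε₀C : ε₀ * (4 * C) ≤ 1 := by
    have : ε₀ * (4 * (C + 1)) ≤ 1 := (le_div_iff₀ hC₁).1 (min_le_right _ _)
    linarith
  have hdet : ∀ t ∈ Icc a b, ∀ y ∈ S.Γ t, ∀ r, |r| ≤ ε₀ →
      |(displaceDeriv (S.weingarten t) (y, r)).det - (1 - r * S.meanCurv y t)| ≤ C * r ^ 2 :=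
    fun t ht y hy r hr =>
      (S.abs_det_displaceDeriv_sub_le (hT t ht) hy (hB t ht y hy) (hr.trans hε₀_one)).trans
        (mul_le_mul_of_nonneg_right (by linarith) (sq_nonneg r))
  have hhalf : ∀ t ∈ Icc a b, ∀ y ∈ S.Γ t, ∀ r, |r| ≤ ε₀ →
      1 / 2 ≤ (displaceDeriv (S.weingarten t) (y, r)).det := fun t ht y hy r hr =>
    half_le_of_abs_sub_le (hdet t ht y hy r hr) (hcurv t ht y hy) hr hε₀_one hε₀C
  refine ⟨ε₀, C, ha, hb, hε₀, hε₀_one, fun t ht x hx => ?_, hcurv, hhalf, fun t ht y hy r hr => ?_⟩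
  · exact (hreg t ht x (hx.trans hε₀₁)).mono fun w hw => hw.mono (by linarith)
  · have hJ : (displaceJac (S.weingarten t) (y, r) : ℝ) =
        (displaceDeriv (S.weingarten t) (y, r)).det := by
      rw [displaceJac, coe_nnnorm]
      exact Real.norm_of_nonneg (by linarith [hhalf t ht y hy r hr])
    rw [hJ]
    exact hdet t ht y hy r hr

end MovingSurface

/-! ### The boundary of the thin domain and integration in normal coordinates -/

namespace MovingSurface

variable {T : ℝ} {S : MovingSurface T}

section Boundary

variable {ρ σ t : ℝ} {x : E3}

theorem infDist_eventuallyEq_signed (hz : ∀ᶠ w in 𝓝 (x, t), S.RegularAt ρ w)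
    (hσ : 0 < σ * S.sdist x t) (hσ₁ : |σ| = 1) :
    (fun w : E3 × ℝ => Metric.infDist w.1 (S.Γ w.2)) =ᶠ[𝓝 (x, t)]
      fun w => σ * Function.uncurry S.sdist w := by
  have hpos : ∀ᶠ w in 𝓝 (x, t), 0 < σ * Function.uncurry S.sdist w :=
    (hz.self_of_nhds.contDiffAt_sdist.continuousAt.const_mul σ).eventually_const_lt hσ
  filter_upwards [hz, hpos] with w hw hw_pos
  rw [← S.abs_sdist (Ioo_subset_Icc_self hw.mem_Ioo), ← abs_of_pos hw_pos, abs_mul, hσ₁, one_mul,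
    Function.uncurry]

theorem hasFDerivAt_infDist (hz : ∀ᶠ w in 𝓝 (x, t), S.RegularAt ρ w)
    (hσ : 0 < σ * S.sdist x t) (hσ₁ : |σ| = 1) :
    HasFDerivAt (fun w : E3 × ℝ => Metric.infDist w.1 (S.Γ w.2))
      (σ • fderiv ℝ (Function.uncurry S.sdist) (x, t)) (x, t) :=
  ((hz.self_of_nhds.contDiffAt_sdist.differentiableAt (by simp)).hasFDerivAt.const_mul
    σ).congr_of_eventuallyEq (infDist_eventuallyEq_signed hz hσ hσ₁)

theorem gradient_infDist (hz : ∀ᶠ w in 𝓝 (x, t), S.RegularAt ρ w)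
    (hσ : 0 < σ * S.sdist x t) (hσ₁ : |σ| = 1) :
    gradient (fun y => Metric.infDist y (S.Γ t)) x = σ • S.normalExt (x, t) := by
  have hd := hasFDerivAt_infDist hz hσ hσ₁
  refine ext_inner_right ℝ fun w => (inner_spaceGrad hd.differentiableAt w).trans ?_
  rw [hd.fderiv, inner_smul_left, smul_apply, fderiv_sdist hz]
  simp

theorem deriv_infDist (hz : ∀ᶠ w in 𝓝 (x, t), S.RegularAt ρ w)
    (hσ : 0 < σ * S.sdist x t) (hσ₁ : |σ| = 1) :
    deriv (fun s => Metric.infDist x (S.Γ s)) t = -(σ * S.V (S.proj x t) t) := by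
  have hd := hasFDerivAt_infDist hz hσ hσ₁
  refine (deriv_prodMk_right hd.differentiableAt).trans ?_
  rw [hd.fderiv, smul_apply, fderiv_sdist hz]
  simp

theorem norm_gradient_infDist (hz : ∀ᶠ w in 𝓝 (x, t), S.RegularAt ρ w)
    (hσ : 0 < σ * S.sdist x t) (hσ₁ : |σ| = 1) :
    ‖gradient (fun y => Metric.infDist y (S.Γ t)) x‖ = 1 := by
  rw [gradient_infDist hz hσ hσ₁, norm_smul,
    S.norm_normalExt (Ioo_subset_Icc_self hz.self_of_nhds.mem_Ioo), Real.norm_eq_abs, hσ₁, one_mul]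

theorem bdryNormal_eq (hz : ∀ᶠ w in 𝓝 (x, t), S.RegularAt ρ w)
    (hσ : 0 < σ * S.sdist x t) (hσ₁ : |σ| = 1) :
    S.bdryNormal x t = σ • S.normalExt (x, t) := by
  rw [bdryNormal, norm_gradient_infDist hz hσ hσ₁, gradient_infDist hz hσ hσ₁, inv_one, one_smul]

theorem bdryVelocity_eq (hz : ∀ᶠ w in 𝓝 (x, t), S.RegularAt ρ w)
    (hσ : 0 < σ * S.sdist x t) (hσ₁ : |σ| = 1) :
    S.bdryVelocity x t = σ * S.V (S.proj x t) t := by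
  rw [bdryVelocity, norm_gradient_infDist hz hσ hσ₁, deriv_infDist hz hσ hσ₁, inv_one, one_mul,
    neg_neg]

end Boundary

variable (S) in
/-- The product of the area on `Γ(t)` and the length on `(-ε, ε)`: the reference measure in the
normal coordinates `(y, r) ↦ y + r ν(y, t)` of `Ω_ε(t)`. -/
def tubeMeasure (ε t : ℝ) : Measure (E3 × ℝ) :=
  (μHE[2].restrict (S.Γ t)).prod (volume.restrict (Ioo (-ε) ε))

namespace Tube

variable {a b ε₀ C ε r σ t : ℝ} {y : E3}

section

variable (hτ : S.Tube a b ε₀ C) (ht : t ∈ Icc a b)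
include hτ ht

theorem mem_Ioo : t ∈ Ioo 0 T := ⟨hτ.pos_left.trans_le ht.1, ht.2.trans_lt hτ.lt_right⟩

theorem mem_Icc : t ∈ Icc 0 T := Ioo_subset_Icc_self (hτ.mem_Ioo ht)

theorem displace_eq (hy : y ∈ S.Γ t) (r : ℝ) :
    displace (S.normalAt t) (y, r) = y + r • S.ν y t := by
  rw [displace, S.normalAt_of_mem (hτ.mem_Icc ht) hy]

theorem infDist_displace_le (hy : y ∈ S.Γ t) (r : ℝ) :
    Metric.infDist (displace (S.normalAt t) (y, r)) (S.Γ t) ≤ |r| := by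
  refine (Metric.infDist_le_dist_of_mem hy).trans ?_
  rw [hτ.displace_eq ht hy, dist_self_add_left, norm_smul, S.norm_normal (hτ.mem_Icc ht) hy,
    mul_one, Real.norm_eq_abs]

theorem regular_displace (hy : y ∈ S.Γ t) (hr : |r| ≤ ε₀) :
    ∀ᶠ w in 𝓝 (displace (S.normalAt t) (y, r), t), S.RegularAt (2 * ε₀) w :=
  hτ.regular t ht _ ((hτ.infDist_displace_le ht hy r).trans hr)

theorem proj_sdist_displace (hy : y ∈ S.Γ t) (hr : |r| ≤ ε₀) :
    S.proj (displace (S.normalAt t) (y, r)) t = y ∧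
      S.sdist (displace (S.normalAt t) (y, r)) t = r :=
  (hτ.regular_displace ht hy hr).self_of_nhds.proj_sdist_eq y hy r (by linarith [hτ.pos])
    (hτ.displace_eq ht hy r).symm

theorem proj_displace (hy : y ∈ S.Γ t) (hr : |r| ≤ ε₀) :
    S.proj (displace (S.normalAt t) (y, r)) t = y :=
  (hτ.proj_sdist_displace ht hy hr).1

theorem sdist_displace (hy : y ∈ S.Γ t) (hr : |r| ≤ ε₀) :
    S.sdist (displace (S.normalAt t) (y, r)) t = r :=
  (hτ.proj_sdist_displace ht hy hr).2

theorem normalExt_displace (hy : y ∈ S.Γ t) (hr : |r| ≤ ε₀) :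
    S.normalExt (displace (S.normalAt t) (y, r), t) = S.ν y t := by
  simp only [normalExt, hτ.proj_displace ht hy hr]

theorem displace_proj_sdist (x : E3) :
    displace (S.normalAt t) (S.proj x t, S.sdist x t) = x := by
  rw [hτ.displace_eq ht (S.proj_mem (hτ.mem_Icc ht) x), S.proj_add_sdist_smul (hτ.mem_Icc ht) x]

theorem injOn_displace : InjOn (displace (S.normalAt t)) (S.Γ t ×ˢ Icc (-ε₀) ε₀) := by
  refine LeftInvOn.injOn (f₁' := fun x => (S.proj x t, S.sdist x t)) ?_
  rintro ⟨y, r⟩ ⟨hy, hr⟩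
  exact Prod.ext (hτ.proj_displace ht hy (abs_le.2 hr)) (hτ.sdist_displace ht hy (abs_le.2 hr))

theorem injOn_displace_slice (hr : |r| ≤ ε₀) :
    InjOn (fun y => displace (S.normalAt t) (y, r)) (S.Γ t) := fun _ hy _ hy' h =>
  congrArg Prod.fst (hτ.injOn_displace ht ⟨hy, abs_le.1 hr⟩ ⟨hy', abs_le.1 hr⟩ h)

theorem Ω_eq_image (ε : ℝ) : S.Ω ε t = displace (S.normalAt t) '' (S.Γ t ×ˢ Ioo (-ε) ε) := by
  refine Subset.antisymm (fun x (hx : Metric.infDist x (S.Γ t) < ε) => ?_) ?_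
  · rw [← S.abs_sdist (hτ.mem_Icc ht)] at hx
    exact ⟨(S.proj x t, S.sdist x t), ⟨S.proj_mem (hτ.mem_Icc ht) x, abs_lt.1 hx⟩,
      hτ.displace_proj_sdist ht x⟩
  · rintro _ ⟨⟨y, r⟩, ⟨hy, hr⟩, rfl⟩
    exact (hτ.infDist_displace_le ht hy r).trans_lt (abs_lt.2 hr)

theorem displace_mem_frontier (hε₀ : 0 < ε) (hε : ε ≤ ε₀) (hy : y ∈ S.Γ t) (hσ : |σ| = 1) :
    displace (S.normalAt t) (y, σ * ε) ∈ frontier (S.Ω ε t) := by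
  have hopen : IsOpen (S.Ω ε t) := isOpen_lt (Metric.continuous_infDist_pt _) continuous_const
  have habs : ∀ s > 0, |σ * s| = s := fun s hs => by rw [abs_mul, hσ, one_mul, abs_of_pos hs]
  rw [hopen.frontier_eq]
  constructor
  · have hcont : Continuous fun s : ℝ => displace (S.normalAt t) (y, σ * s) := by
      simp only [displace]
      fun_prop
    refine mem_closure_of_tendsto ((hcont.tendsto ε).mono_left (nhdsWithin_le_nhds (s := Iio ε))) ?_
    filter_upwards [Ioo_mem_nhdsLT hε₀] with s hs
    exact (hτ.infDist_displace_le ht hy _).trans_lt ((habs s hs.1).trans_lt hs.2)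
  · intro (h : Metric.infDist _ (S.Γ t) < ε)
    rw [← S.abs_sdist (hτ.mem_Icc ht), hτ.sdist_displace ht hy ((habs ε hε₀).trans_le hε),
      habs ε hε₀] at h
    exact lt_irrefl _ h

theorem frontier_Ω (hε₀ : 0 < ε) (hε : ε ≤ ε₀) :
    frontier (S.Ω ε t) = (fun y => displace (S.normalAt t) (y, ε)) '' S.Γ t ∪
      (fun y => displace (S.normalAt t) (y, -ε)) '' S.Γ t := by
  apply Subset.antisymm
  · intro x hx
    have habs : |S.sdist x t| = ε := (S.abs_sdist (hτ.mem_Icc ht) x).trans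
      (frontier_lt_subset_eq (Metric.continuous_infDist_pt _) continuous_const hx)
    have hx' := hτ.displace_proj_sdist ht x
    exact (eq_or_eq_neg_of_abs_eq habs).imp
      (fun h => ⟨S.proj x t, S.proj_mem (hτ.mem_Icc ht) x, by rwa [h] at hx'⟩)
      (fun h => ⟨S.proj x t, S.proj_mem (hτ.mem_Icc ht) x, by rwa [h] at hx'⟩)
  · rintro _ (⟨y, hy, rfl⟩ | ⟨y, hy, rfl⟩)
    · simpa using hτ.displace_mem_frontier ht hε₀ hε hy (abs_one (α := ℝ))
    · simpa using hτ.displace_mem_frontier ht hε₀ hε hy (by simp : |(-1 : ℝ)| = 1)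

theorem bdry_displace (hε₀ : 0 < ε) (hε : ε ≤ ε₀) (hy : y ∈ S.Γ t) (hσ : |σ| = 1) :
    S.bdryNormal (displace (S.normalAt t) (y, σ * ε)) t = σ • S.ν y t ∧
      S.bdryVelocity (displace (S.normalAt t) (y, σ * ε)) t = σ * S.V y t := by
  have habs : |σ * ε| ≤ ε₀ := by rwa [abs_mul, hσ, one_mul, abs_of_pos hε₀]
  have hreg := hτ.regular_displace ht hy habs
  have hside : 0 < σ * S.sdist (displace (S.normalAt t) (y, σ * ε)) t := by
    rw [hτ.sdist_displace ht hy habs, ← mul_assoc, ← abs_mul_abs_self, hσ]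
    simpa using hε₀
  rw [bdryNormal_eq hreg hside hσ, bdryVelocity_eq hreg hside hσ,
    hτ.normalExt_displace ht hy habs, hτ.proj_displace ht hy habs]
  exact ⟨rfl, rfl⟩

theorem det_ne_zero (hy : y ∈ S.Γ t) (hr : |r| ≤ ε₀) :
    (displaceDeriv (S.weingarten t) (y, r)).det ≠ 0 :=
  (one_half_pos.trans_le (hτ.half_le_det t ht y hy r hr)).ne'

theorem isFiniteMeasure_restrict_Γ : IsFiniteMeasure (μHE[2].restrict (S.Γ t)) :=
  (S.normalField (hτ.mem_Ioo ht)).isFiniteMeasure_restrict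

theorem tubeMeasure_eq_restrict (ε : ℝ) : S.tubeMeasure ε t =
    ((μHE[2].restrict (S.Γ t)).prod (volume : Measure ℝ)).restrict (S.Γ t ×ˢ Ioo (-ε) ε) := by
  have := hτ.isFiniteMeasure_restrict_Γ ht
  rw [← Measure.prod_restrict,
    Measure.restrict_restrict (S.isCompact_Γ (hτ.mem_Icc ht)).measurableSet, inter_self,
    tubeMeasure]

variable {f : E3 → ℝ}

theorem setIntegral_Ω (hε : ε ≤ ε₀) (hf : ContinuousOn f (S.Ω ε t)) :
    ∫ x in S.Ω ε t, f x =
      ∫ z, displaceJac (S.weingarten t) z * f (displace (S.normalAt t) z) ∂S.tubeMeasure ε t := by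
  have habs : ∀ r ∈ Ioo (-ε) ε, |r| ≤ ε₀ := fun r hr => (abs_lt.2 hr).le.trans hε
  rw [hτ.Ω_eq_image ht ε] at hf ⊢
  rw [hτ.tubeMeasure_eq_restrict ht]
  exact (S.normalField (hτ.mem_Ioo ht)).setIntegral_displace measurableSet_Ioo
    (fun z hz => hτ.det_ne_zero ht hz.1 (habs z.2 hz.2))
    ((hτ.injOn_displace ht).mono (prod_mono_right fun r hr => abs_le.1 (habs r hr))) hf

theorem integrableOn_Γ (hf : ContinuousOn f (S.Γ t)) : IntegrableOn f (S.Γ t) μHE[2] := by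
  have hN := S.normalField (hτ.mem_Ioo ht)
  exact hf.integrableOn_of_subset_isCompact hN.isCompact hN.isCompact.measurableSet subset_rfl
    hN.measure_lt_top.ne

theorem continuousOn_jac_mul_slice
    (hf : ContinuousOn f ((fun y => displace (S.normalAt t) (y, r)) '' S.Γ t)) :
    ContinuousOn (fun y => displaceJac (S.weingarten t) (y, r) *
      f (displace (S.normalAt t) (y, r))) (S.Γ t) := by
  have hN := S.normalField (hτ.mem_Ioo ht)
  exact (NNReal.continuous_coe.comp_continuousOn (hN.continuousOn_displaceJac_slice r)).mul
    (hf.comp (hN.continuousOn_displace_slice r) (mapsTo_image _ _))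

theorem integrableOn_slice (hr : |r| ≤ ε₀)
    (hf : ContinuousOn f ((fun y => displace (S.normalAt t) (y, r)) '' S.Γ t)) :
    IntegrableOn f ((fun y => displace (S.normalAt t) (y, r)) '' S.Γ t) μHE[2] := by
  have hN := S.normalField (hτ.mem_Ioo ht)
  have hc := hN.isCompact.image_of_continuousOn (hN.continuousOn_displace_slice r)
  exact hf.integrableOn_of_subset_isCompact hc hc.measurableSet subset_rfl
    (hN.measure_displace_slice_lt_top (fun y hy => hτ.det_ne_zero ht hy hr)
      (hτ.injOn_displace_slice ht hr)).ne

theorem setIntegral_frontier_Ω (hε₀ : 0 < ε) (hε : ε ≤ ε₀)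
    (hf : ContinuousOn f (frontier (S.Ω ε t))) :
    ∫ x in frontier (S.Ω ε t), f x ∂μHE[2] = ∫ y in S.Γ t,
      (displaceJac (S.weingarten t) (y, ε) * f (displace (S.normalAt t) (y, ε)) +
        displaceJac (S.weingarten t) (y, -ε) * f (displace (S.normalAt t) (y, -ε))) ∂μHE[2] := by
  have hN := S.normalField (hτ.mem_Ioo ht)
  have hplus : |ε| ≤ ε₀ := (abs_of_pos hε₀).trans_le hε
  have hminus : |-ε| ≤ ε₀ := (abs_neg ε).trans_le hplus
  rw [hτ.frontier_Ω ht hε₀ hε] at hf ⊢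
  have hf_plus := hf.mono subset_union_left
  have hf_minus := hf.mono subset_union_right
  have hdisj : Disjoint ((fun y => displace (S.normalAt t) (y, ε)) '' S.Γ t)
      ((fun y => displace (S.normalAt t) (y, -ε)) '' S.Γ t) := by
    rw [Set.disjoint_left]
    rintro _ ⟨y, hy, rfl⟩ ⟨y', hy', h⟩
    have : -ε = ε := congrArg Prod.snd
      (hτ.injOn_displace ht ⟨hy', abs_le.1 hminus⟩ ⟨hy, abs_le.1 hplus⟩ h)
    linarith
  rw [setIntegral_union hdisj
      (hN.isCompact.image_of_continuousOn (hN.continuousOn_displace_slice _)).measurableSet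
      (hτ.integrableOn_slice ht hplus hf_plus) (hτ.integrableOn_slice ht hminus hf_minus),
    hN.setIntegral_displace_slice (fun y hy => hτ.det_ne_zero ht hy hplus)
      (hτ.injOn_displace_slice ht hplus) hf_plus,
    hN.setIntegral_displace_slice (fun y hy => hτ.det_ne_zero ht hy hminus)
      (hτ.injOn_displace_slice ht hminus) hf_minus]
  exact (integral_add (hτ.integrableOn_Γ ht (hτ.continuousOn_jac_mul_slice ht hf_plus))
    (hτ.integrableOn_Γ ht (hτ.continuousOn_jac_mul_slice ht hf_minus))).symm

end

end Tube

variable (S) in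
/-- The part of the space-time hypersurface that lies over the time interval `[a, b]`. -/
def spaceTimeIcc (a b : ℝ) : Set (E3 × ℝ) := {z | z.2 ∈ Icc a b ∧ z.1 ∈ S.Γ z.2}

namespace Tube

variable {a b ε₀ C ε t : ℝ}

section

variable (hτ : S.Tube a b ε₀ C) (ht : t ∈ Icc a b)
include hτ ht

theorem const_nonneg : 0 ≤ C := by
  obtain ⟨y, hy⟩ := (S.isConnected t (hτ.mem_Icc ht)).nonempty
  exact (abs_nonneg _).trans (hτ.abs_meanCurv_le t ht y hy)

theorem abs_jac_sub_one_le {y : E3} (hy : y ∈ S.Γ t) {r : ℝ} (hr : |r| ≤ ε₀) :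
    |(displaceJac (S.weingarten t) (y, r) : ℝ) - 1| ≤ 2 * C * |r| := by
  have hC := hτ.const_nonneg ht
  have hcurv : |r * S.meanCurv y t| ≤ C * |r| := by
    rw [abs_mul, mul_comm]
    exact mul_le_mul_of_nonneg_right (hτ.abs_meanCurv_le t ht y hy) (abs_nonneg r)
  have hsq : C * r ^ 2 ≤ C * |r| := by
    rw [← sq_abs]
    exact mul_le_mul_of_nonneg_left
      (pow_le_of_le_one (abs_nonneg r) (hr.trans hτ.le_one) two_ne_zero) hC
  have hsplit := abs_sub_le (displaceJac (S.weingarten t) (y, r) : ℝ) (1 - r * S.meanCurv y t) 1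
  rw [sub_sub_cancel_left, abs_neg] at hsplit
  linarith [hτ.abs_jac_sub_le t ht y hy r hr]

theorem isFiniteMeasure_tubeMeasure (ε : ℝ) : IsFiniteMeasure (S.tubeMeasure ε t) := by
  have := hτ.isFiniteMeasure_restrict_Γ ht
  rw [tubeMeasure]
  infer_instance

theorem measurableSet_tube (ε : ℝ) : MeasurableSet (S.Γ t ×ˢ Ioo (-ε) ε) :=
  (S.isCompact_Γ (hτ.mem_Icc ht)).measurableSet.prod measurableSet_Ioo

theorem ae_tubeMeasure (ε : ℝ) : ∀ᵐ z ∂S.tubeMeasure ε t, z.1 ∈ S.Γ t ∧ |z.2| < ε := by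
  rw [hτ.tubeMeasure_eq_restrict ht]
  exact (ae_restrict_mem (hτ.measurableSet_tube ht ε)).mono fun z hz => ⟨hz.1, abs_lt.2 hz.2⟩

theorem measureReal_univ_tubeMeasure (hε₀ : 0 < ε) :
    (S.tubeMeasure ε t).real univ = 2 * ε * μHE[2].real (S.Γ t) := by
  have := hτ.isFiniteMeasure_restrict_Γ ht
  rw [tubeMeasure, ← univ_prod_univ, measureReal_prod_prod, measureReal_restrict_apply_univ,
    measureReal_restrict_apply_univ, Real.volume_real_Ioo_of_le (by linarith)]
  ring

theorem integral_tubeMeasure_fst (hε₀ : 0 < ε) (f : E3 → ℝ) :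
    ∫ z, f z.1 ∂S.tubeMeasure ε t = 2 * ε * ∫ y in S.Γ t, f y ∂μHE[2] := by
  have := hτ.isFiniteMeasure_restrict_Γ ht
  rw [tubeMeasure, integral_fun_fst, measureReal_restrict_apply_univ,
    Real.volume_real_Ioo_of_le (by linarith), smul_eq_mul]
  ring

theorem continuousOn_jac_tube :
    ContinuousOn (fun z => (displaceJac (S.weingarten t) z : ℝ)) (S.Γ t ×ˢ Ioo (-ε) ε) :=
  NNReal.continuous_coe.comp_continuousOn ((S.normalField
    (hτ.mem_Ioo ht)).continuousOn_displaceJac.mono (prod_mono_right (subset_univ _)))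

theorem aestronglyMeasurable_jac_mul {F : E3 → ℝ} (hF : ContinuousOn F (S.Ω ε t)) :
    AEStronglyMeasurable (fun z => displaceJac (S.weingarten t) z *
      F (displace (S.normalAt t) z)) (S.tubeMeasure ε t) := by
  rw [hτ.tubeMeasure_eq_restrict ht]
  refine ContinuousOn.aestronglyMeasurable ?_ (hτ.measurableSet_tube ht ε)
  refine (hτ.continuousOn_jac_tube ht).mul (hF.comp ((S.normalField
    (hτ.mem_Ioo ht)).continuousOn_displace.mono (prod_mono_right (subset_univ _))) ?_)
  rw [hτ.Ω_eq_image ht ε]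
  exact mapsTo_image _ _

theorem abs_setIntegral_Ω_sub_le (hε₀ : 0 < ε) (hε : ε ≤ ε₀) {F f : E3 → ℝ} {η : ℝ}
    (hF : ContinuousOn F (S.Ω ε t)) (hf : ContinuousOn f (S.Γ t))
    (h : ∀ y ∈ S.Γ t, ∀ r, |r| < ε →
      |displaceJac (S.weingarten t) (y, r) * F (displace (S.normalAt t) (y, r)) - f y| ≤ η) :
    |(2 * ε)⁻¹ * (∫ x in S.Ω ε t, F x) - ∫ y in S.Γ t, f y ∂μHE[2]| ≤
      η * μHE[2].real (S.Γ t) := by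
  have := hτ.isFiniteMeasure_tubeMeasure ht ε
  set G : E3 × ℝ → ℝ := fun z => displaceJac (S.weingarten t) z * F (displace (S.normalAt t) z)
  have hclose : ∀ᵐ z ∂S.tubeMeasure ε t, ‖G z - f z.1‖ ≤ η :=
    (hτ.ae_tubeMeasure ht ε).mono fun z hz => h z.1 hz.1 z.2 hz.2
  have hf_int : Integrable (fun z => f z.1) (S.tubeMeasure ε t) :=
    (hτ.integrableOn_Γ ht hf).integrable.comp_fst _
  have hdiff_int : Integrable (fun z => G z - f z.1) (S.tubeMeasure ε t) :=
    .of_bound ((hτ.aestronglyMeasurable_jac_mul ht hF).sub hf_int.1) η hclose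
  have hG_int : Integrable G (S.tubeMeasure ε t) :=
    (hdiff_int.add hf_int).congr (.of_forall fun z => sub_add_cancel _ _)
  have hdiff := norm_integral_le_of_norm_le_const hclose
  rw [integral_sub hG_int hf_int, ← hτ.setIntegral_Ω ht hε hF, hτ.integral_tubeMeasure_fst ht hε₀,
    hτ.measureReal_univ_tubeMeasure ht hε₀, Real.norm_eq_abs] at hdiff
  have h2ε : 0 < 2 * ε := by positivity
  rw [← mul_le_mul_iff_right₀ h2ε, ← abs_of_pos h2ε, ← abs_mul, abs_of_pos h2ε, mul_sub,
    mul_inv_cancel_left₀ h2ε.ne']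
  linarith

theorem abs_setIntegral_frontier_sub_le (hε₀ : 0 < ε) (hε : ε ≤ ε₀) {F f : E3 → ℝ} {η : ℝ}
    (hF : ContinuousOn F (frontier (S.Ω ε t))) (hf : ContinuousOn f (S.Γ t))
    (h : ∀ y ∈ S.Γ t,
      |(2 * ε)⁻¹ * (displaceJac (S.weingarten t) (y, ε) * F (displace (S.normalAt t) (y, ε)) +
        displaceJac (S.weingarten t) (y, -ε) * F (displace (S.normalAt t) (y, -ε))) - f y| ≤ η) :
    |(2 * ε)⁻¹ * (∫ x in frontier (S.Ω ε t), F x ∂μHE[2]) - ∫ y in S.Γ t, f y ∂μHE[2]| ≤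
      η * μHE[2].real (S.Γ t) := by
  have hsheets := hτ.frontier_Ω ht hε₀ hε
  have hint : IntegrableOn (fun y => (2 * ε)⁻¹ *
      (displaceJac (S.weingarten t) (y, ε) * F (displace (S.normalAt t) (y, ε)) +
        displaceJac (S.weingarten t) (y, -ε) * F (displace (S.normalAt t) (y, -ε))))
      (S.Γ t) μHE[2] :=
    hτ.integrableOn_Γ ht <| continuousOn_const.mul <|
      (hτ.continuousOn_jac_mul_slice ht (hF.mono (hsheets ▸ subset_union_left))).add
        (hτ.continuousOn_jac_mul_slice ht (hF.mono (hsheets ▸ subset_union_right)))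
  rw [hτ.setIntegral_frontier_Ω ht hε₀ hε hF, ← integral_const_mul,
    ← integral_sub hint (hτ.integrableOn_Γ ht hf), ← Real.norm_eq_abs]
  exact norm_setIntegral_le_of_norm_le_const
    (S.normalField (hτ.mem_Ioo ht)).measure_lt_top h

theorem mul_measureReal_Γ_le : ε₀ * μHE[2].real (S.Γ t) ≤ volume.real (S.Ω ε₀ t) := by
  have := hτ.isFiniteMeasure_tubeMeasure ht ε₀
  have hvol := hτ.setIntegral_Ω ht le_rfl (f := fun _ => 1) continuousOn_const
  rw [setIntegral_const, smul_eq_mul, mul_one] at hvol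
  have hbound : ∀ᵐ z ∂S.tubeMeasure ε₀ t,
      ‖(displaceJac (S.weingarten t) z : ℝ) * 1‖ ≤ 1 + 2 * C := by
    filter_upwards [hτ.ae_tubeMeasure ht ε₀] with z hz
    have hle := hτ.abs_jac_sub_one_le ht hz.1 hz.2.le
    have hz_le : 2 * C * |z.2| ≤ 2 * C := mul_le_of_le_one_right
      (mul_nonneg two_pos.le (hτ.const_nonneg ht)) (hz.2.le.trans hτ.le_one)
    rw [mul_one, Real.norm_eq_abs, abs_of_nonneg (NNReal.coe_nonneg _)]
    linarith [(abs_le.1 hle).2]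
  have hhalf : ∀ᵐ z ∂S.tubeMeasure ε₀ t,
      (1 / 2 : ℝ) ≤ (displaceJac (S.weingarten t) z : ℝ) * 1 := by
    filter_upwards [hτ.ae_tubeMeasure ht ε₀] with z hz
    rw [mul_one, displaceJac, coe_nnnorm]
    exact (hτ.half_le_det t ht z.1 hz.1 z.2 hz.2.le).trans (le_abs_self _)
  have hmono := integral_mono_ae (integrable_const _)
    (.of_bound (hτ.aestronglyMeasurable_jac_mul ht continuousOn_const) _ hbound) hhalf
  rw [integral_const, hτ.measureReal_univ_tubeMeasure ht hτ.pos, smul_eq_mul, ← hvol] at hmono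
  linarith

end

variable (hτ : S.Tube a b ε₀ C)
include hτ

theorem isCompact_spaceTimeIcc : IsCompact (S.spaceTimeIcc a b) :=
  S.isCompact_spaceTime_of_isClosed isClosed_Icc (Icc_subset_Icc hτ.pos_left.le hτ.lt_right.le)

theorem exists_area_bound : ∃ M, ∀ t ∈ Icc a b, μHE[2].real (S.Γ t) ≤ M := by
  obtain ⟨R, hR⟩ :=
    (hτ.isCompact_spaceTimeIcc.image continuous_fst).isBounded.subset_closedBall (0 : E3)
  refine ⟨volume.real (Metric.closedBall (0 : E3) (ε₀ + R)) / ε₀, fun t ht => ?_⟩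
  have hsub : S.Ω ε₀ t ⊆ Metric.closedBall 0 (ε₀ + R) := by
    intro x (hx : Metric.infDist x (S.Γ t) < ε₀)
    rw [← S.dist_proj (hτ.mem_Icc ht)] at hx
    exact (dist_triangle x (S.proj x t) 0).trans
      (add_le_add hx.le (hR ⟨(S.proj x t, t), ⟨ht, S.proj_mem (hτ.mem_Icc ht) x⟩, rfl⟩))
  rw [le_div_iff₀' hτ.pos]
  exact (hτ.mul_measureReal_Γ_le ht).trans
    (measureReal_mono hsub measure_closedBall_lt_top.ne)

theorem continuousOn_displace_spaceTime :
    ContinuousOn (fun p : (E3 × ℝ) × ℝ => (displace (S.normalAt p.1.2) (p.1.1, p.2), p.1.2))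
      (S.spaceTimeIcc a b ×ˢ Icc (-ε₀) ε₀) := by
  have hnormal : ContinuousOn S.normalExt (S.spaceTimeIcc a b) :=
    fun z hz => (hτ.regular z.2 hz.1 z.1 ((Metric.infDist_zero_of_mem hz.2).trans_le
      hτ.pos.le)).self_of_nhds.contDiffAt_normalExt.continuousAt.continuousWithinAt
  have hcomp : ContinuousOn (fun p : (E3 × ℝ) × ℝ => S.normalExt (p.1.1, p.1.2))
      (S.spaceTimeIcc a b ×ˢ Icc (-ε₀) ε₀) :=
    hnormal.comp continuousOn_fst fun p hp => hp.1
  simp only [displace, normalAt]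
  fun_prop

theorem exists_forall_norm_sub_lt {F : Type*} [NormedAddCommGroup F] {G : E3 × ℝ → F}
    (hG : ∀ t ∈ Icc a b, ∀ x, Metric.infDist x (S.Γ t) ≤ ε₀ → ContinuousAt G (x, t)) {η : ℝ}
    (hη : 0 < η) :
    ∃ δ > 0, δ ≤ ε₀ ∧ ∀ t ∈ Icc a b, ∀ y ∈ S.Γ t, ∀ r, |r| < δ →
      ‖G (displace (S.normalAt t) (y, r), t) - G (y, t)‖ < η := by
  have hcont : ContinuousOn
      (fun p : (E3 × ℝ) × ℝ => G (displace (S.normalAt p.1.2) (p.1.1, p.2), p.1.2))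
      (S.spaceTimeIcc a b ×ˢ Icc (-ε₀) ε₀) := fun p hp =>
    ContinuousAt.comp_continuousWithinAt (g := G)
      (hG _ hp.1.1 _ ((hτ.infDist_displace_le hp.1.1 hp.1.2 _).trans (abs_le.2 hp.2)))
      (hτ.continuousOn_displace_spaceTime p hp)
  obtain ⟨δ, hδ, hclose⟩ := Metric.uniformContinuousOn_iff.1
    ((hτ.isCompact_spaceTimeIcc.prod isCompact_Icc).uniformContinuousOn_of_continuous hcont) η hη
  refine ⟨min δ ε₀, lt_min hδ hτ.pos, min_le_right _ _, fun t ht y hy r hr => ?_⟩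
  have h := hclose ((y, t), r) ⟨⟨ht, hy⟩, abs_le.1 (hr.trans_le (min_le_right _ _)).le⟩ ((y, t), 0)
    ⟨⟨ht, hy⟩, by simp [hτ.pos.le]⟩
    (by simpa [Prod.dist_eq, hδ] using hr.trans_le (min_le_left _ _))
  simpa [displace, dist_eq_norm] using h

theorem exists_bound_of_continuousOn {F : Type*} [NormedAddCommGroup F] {G : E3 × ℝ → F}
    (hG : ContinuousOn G (S.spaceTimeIcc a b)) :
    ∃ M, 0 ≤ M ∧ ∀ t ∈ Icc a b, ∀ y ∈ S.Γ t, ‖G (y, t)‖ ≤ M := by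
  obtain ⟨M, hM⟩ := hτ.isCompact_spaceTimeIcc.exists_bound_of_continuousOn hG
  exact ⟨|M|, abs_nonneg M, fun t ht y hy => (hM (y, t) ⟨ht, hy⟩).trans (le_abs_self M)⟩

end Tube

end MovingSurface

/-! ### Expansions in the signed distance -/

theorem norm_le_mul_abs_pow_of_lt {F : Type*} [NormedAddCommGroup F] {g : ℝ → F} {M r ε : ℝ}
    {n : ℕ} (hε : 0 < ε) (h : ∀ s, |s| < ε → ‖g s‖ ≤ M * |s| ^ n) (hr : |r| ≤ ε)
    (hg : ContinuousAt g r) : ‖g r‖ ≤ M * |r| ^ n := by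
  have hclosure : r ∈ closure (Ioo (-ε) ε) := by
    rw [closure_Ioo (by linarith)]
    exact abs_le.1 hr
  exact hg.norm.continuousWithinAt.closure_le hclosure (by fun_prop) fun s hs => h s (abs_lt.2 hs)

namespace MovingSurface

variable {T : ℝ} {S : MovingSurface T} {F : Type*} [NormedAddCommGroup F] [NormedSpace ℝ F]

theorem contDiffAt_comp_proj {c : E3 → ℝ → F}
    (hc : ContDiffOn ℝ ∞ (Function.uncurry c) S.spaceTime) {ρ : ℝ} {z : E3 × ℝ}
    (hz : ∀ᶠ w in 𝓝 z, S.RegularAt ρ w) :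
    ContDiffAt ℝ 1 (fun w : E3 × ℝ => c (S.proj w.1 w.2) w.2) z := by
  have hmaps : MapsTo (fun w : E3 × ℝ => (S.proj w.1 w.2, w.2)) {w | S.RegularAt ρ w}
      S.spaceTime := fun w hw =>
    ⟨hw.mem_Ioo, S.proj_mem (Ioo_subset_Icc_self hw.mem_Ioo) w.1⟩
  have hproj : ContDiffAt ℝ 1 (fun w : E3 × ℝ => (S.proj w.1 w.2, w.2)) z :=
    hz.self_of_nhds.contDiffAt_proj.prodMk contDiffAt_snd
  exact (ContDiffWithinAt.comp (g := Function.uncurry c) z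
    ((hc _ (hmaps hz.self_of_nhds)).of_le (by exact_mod_cast le_top))
    hproj.contDiffWithinAt hmaps).contDiffAt hz

variable (S) in
/-- The truncated expansion `∑ⱼ d^j c_j(π, t)` in powers of the signed distance. -/
def expansion {k : ℕ} (c : Fin k → E3 → ℝ → F) (z : E3 × ℝ) : F :=
  ∑ j : Fin k, S.sdist z.1 z.2 ^ (j : ℕ) • c j (S.proj z.1 z.2) z.2

theorem contDiffAt_expansion {k : ℕ} {c : Fin k → E3 → ℝ → F}
    (hc : ∀ j, ContDiffOn ℝ ∞ (Function.uncurry (c j)) S.spaceTime) {ρ : ℝ} {z : E3 × ℝ}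
    (hz : ∀ᶠ w in 𝓝 z, S.RegularAt ρ w) : ContDiffAt ℝ 1 (S.expansion c) z :=
  ContDiffAt.sum fun j _ =>
    (hz.self_of_nhds.contDiffAt_sdist.pow j).smul (contDiffAt_comp_proj (hc j) hz)

theorem expansion_succ {k : ℕ} (c : Fin (k + 1) → E3 → ℝ → F) (z : E3 × ℝ) :
    S.expansion c z =
      c 0 (S.proj z.1 z.2) z.2 + S.sdist z.1 z.2 • S.expansion (Fin.tail c) z := by
  simp [expansion, Fin.sum_univ_succ, Finset.smul_sum, smul_smul, pow_succ', Fin.tail]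

theorem expansion_of_mem {k : ℕ} (c : Fin (k + 1) → E3 → ℝ → F) {t : ℝ} (ht : t ∈ Icc 0 T)
    {y : E3} (hy : y ∈ S.Γ t) : S.expansion c (y, t) = c 0 y t := by
  simp [expansion_succ, S.proj_of_mem ht hy, S.sdist_of_mem ht hy]

theorem fderiv_expansion_of_mem {k : ℕ} {c : Fin (k + 1) → E3 → ℝ → F}
    (hc : ∀ j, ContDiffOn ℝ ∞ (Function.uncurry (c j)) S.spaceTime) {ρ t : ℝ} {y : E3}
    (hz : ∀ᶠ w in 𝓝 (y, t), S.RegularAt ρ w) (hy : y ∈ S.Γ t) (w : E3) :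
    fderiv ℝ (S.expansion c) (y, t) (w, 0) =
      fderiv ℝ (fun x => c 0 (S.proj x t) t) y w +
        inner ℝ (S.ν y t) w • S.expansion (Fin.tail c) (y, t) := by
  have ht := Ioo_subset_Icc_self hz.self_of_nhds.mem_Ioo
  have hlead : DifferentiableAt ℝ (fun z : E3 × ℝ => c 0 (S.proj z.1 z.2) z.2) (y, t) :=
    (contDiffAt_comp_proj (hc 0) hz).differentiableAt one_ne_zero
  have hsdist : DifferentiableAt ℝ (Function.uncurry S.sdist) (y, t) :=
    hz.self_of_nhds.contDiffAt_sdist.differentiableAt one_ne_zero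
  have htail : DifferentiableAt ℝ (S.expansion (Fin.tail c)) (y, t) :=
    (contDiffAt_expansion (fun j => hc j.succ) hz).differentiableAt one_ne_zero
  have hderiv := ((hlead.hasFDerivAt.add
    (hsdist.hasFDerivAt.smul htail.hasFDerivAt)).congr_of_eventuallyEq
      (.of_forall (expansion_succ c))).fderiv
  rw [hderiv, fderiv_prodMk_left (f := fun z : E3 × ℝ => c 0 (S.proj z.1 z.2) z.2) hlead]
  simp [fderiv_sdist hz, normalExt, Function.uncurry, S.proj_of_mem ht hy, S.sdist_of_mem ht hy]

namespace Tube

variable {a b ε₀ C ε t r : ℝ} {y : E3}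

section

variable (hτ : S.Tube a b ε₀ C) (ht : t ∈ Icc a b)
include hτ ht

theorem expansion_displace (hy : y ∈ S.Γ t) (hr : |r| ≤ ε₀) {k : ℕ} (c : Fin k → E3 → ℝ → F) :
    S.expansion c (displace (S.normalAt t) (y, r), t) = ∑ j : Fin k, r ^ (j : ℕ) • c j y t := by
  simp only [expansion, hτ.proj_displace ht hy hr, hτ.sdist_displace ht hy hr]

theorem displace_mem_closure (hε : ε ≤ ε₀) (hε₀ : 0 < ε) (hy : y ∈ S.Γ t) (hr : |r| ≤ ε) :
    displace (S.normalAt t) (y, r) ∈ closure (S.Ω ε t) := by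
  have hdist := hτ.infDist_displace_le ht hy r
  rcases hr.lt_or_eq with hlt | heq
  · exact subset_closure (hdist.trans_lt hlt)
  · rcases eq_or_eq_neg_of_abs_eq heq with rfl | rfl
    · simpa using frontier_subset_closure
        (hτ.displace_mem_frontier ht hε₀ hε hy (σ := 1) (by simp))
    · simpa using frontier_subset_closure
        (hτ.displace_mem_frontier ht hε₀ hε hy (σ := -1) (by simp))

end

end Tube

theorem HasExpansion.exists_interior_remainder_bound {k : ℕ} {f : ℝ → E3 → ℝ → F}
    {c : Fin k → E3 → ℝ → F} (hf : S.HasExpansion f c) {a b ε₀ C : ℝ} (hτ : S.Tube a b ε₀ C)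
    (hk : 1 ≤ k) :
    ∃ M, 0 ≤ M ∧ ∀ᶠ ε : ℝ in 𝓝[>] 0, ∀ t ∈ Icc a b, ∀ y ∈ S.Γ t, ∀ r, |r| < ε →
      ‖Function.uncurry (f ε) (displace (S.normalAt t) (y, r), t) -
        S.expansion c (displace (S.normalAt t) (y, r), t)‖ ≤ M * |r| ^ k ∧
      ‖fderiv ℝ (fun z => Function.uncurry (f ε) z - S.expansion c z)
        (displace (S.normalAt t) (y, r), t)‖ ≤ M * |r| ^ (k - 1) := by
  obtain ⟨M, hM⟩ := hf.remainder a b hτ.pos_left hτ.lt_right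
  refine ⟨|M|, abs_nonneg M, ?_⟩
  filter_upwards [hM, Ioo_mem_nhdsGT hτ.pos] with ε hbound hε t ht y hy r hr
  have hΩ : displace (S.normalAt t) (y, r) ∈ S.Ω ε t :=
    (hτ.infDist_displace_le ht hy r).trans_lt hr
  have hsdist := hτ.sdist_displace ht hy (hr.le.trans hε.2.le)
  have hrem (l : ℕ) (hl : l ≤ k) :
      ‖iteratedFDeriv ℝ l (fun z => Function.uncurry (f ε) z - S.expansion c z)
        (displace (S.normalAt t) (y, r), t)‖ ≤ M * |r| ^ (k - l) :=
    (hbound t ht _ hΩ l hl).trans_eq (by rw [hsdist])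
  have hvalue := hrem 0 (Nat.zero_le k)
  have hderiv := hrem 1 hk
  rw [norm_iteratedFDeriv_zero] at hvalue
  rw [norm_iteratedFDeriv_one] at hderiv
  have hM_le (n : ℕ) : M * |r| ^ n ≤ |M| * |r| ^ n := by gcongr; exact le_abs_self M
  exact ⟨hvalue.trans (hM_le k), hderiv.trans (hM_le (k - 1))⟩

theorem HasExpansion.exists_remainder_bound {k : ℕ} {f : ℝ → E3 → ℝ → F}
    {c : Fin k → E3 → ℝ → F} (hf : S.HasExpansion f c) {a b ε₀ C : ℝ} (hτ : S.Tube a b ε₀ C)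
    (hk : 1 ≤ k) :
    ∃ M, 0 ≤ M ∧ ∀ᶠ ε : ℝ in 𝓝[>] 0, ∀ t ∈ Icc a b, ∀ y ∈ S.Γ t, ∀ r, |r| ≤ ε →
      ‖f ε (displace (S.normalAt t) (y, r)) t -
        S.expansion c (displace (S.normalAt t) (y, r), t)‖ ≤ M * |r| ^ k ∧
      ‖fderiv ℝ (Function.uncurry (f ε)) (displace (S.normalAt t) (y, r), t) -
        fderiv ℝ (S.expansion c) (displace (S.normalAt t) (y, r), t)‖ ≤ M * |r| ^ (k - 1) := by
  obtain ⟨M, hM₀, hM⟩ := hf.exists_interior_remainder_bound hτ hk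
  refine ⟨M, hM₀, ?_⟩
  filter_upwards [hM, hf.smooth, Ioo_mem_nhdsGT hτ.pos] with ε hbound hsmooth hε t ht y hy r hr
  have hf_smooth : ContDiffAt ℝ 1 (Function.uncurry (f ε)) (displace (S.normalAt t) (y, r), t) :=
    (hsmooth t (hτ.mem_Ioo ht) _ (hτ.displace_mem_closure ht hε.2.le hε.1 hy hr)).of_le
      (by exact_mod_cast le_top)
  have hc_smooth : ContDiffAt ℝ 1 (S.expansion c) (displace (S.normalAt t) (y, r), t) :=
    contDiffAt_expansion hf.coeff_smooth (hτ.regular_displace ht hy (hr.trans hε.2.le))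
  have hrem := hf_smooth.sub hc_smooth
  let line : ℝ → E3 × ℝ := fun s => (displace (S.normalAt t) (y, s), t)
  have hline : ContinuousAt line r := by
    simp only [line, displace]
    fun_prop
  rw [← fderiv_fun_sub (hf_smooth.differentiableAt one_ne_zero)
    (hc_smooth.differentiableAt one_ne_zero)]
  exact ⟨norm_le_mul_abs_pow_of_lt hε.1 (fun s hs => (hbound t ht y hy s hs).1) hr
      (hrem.continuousAt.comp (f := line) hline),
    norm_le_mul_abs_pow_of_lt hε.1 (fun s hs => (hbound t ht y hy s hs).2) hr
      ((hrem.continuousAt_fderiv one_ne_zero).comp (f := line) hline)⟩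

end MovingSurface

/-! ### Limits of integrals over the thin domains -/

namespace MovingSurface

variable {T : ℝ} {S : MovingSurface T} {X : Type*} [NormedAddCommGroup X]

variable (S) in
/-- Uniform convergence of functions `G ε` on the tubes of half-width `ε` to a function `g` on the
surface, for times in `[a, b]`: `G ε (y + r ν(y,t), t)` is close to `g (y, t)` uniformly in
`|r| ≤ ε`. -/
def ConvergesToSurface (a b : ℝ) (G : ℝ → E3 × ℝ → X) (g : E3 × ℝ → X) : Prop :=
  ∀ η > 0, ∀ᶠ ε : ℝ in 𝓝[>] 0, ∀ t ∈ Icc a b, ∀ y ∈ S.Γ t, ∀ r, |r| ≤ ε →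
    ‖G ε (displace (S.normalAt t) (y, r), t) - g (y, t)‖ ≤ η

variable {a b ε₀ C : ℝ} {G : ℝ → E3 × ℝ → X} {g : E3 × ℝ → X}

theorem ConvergesToSurface.tendsto (h : S.ConvergesToSurface a b G g) {t : ℝ} (ht : t ∈ Icc a b)
    {y : E3} (hy : y ∈ S.Γ t) :
    Tendsto (fun ε => G ε (displace (S.normalAt t) (y, ε), t)) (𝓝[>] 0) (𝓝 (g (y, t))) := by
  refine Metric.tendsto_nhds.2 fun η hη => ?_
  filter_upwards [h (η / 2) (half_pos hη), self_mem_nhdsWithin] with ε hclose (hε : 0 < ε)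
  rw [dist_eq_norm]
  exact (hclose t ht y hy ε (abs_of_pos hε).le).trans_lt (half_lt_self hη)

theorem ConvergesToSurface.comp (h : S.ConvergesToSurface a b G g) (hτ : S.Tube a b ε₀ C)
    (hg : ContinuousOn g (S.spaceTimeIcc a b)) {Y : Type*} [NormedAddCommGroup Y] {Φ : X → Y}
    (hΦ : Continuous Φ) : S.ConvergesToSurface a b (fun ε => Φ ∘ G ε) (Φ ∘ g) := by
  intro η hη
  have huniform := (hτ.isCompact_spaceTimeIcc.image_of_continuousOn
    hg).uniformContinuousAt_of_continuousAt Φ (fun x _ => hΦ.continuousAt)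
      (Metric.dist_mem_uniformity hη)
  obtain ⟨δ, hδ, hclose⟩ := Metric.mem_uniformity_dist.1 huniform
  filter_upwards [h (δ / 2) (half_pos hδ)] with ε hε t ht y hy r hr
  rw [← dist_eq_norm, dist_comm]
  refine (hclose ?_ (mem_image_of_mem g (show (y, t) ∈ S.spaceTimeIcc a b from ⟨ht, hy⟩))).le
  rw [dist_comm, dist_eq_norm]
  exact (hε t ht y hy r hr).trans_lt (half_lt_self hδ)

theorem continuousOn_slice (hg : ContinuousOn g (S.spaceTimeIcc a b)) {t : ℝ}
    (ht : t ∈ Icc a b) : ContinuousOn (fun y => g (y, t)) (S.Γ t) :=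
  hg.comp (by fun_prop) fun _ hy => ⟨ht, hy⟩

namespace Tube

variable (hτ : S.Tube a b ε₀ C)
include hτ

theorem convergesToSurface
    (hg : ∀ t ∈ Icc a b, ∀ x, Metric.infDist x (S.Γ t) ≤ ε₀ → ContinuousAt g (x, t)) {M : ℝ}
    {m : ℕ} (hM : 0 ≤ M) (hm : m ≠ 0)
    (h : ∀ᶠ ε : ℝ in 𝓝[>] 0, ∀ t ∈ Icc a b, ∀ y ∈ S.Γ t, ∀ r, |r| ≤ ε →
      ‖G ε (displace (S.normalAt t) (y, r), t) - g (displace (S.normalAt t) (y, r), t)‖ ≤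
        M * |r| ^ m) :
    S.ConvergesToSurface a b G g := by
  intro η hη
  obtain ⟨δ, hδ, -, hnear⟩ := hτ.exists_forall_norm_sub_lt hg (half_pos hη)
  have hsmall : ∀ᶠ ε : ℝ in 𝓝 0, M * ε ^ m < η / 2 :=
    ContinuousAt.eventually_lt (by fun_prop) continuousAt_const (by simpa [hm] using hη)
  filter_upwards [h, nhdsWithin_le_nhds hsmall, Ioo_mem_nhdsGT hδ] with
    ε hrem hsmall hε t ht y hy r hr
  calc ‖G ε (displace (S.normalAt t) (y, r), t) - g (y, t)‖
      ≤ M * |r| ^ m + η / 2 := (norm_sub_le_norm_sub_add_norm_sub _ _ _).trans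
        (add_le_add (hrem t ht y hy r hr) (hnear t ht y hy r (hr.trans_lt hε.2)).le)
    _ ≤ M * ε ^ m + η / 2 := by gcongr
    _ ≤ η := by linarith

theorem tendstoUniformlyOn_of_abs_sub_le {F : ℝ → ℝ → ℝ} {f : ℝ → ℝ}
    (h : ∀ η > 0, ∀ᶠ ε : ℝ in 𝓝[>] 0, ∀ t ∈ Icc a b, |F ε t - f t| ≤ η * μHE[2].real (S.Γ t)) :
    TendstoUniformlyOn F f (𝓝[>] 0) (Icc a b) := by
  refine Metric.tendstoUniformlyOn_iff.2 fun η hη => ?_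
  obtain ⟨A, hA⟩ := hτ.exists_area_bound
  have hA_pos : 0 < |A| + 1 := by positivity
  filter_upwards [h (η / (|A| + 1)) (by positivity)] with ε hε t ht
  have harea : μHE[2].real (S.Γ t) < |A| + 1 :=
    (hA t ht).trans_lt ((le_abs_self A).trans_lt (lt_add_one _))
  rw [dist_comm, Real.dist_eq]
  calc |F ε t - f t| ≤ η / (|A| + 1) * μHE[2].real (S.Γ t) := hε t ht
    _ < η / (|A| + 1) * (|A| + 1) := by gcongr
    _ = η := div_mul_cancel₀ _ hA_pos.ne'

theorem eventually_abs_jac_mul_sub_le {G : ℝ → E3 × ℝ → ℝ} {g : E3 × ℝ → ℝ}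
    (h : S.ConvergesToSurface a b G g) (hg : ContinuousOn g (S.spaceTimeIcc a b)) {η : ℝ}
    (hη : 0 < η) :
    ∀ᶠ ε : ℝ in 𝓝[>] 0, ∀ t ∈ Icc a b, ∀ y ∈ S.Γ t, ∀ r, |r| ≤ ε →
      |displaceJac (S.weingarten t) (y, r) * G ε (displace (S.normalAt t) (y, r), t) -
        g (y, t)| ≤ η := by
  obtain ⟨M, hM₀, hM⟩ := hτ.exists_bound_of_continuousOn hg
  have hsmall : ∀ᶠ ε : ℝ in 𝓝 0, 2 * C * ε * (1 + M) < η / 2 :=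
    ContinuousAt.eventually_lt (by fun_prop) continuousAt_const (by simpa using hη)
  filter_upwards [h (min (η / 2) 1) (lt_min (half_pos hη) one_pos), nhdsWithin_le_nhds hsmall,
    Ioo_mem_nhdsGT hτ.pos] with ε hclose hsmall hε t ht y hy r hr
  have hC := hτ.const_nonneg ht
  have hJ := hτ.abs_jac_sub_one_le ht hy (hr.trans hε.2.le)
  have hGg := hclose t ht y hy r hr
  have hg_le := hM t ht y hy
  set J := (displaceJac (S.weingarten t) (y, r) : ℝ)
  set w := G ε (displace (S.normalAt t) (y, r), t)
  have hw : |w| ≤ 1 + M := by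
    rw [← sub_add_cancel w (g (y, t))]
    exact (abs_add_le _ _).trans (add_le_add (hGg.trans (min_le_right _ _)) hg_le)
  calc |J * w - g (y, t)| = |(J - 1) * w + (w - g (y, t))| := by congr 1; ring
    _ ≤ |J - 1| * |w| + |w - g (y, t)| := (abs_add_le _ _).trans_eq (by rw [abs_mul])
    _ ≤ 2 * C * |r| * (1 + M) + η / 2 := by
      gcongr
      exact hGg.trans (min_le_left _ _)
    _ ≤ 2 * C * ε * (1 + M) + η / 2 := by gcongr
    _ ≤ η := by linarith

theorem tendstoUniformlyOn_setIntegral_Ω {G : ℝ → E3 × ℝ → ℝ} {g : E3 × ℝ → ℝ}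
    (h : S.ConvergesToSurface a b G g) (hg : ContinuousOn g (S.spaceTimeIcc a b))
    (hG : ∀ᶠ ε : ℝ in 𝓝[>] 0, ∀ t ∈ Icc a b, ContinuousOn (fun x => G ε (x, t)) (S.Ω ε t)) :
    TendstoUniformlyOn (fun ε t => (2 * ε)⁻¹ * ∫ x in S.Ω ε t, G ε (x, t))
      (fun t => ∫ y in S.Γ t, g (y, t) ∂μHE[2]) (𝓝[>] 0) (Icc a b) := by
  refine hτ.tendstoUniformlyOn_of_abs_sub_le fun η hη => ?_
  filter_upwards [hτ.eventually_abs_jac_mul_sub_le h hg hη, hG, Ioo_mem_nhdsGT hτ.pos] with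
    ε hclose hcont hε t ht
  exact hτ.abs_setIntegral_Ω_sub_le ht hε.1 hε.2.le (hcont t ht) (continuousOn_slice hg ht)
    fun y hy r hr => hclose t ht y hy r hr.le

end Tube

namespace HasExpansion

variable {F : Type*} [NormedAddCommGroup F] [NormedSpace ℝ F] {k : ℕ} {f : ℝ → E3 → ℝ → F}
  {c : Fin k → E3 → ℝ → F} (hf : S.HasExpansion f c) (hτ : S.Tube a b ε₀ C)
include hf hτ

theorem convergesToSurface (hk : 1 ≤ k) :
    S.ConvergesToSurface a b (fun ε => Function.uncurry (f ε)) (S.expansion c) := by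
  obtain ⟨M, hM₀, hM⟩ := hf.exists_remainder_bound hτ hk
  exact hτ.convergesToSurface (fun t ht x hx =>
      (contDiffAt_expansion hf.coeff_smooth (hτ.regular t ht x hx)).continuousAt) hM₀
    (by lia : k ≠ 0) (hM.mono fun ε h t ht y hy r hr => (h t ht y hy r hr).1)

theorem convergesToSurface_fderiv (hk : 2 ≤ k) :
    S.ConvergesToSurface a b (fun ε => fderiv ℝ (Function.uncurry (f ε)))
      (fderiv ℝ (S.expansion c)) := by
  obtain ⟨M, hM₀, hM⟩ := hf.exists_remainder_bound hτ (by lia)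
  exact hτ.convergesToSurface (fun t ht x hx => (contDiffAt_expansion hf.coeff_smooth
      (hτ.regular t ht x hx)).continuousAt_fderiv one_ne_zero) hM₀
    (by lia : k - 1 ≠ 0) (hM.mono fun ε h t ht y hy r hr => (h t ht y hy r hr).2)

end HasExpansion

end MovingSurface

/-! ### Boundary conditions and the strain rate on the surface -/

open Asymptotics in
theorem eq_zero_of_sum_pow_smul_isBigO {𝕜 F : Type*} [NontriviallyNormedField 𝕜]
    [NormedAddCommGroup F] [NormedSpace 𝕜 F] :
    ∀ {k : ℕ} {c : Fin k → F},
      ((fun r : 𝕜 => ∑ j : Fin k, r ^ (j : ℕ) • c j) =O[𝓝[≠] 0] fun r => r ^ k) → c = 0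
  | 0, _, _ => Subsingleton.elim _ _
  | k + 1, c, h => by
    simp only [Fin.sum_univ_succ, Fin.val_zero, pow_zero, one_smul, Fin.val_succ, pow_succ',
      mul_smul, ← Finset.smul_sum] at h
    have hlim : Tendsto (fun r : 𝕜 => c 0 + r • ∑ j : Fin k, r ^ (j : ℕ) • c j.succ) (𝓝[≠] 0)
        (𝓝 (c 0)) := by
      have hcont : Continuous fun r : 𝕜 => c 0 + r • ∑ j : Fin k, r ^ (j : ℕ) • c j.succ := by
        fun_prop
      simpa using (hcont.tendsto 0).mono_left nhdsWithin_le_nhds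
    have hpow : Tendsto (fun r : 𝕜 => r * r ^ k) (𝓝[≠] 0) (𝓝 0) := by
      have hcont : Continuous fun r : 𝕜 => r * r ^ k := by fun_prop
      simpa using (hcont.tendsto 0).mono_left nhdsWithin_le_nhds
    have hzero : c 0 = 0 := tendsto_nhds_unique hlim (h.trans_tendsto hpow)
    have hsucc : (fun j : Fin k => c j.succ) = 0 := by
      refine eq_zero_of_sum_pow_smul_isBigO (𝕜 := 𝕜) ?_
      obtain ⟨M, hM⟩ := h.bound
      refine .of_bound M ?_
      filter_upwards [hM, self_mem_nhdsWithin] with r hr hr₀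
      rw [hzero, zero_add, norm_smul, norm_mul, mul_left_comm] at hr
      exact le_of_mul_le_mul_left hr (norm_pos_iff.2 hr₀)
    funext j
    exact Fin.cases hzero (congrFun hsucc) j

section Strain

/-- The strain rate of a velocity field with space-time derivative `L`. -/
def strainOf (L : E3 × ℝ →L[ℝ] E3) : Matrix (Fin 3) (Fin 3) ℝ :=
  Matrix.of fun i j => (1 / 2 : ℝ) * (L (e i, 0) j + L (e j, 0) i)

theorem strain_eq_strainOf_fderiv {f : E3 → ℝ → E3} {x : E3} {t : ℝ}
    (h : DifferentiableAt ℝ (Function.uncurry f) (x, t)) :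
    strain (fun y => f y t) x = strainOf (fderiv ℝ (Function.uncurry f) (x, t)) := by
  have hslice : fderiv ℝ (fun y => f y t) x = _ := fderiv_prodMk_left (f := Function.uncurry f) h
  ext i j
  simp [strain, strainOf, gradMatrix, hslice]

theorem transpose_strainOf (L : E3 × ℝ →L[ℝ] E3) : (strainOf L).transpose = strainOf L := by
  ext i j
  simp [strainOf, add_comm]

theorem continuous_strainOf : Continuous strainOf := by
  refine continuous_matrix fun i j => ?_
  simp only [strainOf, Matrix.of_apply]
  fun_prop

theorem continuous_frobSq : Continuous frobSq := by
  unfold frobSq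
  fun_prop

theorem continuous_matVec : Continuous fun p : Matrix (Fin 3) (Fin 3) ℝ × E3 => matVec p.1 p.2 :=
  (PiLp.continuous_toLp 2 _).comp
    (continuous_fst.matrix_mulVec ((PiLp.continuous_ofLp 2 _).comp continuous_snd))

theorem inner_matVec_strainOf (L : E3 × ℝ →L[ℝ] E3) (n : E3) :
    inner ℝ (matVec (strainOf L) n) n = inner ℝ (L (n, 0)) n := by
  have hL : L (n, 0) = ∑ i, n i • L (e i, 0) := by
    have hsum := congrArg (L.comp (ContinuousLinearMap.inl ℝ E3 ℝ)) (sum_smul_e n)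
    simpa only [map_sum, map_smul, ContinuousLinearMap.comp_apply, ContinuousLinearMap.inl_apply]
      using hsum.symm
  rw [hL]
  simp only [PiLp.inner_apply, matVec, Matrix.mulVec, dotProduct, strainOf, Matrix.of_apply,
    Fin.sum_univ_three, PiLp.add_apply, PiLp.smul_apply, RCLike.inner_apply, conj_trivial,
    smul_eq_mul]
  ring

theorem tendsto_normal_residual_strainOf {L : ℝ → E3 × ℝ →L[ℝ] E3} {L₀ : E3 × ℝ →L[ℝ] E3}
    {l : Filter ℝ} (h : Tendsto L l (𝓝 L₀)) (n : E3) :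
    Tendsto (fun ε => matVec (strainOf (L ε)) n - inner ℝ (matVec (strainOf (L ε)) n) n • n) l
      (𝓝 (matVec (strainOf L₀) n - inner ℝ (L₀ (n, 0)) n • n)) := by
  have hmatVec : Tendsto (fun ε => matVec (strainOf (L ε)) n) l (𝓝 (matVec (strainOf L₀) n)) :=
    ((continuous_matVec.comp (continuous_strainOf.prodMk continuous_const)).tendsto L₀).comp h
  rw [← inner_matVec_strainOf]
  exact hmatVec.sub ((hmatVec.inner tendsto_const_nhds).smul tendsto_const_nhds)

theorem eq_proj_mul_mul_proj {D M : Matrix (Fin 3) (Fin 3) ℝ} {n w : Fin 3 → ℝ}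
    (hn : n ⬝ᵥ n = 1)
    (hD : D = M + (1 / 2 : ℝ) • (Matrix.vecMulVec n w + Matrix.vecMulVec w n))
    (hDn : D.mulVec n = 0) (hDs : D.transpose = D) :
    D = (1 - Matrix.vecMulVec n n) * M * (1 - Matrix.vecMulVec n n) := by
  set P := (1 : Matrix (Fin 3) (Fin 3) ℝ) - Matrix.vecMulVec n n with hP
  have hPD : P * D = D := by
    rw [hP, Matrix.sub_mul, Matrix.one_mul, Matrix.vecMulVec_mul, ← Matrix.mulVec_transpose, hDs,
      hDn, Matrix.vecMulVec_zero, sub_zero]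
  have hDP : D * P = D := by
    rw [hP, Matrix.mul_sub, Matrix.mul_one, Matrix.mul_vecMulVec, hDn, Matrix.zero_vecMulVec,
      sub_zero]
  have hPn : P * Matrix.vecMulVec n w = 0 := by
    rw [hP, Matrix.sub_mul, Matrix.one_mul, Matrix.vecMulVec_mul_vecMulVec, hn, one_smul, sub_self]
  have hnP : Matrix.vecMulVec w n * P = 0 := by
    rw [hP, Matrix.mul_sub, Matrix.mul_one, Matrix.vecMulVec_mul_vecMulVec, hn, one_smul, sub_self]
  calc D = P * D * P := by rw [hPD, hDP]
    _ = P * M * P +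
        (1 / 2 : ℝ) • (P * Matrix.vecMulVec n w * P + P * (Matrix.vecMulVec w n * P)) := by
      conv_lhs => rw [hD]
      simp only [Matrix.mul_add, Matrix.add_mul, Matrix.mul_smul, Matrix.smul_mul, Matrix.mul_assoc]
    _ = P * M * P := by
      rw [hPn, hnP, Matrix.zero_mul, Matrix.mul_zero, add_zero, smul_zero, add_zero]

end Strain

namespace MovingSurface

variable {T : ℝ} {S : MovingSurface T} {a b ε₀ C t : ℝ} {y : E3}

namespace Tube

variable (hτ : S.Tube a b ε₀ C) (ht : t ∈ Icc a b) (hy : y ∈ S.Γ t) {ε r : ℝ} {u : E3 → ℝ → E3}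
include hτ ht hy

theorem bdry_displace_of_abs_eq (hr : |r| = ε) (hε₀ : 0 < ε) (hε : ε ≤ ε₀) :
    displace (S.normalAt t) (y, r) ∈ frontier (S.Ω ε t) ∧
      S.bdryNormal (displace (S.normalAt t) (y, r)) t = (r / ε) • S.ν y t ∧
      S.bdryVelocity (displace (S.normalAt t) (y, r)) t = r / ε * S.V y t := by
  have hsign : |r / ε| = 1 := by rw [abs_div, hr, abs_of_pos hε₀, div_self hε₀.ne']
  have hfrontier := hτ.displace_mem_frontier ht hε₀ hε hy hsign
  have hbdry := hτ.bdry_displace ht hε₀ hε hy hsign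
  rw [div_mul_cancel₀ r hε₀.ne'] at hfrontier hbdry
  exact ⟨hfrontier, hbdry⟩

theorem inner_displace_of_impermeable (hu : S.Impermeable ε u) (hr : |r| = ε) (hε₀ : 0 < ε)
    (hε : ε ≤ ε₀) : inner ℝ (u (displace (S.normalAt t) (y, r)) t) (S.ν y t) = S.V y t := by
  obtain ⟨hmem, hnormal, hvelocity⟩ := hτ.bdry_displace_of_abs_eq ht hy hr hε₀ hε
  have hbc := hu t (hτ.mem_Ioo ht) _ hmem
  have hr₀ : r ≠ 0 := abs_pos.1 (hr ▸ hε₀)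
  rw [hnormal, hvelocity, inner_smul_right] at hbc
  exact mul_left_cancel₀ (div_ne_zero hr₀ hε₀.ne') hbc

end Tube

namespace HasExpansion

variable {k : ℕ} {u : ℝ → E3 → ℝ → E3}

theorem inner_coeff_normal {c : Fin (k + 1) → E3 → ℝ → E3} (hu : S.HasExpansion u c)
    (hnormal : ∀ᶠ ε : ℝ in 𝓝[>] 0, S.Impermeable ε (u ε)) (ht : t ∈ Ioo 0 T) (hy : y ∈ S.Γ t)
    (j : Fin (k + 1)) :
    inner ℝ (c j y t) (S.ν y t) = (Pi.single 0 (S.V y t) : Fin (k + 1) → ℝ) j := by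
  obtain ⟨ε₀, C, hτ⟩ := S.exists_tube ht.1 ht.2
  have htt : t ∈ Icc t t := left_mem_Icc.2 le_rfl
  obtain ⟨M, -, hM⟩ := hu.exists_remainder_bound hτ (Nat.le_add_left 1 k)
  have hν := S.norm_normal (hτ.mem_Icc htt) hy
  suffices hpoly : (fun j => inner ℝ (c j y t) (S.ν y t) -
      (Pi.single 0 (S.V y t) : Fin (k + 1) → ℝ) j) = 0 from sub_eq_zero.1 (congrFun hpoly j)
  refine eq_zero_of_sum_pow_smul_isBigO (𝕜 := ℝ) (.of_bound M ?_)
  filter_upwards [tendsto_norm_nhdsNE_zero.eventually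
    ((hM.and hnormal).and (Ioo_mem_nhdsGT hτ.pos))] with r ⟨⟨hrem, hbc⟩, hr⟩
  rw [Real.norm_eq_abs] at hrem hbc hr
  set x := displace (S.normalAt t) (y, r)
  have hsum : ∑ j : Fin (k + 1), r ^ (j : ℕ) • (inner ℝ (c j y t) (S.ν y t) -
      (Pi.single 0 (S.V y t) : Fin (k + 1) → ℝ) j) =
      -inner ℝ (u |r| x t - S.expansion c (x, t)) (S.ν y t) := by
    rw [inner_sub_left, hτ.inner_displace_of_impermeable htt hy hbc rfl hr.1 hr.2.le,
      hτ.expansion_displace htt hy hr.2.le, sum_inner, neg_sub]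
    simp [mul_sub, Finset.sum_sub_distrib, inner_smul_left, Pi.single_apply]
  rw [hsum, norm_neg, norm_pow, Real.norm_eq_abs r]
  refine (norm_inner_le_norm _ _).trans ?_
  rw [hν, mul_one]
  exact (hrem t htt y hy r le_rfl).1

variable {c : Fin (k + 1) → E3 → ℝ → E3} (hu : S.HasExpansion u c)
  (hnormal : ∀ᶠ ε : ℝ in 𝓝[>] 0, S.Impermeable ε (u ε)) (hτ : S.Tube a b ε₀ C) (ht : t ∈ Icc a b)
  (hy : y ∈ S.Γ t)
include hu hnormal hτ ht hy

theorem inner_expansion_displace {r : ℝ} (hr : |r| ≤ ε₀) :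
    inner ℝ (S.expansion c (displace (S.normalAt t) (y, r), t)) (S.ν y t) = S.V y t := by
  rw [hτ.expansion_displace ht hy hr, sum_inner]
  simp [inner_smul_left, hu.inner_coeff_normal hnormal (hτ.mem_Ioo ht) hy, Pi.single_apply]

theorem inner_fderiv_expansion_displace {r : ℝ} (hr : |r| < ε₀) :
    inner ℝ (fderiv ℝ (S.expansion c) (displace (S.normalAt t) (y, r), t) (S.ν y t, 0))
      (S.ν y t) = 0 := by
  have hline : HasDerivAt (fun s : ℝ => (displace (S.normalAt t) (y, s), t)) (S.ν y t, 0) r := by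
    refine HasDerivAt.prodMk ?_ (hasDerivAt_const r t)
    simp only [hτ.displace_eq ht hy]
    simpa using ((hasDerivAt_id r).smul_const (S.ν y t)).const_add y
  have hexp := ((contDiffAt_expansion hu.coeff_smooth
    (hτ.regular_displace ht hy hr.le)).differentiableAt one_ne_zero).hasFDerivAt
  have hinner := (hexp.comp_hasDerivAt r hline).inner ℝ (hasDerivAt_const r (S.ν y t))
  have hconst : (fun s : ℝ => inner ℝ (S.expansion c (displace (S.normalAt t) (y, s), t))
      (S.ν y t)) =ᶠ[𝓝 r] fun _ => S.V y t := by
    filter_upwards [continuousAt_id.abs.eventually_lt_const hr] with s hs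
    exact hu.inner_expansion_displace hnormal hτ ht hy hs.le
  simpa using hinner.unique ((hasDerivAt_const r (S.V y t)).congr_of_eventuallyEq hconst)

end HasExpansion

namespace HasExpansion

variable {k : ℕ} {u : ℝ → E3 → ℝ → E3} {c : Fin (k + 2) → E3 → ℝ → E3} (hu : S.HasExpansion u c)
  (hnormal : ∀ᶠ ε : ℝ in 𝓝[>] 0, S.Impermeable ε (u ε))
  (htan : ∀ᶠ ε : ℝ in 𝓝[>] 0, S.PerfectSlip ε (u ε)) (ht : t ∈ Ioo 0 T) (hy : y ∈ S.Γ t)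
include hu hnormal htan ht hy

theorem matVec_strainOf_normal :
    matVec (strainOf (fderiv ℝ (S.expansion c) (y, t))) (S.ν y t) = 0 := by
  obtain ⟨ε₀, C, hτ⟩ := S.exists_tube ht.1 ht.2
  have htt : t ∈ Icc t t := left_mem_Icc.2 le_rfl
  have hinner := hu.inner_fderiv_expansion_displace hnormal hτ htt hy (r := 0)
    (by simpa using hτ.pos)
  have hlim := tendsto_normal_residual_strainOf
    ((hu.convergesToSurface_fderiv hτ (by lia)).tendsto htt hy) (S.ν y t)
  rw [show displace (S.normalAt t) (y, 0) = y by simp [displace]] at hinner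
  rw [hinner, zero_smul, sub_zero] at hlim
  refine tendsto_nhds_unique hlim (tendsto_const_nhds.congr' ?_)
  filter_upwards [htan, hu.smooth, Ioo_mem_nhdsGT hτ.pos] with ε hslip hsmooth hε
  obtain ⟨hmem, hbdry, -⟩ := hτ.bdry_displace_of_abs_eq htt hy (abs_of_pos hε.1) hε.1 hε.2.le
  have hbc := hslip t ht _ hmem
  rw [hbdry, div_self hε.1.ne', one_smul, strain_eq_strainOf_fderiv
    ((hsmooth t ht _ (frontier_subset_closure hmem)).differentiableAt (by simp))] at hbc
  exact hbc.symm

theorem strainOf_fderiv_expansion :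
    strainOf (fderiv ℝ (S.expansion c) (y, t)) =
      S.tanProj y t * S.tanStrain (c 0) y t * S.tanProj y t := by
  obtain ⟨ρ, hρ, hz⟩ := S.eventually_regularAt (z₀ := (y, t)) ⟨ht, hy⟩
  have ht' := Ioo_subset_Icc_self ht
  have hn : S.ν y t ⬝ᵥ S.ν y t = 1 := by
    have hinner := real_inner_self_eq_norm_sq (S.ν y t)
    rwa [S.norm_normal ht' hy, one_pow] at hinner
  have hlead : DifferentiableAt ℝ (fun z : E3 × ℝ => c 0 (S.proj z.1 z.2) z.2) (y, t) :=
    (contDiffAt_comp_proj (hu.coeff_smooth 0) hz).differentiableAt one_ne_zero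
  have hderiv : fderiv ℝ (fun x => c 0 (S.proj x t) t) y (S.ν y t) = 0 := by
    rw [fderiv_prodMk_left (f := fun z : E3 × ℝ => c 0 (S.proj z.1 z.2) z.2) hlead]
    have hnormal_deriv :=
      fderiv_comp_proj_normal hz (by simpa [S.sdist_of_mem ht' hy] using hρ) hlead
    rw [normalExt, S.proj_of_mem ht' hy] at hnormal_deriv
    simpa using hnormal_deriv
  have hgrad : S.tanGrad (c 0) y t = gradMatrix (fun x => c 0 (S.proj x t) t) y :=
    S.tanProj_mul_gradMatrix hderiv
  refine eq_proj_mul_mul_proj (w := (S.expansion (Fin.tail c) (y, t)).ofLp) hn ?_ ?_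
    (transpose_strainOf _)
  · have hcoord (i : Fin 3) : inner ℝ (S.ν y t) (e i) = S.ν y t i := by
      simp [e, EuclideanSpace.inner_single_right]
    ext i j
    simp only [tanStrain, hgrad, strainOf, Matrix.of_apply,
      fderiv_expansion_of_mem hu.coeff_smooth hz hy, Matrix.add_apply, Matrix.smul_apply,
      gradMatrix, Matrix.transpose_apply, Matrix.vecMulVec_apply, hcoord, PiLp.add_apply,
      PiLp.smul_apply, smul_eq_mul]
    ring
  · simpa [matVec] using congrArg WithLp.ofLp (hu.matVec_strainOf_normal hnormal htan ht hy)

end HasExpansion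

end MovingSurface

/-! ### Limits of the energy and the dissipation -/

namespace MovingSurface

variable {T : ℝ} {S : MovingSurface T} {a b ε₀ C : ℝ}

theorem Tube.contDiffAt_expansion_of_mem {F : Type*} [NormedAddCommGroup F] [NormedSpace ℝ F]
    (hτ : S.Tube a b ε₀ C) {k : ℕ} {c : Fin k → E3 → ℝ → F}
    (hc : ∀ j, ContDiffOn ℝ ∞ (Function.uncurry (c j)) S.spaceTime) {z : E3 × ℝ}
    (hz : z ∈ S.spaceTimeIcc a b) : ContDiffAt ℝ 1 (S.expansion c) z :=
  contDiffAt_expansion hc (hτ.regular z.2 hz.1 z.1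
    ((Metric.infDist_zero_of_mem hz.2).trans_le hτ.pos.le))

theorem measurableSet_Ω (ε t : ℝ) : MeasurableSet (S.Ω ε t) :=
  (isOpen_lt (Metric.continuous_infDist_pt _) continuous_const).measurableSet

namespace HasExpansion

variable {k : ℕ} {u : ℝ → E3 → ℝ → E3}

theorem tendstoUniformlyOn_energy {c : Fin (k + 1) → E3 → ℝ → E3} (hu : S.HasExpansion u c)
    (hτ : S.Tube a b ε₀ C) :
    TendstoUniformlyOn (fun ε t => (2 * ε)⁻¹ * ∫ x in S.Ω ε t, ‖u ε x t‖ ^ 2 / 2)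
      (fun t => ∫ y in S.Γ t, ‖c 0 y t‖ ^ 2 / 2 ∂μHE[2]) (𝓝[>] 0) (Icc a b) := by
  have hΦ : Continuous fun w : E3 => ‖w‖ ^ 2 / 2 := by fun_prop
  have hexp : ContinuousOn (S.expansion c) (S.spaceTimeIcc a b) := fun z hz =>
    (hτ.contDiffAt_expansion_of_mem hu.coeff_smooth hz).continuousAt.continuousWithinAt
  refine (hτ.tendstoUniformlyOn_setIntegral_Ω
    ((hu.convergesToSurface hτ (by lia)).comp hτ hexp hΦ) (hΦ.comp_continuousOn hexp)
    ?_).congr_right fun t ht => ?_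
  · filter_upwards [hu.smooth] with ε hsmooth t ht x hx
    exact (hΦ.continuousAt.comp ((hsmooth t (hτ.mem_Ioo ht) x (subset_closure hx)).continuousAt.comp
      (f := fun x' => (x', t)) (by fun_prop))).continuousWithinAt
  · refine setIntegral_congr_fun (S.isCompact_Γ (hτ.mem_Icc ht)).measurableSet fun y hy => ?_
    simp only [Function.comp_apply, expansion_of_mem c (hτ.mem_Icc ht) hy]

theorem tendstoUniformlyOn_dissipation {c : Fin (k + 2) → E3 → ℝ → E3} (hu : S.HasExpansion u c)
    (hτ : S.Tube a b ε₀ C) (hnormal : ∀ᶠ ε : ℝ in 𝓝[>] 0, S.Impermeable ε (u ε))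
    (htan : ∀ᶠ ε : ℝ in 𝓝[>] 0, S.PerfectSlip ε (u ε)) :
    TendstoUniformlyOn
      (fun ε t => (2 * ε)⁻¹ * ∫ x in S.Ω ε t, frobSq (strain (fun y => u ε y t) x))
      (fun t => ∫ y in S.Γ t,
        frobSq (S.tanProj y t * S.tanStrain (c 0) y t * S.tanProj y t) ∂μHE[2])
      (𝓝[>] 0) (Icc a b) := by
  have hΦ : Continuous (frobSq ∘ strainOf) := continuous_frobSq.comp continuous_strainOf
  have hexp : ContinuousOn (fderiv ℝ (S.expansion c)) (S.spaceTimeIcc a b) := fun z hz =>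
    ((hτ.contDiffAt_expansion_of_mem hu.coeff_smooth hz).continuousAt_fderiv
      one_ne_zero).continuousWithinAt
  refine ((hτ.tendstoUniformlyOn_setIntegral_Ω
    ((hu.convergesToSurface_fderiv hτ (by lia)).comp hτ hexp hΦ) (hΦ.comp_continuousOn hexp)
    ?_).congr ?_).congr_right fun t ht => ?_
  · filter_upwards [hu.smooth] with ε hsmooth t ht x hx
    exact (hΦ.continuousAt.comp (((hsmooth t (hτ.mem_Ioo ht) x
      (subset_closure hx)).continuousAt_fderiv (by simp)).comp
        (f := fun x' => (x', t)) (by fun_prop))).continuousWithinAt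
  · filter_upwards [hu.smooth] with ε hsmooth t ht
    refine congrArg _ (setIntegral_congr_fun (S.measurableSet_Ω ε t) fun x hx => ?_)
    exact congrArg frobSq (strain_eq_strainOf_fderiv
      ((hsmooth t (hτ.mem_Ioo ht) x (subset_closure hx)).differentiableAt (by simp))).symm
  · exact setIntegral_congr_fun (S.isCompact_Γ (hτ.mem_Icc ht)).measurableSet fun y hy =>
      congrArg frobSq (hu.strainOf_fderiv_expansion hnormal htan (hτ.mem_Ioo ht) hy)

end HasExpansion

end MovingSurface

/-! ### Limit of the work done on the boundary -/

section Estimates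

theorem abs_mul_add_mul_le {J w q q₁ H r C K Q : ℝ} (hr : |r| ≤ 1) (hH : |H| ≤ C) (hq : |q| ≤ Q)
    (hq₁ : |q₁| ≤ Q) (hK : 0 ≤ K) (hJ : |J - (1 - r * H)| ≤ C * r ^ 2)
    (hw : |w + (q + r * q₁)| ≤ K * r ^ 2) :
    |J * w + (1 - r * H) * (q + r * q₁)| ≤ ((1 + C) * K + C * (2 * Q + K)) * r ^ 2 := by
  have hC : 0 ≤ C := (abs_nonneg _).trans hH
  have hmul {s B : ℝ} (hs : |s| ≤ B) : |r * s| ≤ B := by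
    rw [abs_mul]
    exact (mul_le_of_le_one_left (abs_nonneg s) hr).trans hs
  have hr_sq : r ^ 2 ≤ 1 := (sq_le_one_iff_abs_le_one r).2 hr
  have hlin : |1 - r * H| ≤ 1 + C :=
    (abs_sub _ _).trans (add_le_add abs_one.le (hmul hH))
  have hw_le : |w| ≤ 2 * Q + K := by
    have htriangle := abs_sub (w + (q + r * q₁)) (q + r * q₁)
    rw [add_sub_cancel_right] at htriangle
    linarith [abs_add_le q (r * q₁), hmul hq₁, mul_le_of_le_one_right hK hr_sq]
  calc |J * w + (1 - r * H) * (q + r * q₁)|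
      = |(J - (1 - r * H)) * w + (1 - r * H) * (w + (q + r * q₁))| := by congr 1; ring
    _ ≤ |J - (1 - r * H)| * |w| + |1 - r * H| * |w + (q + r * q₁)| := by
      rw [← abs_mul, ← abs_mul]
      exact abs_add_le _ _
    _ ≤ C * r ^ 2 * (2 * Q + K) + (1 + C) * (K * r ^ 2) := by gcongr
    _ = ((1 + C) * K + C * (2 * Q + K)) * r ^ 2 := by ring

/- To first order the integrand on the sheet at height `r = ±ε` is `-(1 - r H) (q + r q₁) (±V)`.
In the sum over both sheets the terms of order one cancel, and those of order `ε` add up. -/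
theorem abs_two_sheets_sub_le {Jp Jm wp wm q q₁ H V ε C K Q W : ℝ} (hε₀ : 0 < ε) (hε : ε ≤ 1)
    (hH : |H| ≤ C) (hq : |q| ≤ Q) (hq₁ : |q₁| ≤ Q) (hV : |V| ≤ W) (hK : 0 ≤ K)
    (hJp : |Jp - (1 - ε * H)| ≤ C * ε ^ 2) (hJm : |Jm - (1 - -ε * H)| ≤ C * (-ε) ^ 2)
    (hwp : |wp + (q + ε * q₁)| ≤ K * ε ^ 2) (hwm : |wm + (q + -ε * q₁)| ≤ K * (-ε) ^ 2) :
    |(2 * ε)⁻¹ * (Jp * (wp * V) + Jm * (wm * -V)) - (q * H - q₁) * V| ≤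
      ε * (((1 + C) * K + C * (2 * Q + K)) * W) := by
  have hp := abs_mul_add_mul_le (by rwa [abs_of_pos hε₀]) hH hq hq₁ hK hJp hwp
  have hm := abs_mul_add_mul_le (by rwa [abs_neg, abs_of_pos hε₀]) hH hq hq₁ hK hJm hwm
  set B := (1 + C) * K + C * (2 * Q + K)
  have hB : 0 ≤ B := by
    have := (abs_nonneg _).trans hH
    have := (abs_nonneg _).trans hq
    positivity
  rw [neg_sq] at hm
  calc |(2 * ε)⁻¹ * (Jp * (wp * V) + Jm * (wm * -V)) - (q * H - q₁) * V|
      = |(2 * ε)⁻¹ * ((Jp * wp + (1 - ε * H) * (q + ε * q₁)) -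
          (Jm * wm + (1 - -ε * H) * (q + -ε * q₁))) * V| := by
        congr 1
        field_simp
        ring
    _ ≤ (2 * ε)⁻¹ * (B * ε ^ 2 + B * ε ^ 2) * W := by
        rw [abs_mul, abs_mul, abs_of_pos (by positivity : 0 < (2 * ε)⁻¹)]
        gcongr
        exact (abs_sub _ _).trans (add_le_add hp hm)
    _ = ε * (B * W) := by
        field_simp
        ring

end Estimates

namespace MovingSurface

variable {T : ℝ} {S : MovingSurface T}

theorem inner_matVec_stress (μ₀ : ℝ) (u : E3 → ℝ → E3) (p : E3 → ℝ → ℝ) (x : E3) (t : ℝ) (n : E3) :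
    inner ℝ (matVec (stress μ₀ u p x t) n) n =
      2 * μ₀ * inner ℝ (matVec (strain (fun y => u y t) x) n) n - p x t * inner ℝ n n := by
  have hstress : matVec (stress μ₀ u p x t) n =
      (2 * μ₀) • matVec (strain (fun y => u y t) x) n - p x t • n := by
    simp [stress, matVec, Matrix.sub_mulVec, Matrix.smul_mulVec]
  rw [hstress, inner_sub_left, real_inner_smul_left, real_inner_smul_left]

theorem continuousOn_strain {f : E3 → ℝ → E3} {t : ℝ} {s : Set E3}
    (h : ∀ x ∈ s, ContDiffAt ℝ 1 (Function.uncurry f) (x, t)) :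
    ContinuousOn (fun x => strain (fun y => f y t) x) s := by
  refine ContinuousOn.congr (fun x hx => ContinuousAt.continuousWithinAt ?_) fun x hx =>
    strain_eq_strainOf_fderiv ((h x hx).differentiableAt one_ne_zero)
  exact continuous_strainOf.continuousAt.comp (((h x hx).continuousAt_fderiv one_ne_zero).comp
    (f := fun x' : E3 => (x', t)) (by fun_prop))

theorem continuousOn_meanCurv {t : ℝ} (ht : t ∈ Ioo 0 T) :
    ContinuousOn (fun y => S.meanCurv y t) (S.Γ t) := by
  refine ContinuousOn.congr (f := fun y => -∑ i, (S.weingarten t y (e i)) i) ?_ fun y hy =>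
    S.meanCurv_eq ht hy
  have hweingarten := (S.normalField ht).continuousOn_deriv
  fun_prop

section Continuity

variable {ρ σ t : ℝ} {x : E3} (hz : ∀ᶠ w in 𝓝 (x, t), S.RegularAt ρ w) (hσ : 0 < σ * S.sdist x t)
  (hσ₁ : |σ| = 1)
include hz hσ

theorem eventually_regularAt_signed :
    ∀ᶠ x' in 𝓝 x, (∀ᶠ w in 𝓝 (x', t), S.RegularAt ρ w) ∧ 0 < σ * S.sdist x' t := by
  have hslice : Tendsto (fun x' : E3 => (x', t)) (𝓝 x) (𝓝 (x, t)) :=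
    Continuous.tendsto (by fun_prop) x
  have hsdist : ContinuousAt (fun w => σ * Function.uncurry S.sdist w) (x, t) :=
    hz.self_of_nhds.contDiffAt_sdist.continuousAt.const_mul σ
  exact hslice.eventually (hz.eventually_nhds.and (hsdist.eventually_const_lt hσ))

include hσ₁

theorem continuousAt_bdryNormal : ContinuousAt (fun x' => S.bdryNormal x' t) x := by
  have hnormal : ContinuousAt (fun x' : E3 => S.normalExt (x', t)) x :=
    hz.self_of_nhds.contDiffAt_normalExt.continuousAt.comp (f := fun x' : E3 => (x', t))
      (by fun_prop)
  refine (hnormal.const_smul σ).congr ?_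
  filter_upwards [eventually_regularAt_signed hz hσ] with x' ⟨hreg, hside⟩
  exact (bdryNormal_eq hreg hside hσ₁).symm

theorem continuousAt_bdryVelocity : ContinuousAt (fun x' => S.bdryVelocity x' t) x := by
  have hderiv : ContinuousAt (fun x' : E3 => fderiv ℝ (Function.uncurry S.sdist) (x', t)) x :=
    (hz.self_of_nhds.contDiffAt_sdist.continuousAt_fderiv one_ne_zero).comp
      (f := fun x' : E3 => (x', t)) (by fun_prop)
  refine ((hderiv.clm_apply (continuousAt_const (y := (0, 1)))).const_mul σ).neg.congr ?_
  filter_upwards [eventually_regularAt_signed hz hσ] with x' ⟨hreg, hside⟩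
  rw [bdryVelocity_eq hreg hside hσ₁, Pi.neg_apply, fderiv_sdist hreg]
  simp

end Continuity

variable (S) in
/-- The power `(σ ν_ε · ν_ε) V_ε` of the normal stress per unit area of `∂Ω_ε(t)`. -/
def boundaryPower (μ₀ : ℝ) (u : E3 → ℝ → E3) (p : E3 → ℝ → ℝ) (x : E3) (t : ℝ) : ℝ :=
  inner ℝ (matVec (stress μ₀ u p x t) (S.bdryNormal x t)) (S.bdryNormal x t) * S.bdryVelocity x t

namespace Tube

variable {a b ε₀ C ε t : ℝ} (hτ : S.Tube a b ε₀ C) (ht : t ∈ Icc a b) (hε₀ : 0 < ε) (hε : ε ≤ ε₀)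
include hτ ht hε₀ hε

theorem exists_signed_of_mem_frontier {x : E3} (hx : x ∈ frontier (S.Ω ε t)) :
    ∃ σ : ℝ, |σ| = 1 ∧ 0 < σ * S.sdist x t ∧ ∀ᶠ w in 𝓝 (x, t), S.RegularAt (2 * ε₀) w := by
  have hε_abs : |ε| ≤ ε₀ := by rwa [abs_of_pos hε₀]
  have hε_neg_abs : |-ε| ≤ ε₀ := by rwa [abs_neg]
  rw [hτ.frontier_Ω ht hε₀ hε] at hx
  rcases hx with ⟨y, hy, rfl⟩ | ⟨y, hy, rfl⟩
  · exact ⟨1, by simp, by simpa [hτ.sdist_displace ht hy hε_abs] using hε₀,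
      hτ.regular_displace ht hy hε_abs⟩
  · exact ⟨-1, by simp, by simpa [hτ.sdist_displace ht hy hε_neg_abs] using hε₀,
      hτ.regular_displace ht hy hε_neg_abs⟩

theorem continuousOn_boundaryPower (μ₀ : ℝ) {u : E3 → ℝ → E3} {p : E3 → ℝ → ℝ}
    (hu : ∀ x ∈ frontier (S.Ω ε t), ContDiffAt ℝ 1 (Function.uncurry u) (x, t))
    (hp : ∀ x ∈ frontier (S.Ω ε t), ContinuousAt (Function.uncurry p) (x, t)) :
    ContinuousOn (fun x => S.boundaryPower μ₀ u p x t) (frontier (S.Ω ε t)) := by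
  have hnormal : ContinuousOn (fun x => S.bdryNormal x t) (frontier (S.Ω ε t)) := fun x hx => by
    obtain ⟨σ, hσ₁, hσ, hz⟩ := hτ.exists_signed_of_mem_frontier ht hε₀ hε hx
    exact (continuousAt_bdryNormal hz hσ hσ₁).continuousWithinAt
  have hvelocity : ContinuousOn (fun x => S.bdryVelocity x t) (frontier (S.Ω ε t)) :=
    fun x hx => by
      obtain ⟨σ, hσ₁, hσ, hz⟩ := hτ.exists_signed_of_mem_frontier ht hε₀ hε hx
      exact (continuousAt_bdryVelocity hz hσ hσ₁).continuousWithinAt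
  have hpressure : ContinuousOn (fun x => p x t) (frontier (S.Ω ε t)) := fun x hx =>
    ((hp x hx).comp (f := fun x' : E3 => (x', t)) (by fun_prop)).continuousWithinAt
  have hstrain : ContinuousOn
      (fun x => matVec (strain (fun y => u y t) x) (S.bdryNormal x t)) (frontier (S.Ω ε t)) :=
    continuous_matVec.comp_continuousOn ((continuousOn_strain hu).prodMk hnormal)
  simp only [boundaryPower, inner_matVec_stress]
  exact (((hstrain.inner hnormal).const_mul _).sub
    (hpressure.mul (hnormal.inner hnormal))).mul hvelocity

theorem boundaryPower_displace (μ₀ : ℝ) {u : E3 → ℝ → E3} (p : E3 → ℝ → ℝ)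
    (hu : ∀ x ∈ frontier (S.Ω ε t), DifferentiableAt ℝ (Function.uncurry u) (x, t)) {y : E3}
    (hy : y ∈ S.Γ t) {r : ℝ} (hr : |r| = ε) :
    S.boundaryPower μ₀ u p (displace (S.normalAt t) (y, r)) t =
      (2 * μ₀ * inner ℝ (fderiv ℝ (Function.uncurry u) (displace (S.normalAt t) (y, r), t)
        (S.ν y t, 0)) (S.ν y t) - p (displace (S.normalAt t) (y, r)) t) * (r / ε * S.V y t) := by
  obtain ⟨hmem, hnormal, hvelocity⟩ := hτ.bdry_displace_of_abs_eq ht hy hr hε₀ hε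
  have hsign : r / ε * (r / ε) = 1 := by
    rw [← sq, ← sq_abs, abs_div, hr, abs_of_pos hε₀, div_self hε₀.ne', one_pow]
  have hscale : (((r / ε) • S.ν y t, 0) : E3 × ℝ) = (r / ε) • (S.ν y t, 0) := by simp
  rw [boundaryPower, inner_matVec_stress, hnormal, hvelocity, strain_eq_strainOf_fderiv (hu _ hmem),
    inner_matVec_strainOf, hscale, map_smul]
  simp only [real_inner_smul_left, real_inner_smul_right, ← mul_assoc (r / ε) (r / ε), hsign,
    one_mul]
  rw [real_inner_self_eq_norm_sq, S.norm_normal (hτ.mem_Icc ht) hy, one_pow, mul_one]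

end Tube

namespace HasExpansion

variable {a b ε₀ C : ℝ} {u : ℝ → E3 → ℝ → E3} {p : ℝ → E3 → ℝ → ℝ}

theorem exists_bound_inner_fderiv_normal {k : ℕ} {c : Fin (k + 1) → E3 → ℝ → E3}
    (hu : S.HasExpansion u c) (hτ : S.Tube a b ε₀ C)
    (hnormal : ∀ᶠ ε : ℝ in 𝓝[>] 0, S.Impermeable ε (u ε)) :
    ∃ M, 0 ≤ M ∧ ∀ᶠ ε : ℝ in 𝓝[>] 0, ∀ t ∈ Icc a b, ∀ y ∈ S.Γ t, ∀ r, |r| ≤ ε →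
      |inner ℝ (fderiv ℝ (Function.uncurry (u ε)) (displace (S.normalAt t) (y, r), t)
        (S.ν y t, 0)) (S.ν y t)| ≤ M * |r| ^ k := by
  obtain ⟨M, hM₀, hM⟩ := hu.exists_remainder_bound hτ (Nat.le_add_left 1 k)
  refine ⟨M, hM₀, ?_⟩
  filter_upwards [hM, Ioo_mem_nhdsGT hτ.pos] with ε hrem hε t ht y hy r hr
  have hν := S.norm_normal (hτ.mem_Icc ht) hy
  have hν_norm : ‖((S.ν y t, 0) : E3 × ℝ)‖ = 1 := by simp [Prod.norm_def, hν]
  have hexp := hu.inner_fderiv_expansion_displace hnormal hτ ht hy (hr.trans_lt hε.2)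
  have hop := (hrem t ht y hy r hr).2
  set L := fderiv ℝ (Function.uncurry (u ε)) (displace (S.normalAt t) (y, r), t)
  set L₀ := fderiv ℝ (S.expansion c) (displace (S.normalAt t) (y, r), t)
  calc |inner ℝ (L (S.ν y t, 0)) (S.ν y t)|
      = |inner ℝ ((L - L₀) (S.ν y t, 0)) (S.ν y t)| := by
        rw [sub_apply, inner_sub_left, hexp, sub_zero]
    _ ≤ ‖(L - L₀) (S.ν y t, 0)‖ := by
        simpa only [hν, mul_one] using abs_real_inner_le_norm ((L - L₀) (S.ν y t, 0)) (S.ν y t)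
    _ ≤ ‖L - L₀‖ := (L - L₀).unit_le_opNorm _ hν_norm.le
    _ ≤ M * |r| ^ k := hop

theorem exists_normal_stress_bound (μ₀ : ℝ) {c : Fin 3 → E3 → ℝ → E3} {c' : Fin 2 → E3 → ℝ → ℝ}
    (hu : S.HasExpansion u c) (hp : S.HasExpansion p c') (hτ : S.Tube a b ε₀ C)
    (hnormal : ∀ᶠ ε : ℝ in 𝓝[>] 0, S.Impermeable ε (u ε)) :
    ∃ K, 0 ≤ K ∧ ∀ᶠ ε : ℝ in 𝓝[>] 0, ∀ t ∈ Icc a b, ∀ y ∈ S.Γ t, ∀ r, |r| ≤ ε →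
      |2 * μ₀ * inner ℝ (fderiv ℝ (Function.uncurry (u ε)) (displace (S.normalAt t) (y, r), t)
        (S.ν y t, 0)) (S.ν y t) - p ε (displace (S.normalAt t) (y, r)) t +
          (c' 0 y t + r * c' 1 y t)| ≤ K * r ^ 2 := by
  obtain ⟨Mu, hMu₀, hMu⟩ := hu.exists_bound_inner_fderiv_normal hτ hnormal
  obtain ⟨Mp, hMp₀, hMp⟩ := hp.exists_remainder_bound hτ one_le_two
  refine ⟨|2 * μ₀| * Mu + Mp, by positivity, ?_⟩
  filter_upwards [hMu, hMp, Ioo_mem_nhdsGT hτ.pos] with ε hstrain hpressure hε t ht y hy r hr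
  have hstrain := hstrain t ht y hy r hr
  have hpressure := (hpressure t ht y hy r hr).1
  rw [hτ.expansion_displace ht hy (hr.trans hε.2.le)] at hpressure
  simp only [Fin.sum_univ_two, Fin.val_zero, Fin.val_one, pow_zero, pow_one, smul_eq_mul, one_mul,
    Real.norm_eq_abs, sq_abs] at hstrain hpressure
  rw [sub_add, add_mul]
  refine (abs_sub _ _).trans (add_le_add ?_ hpressure)
  rw [abs_mul (2 * μ₀), mul_assoc |2 * μ₀|]
  exact mul_le_mul_of_nonneg_left hstrain (abs_nonneg _)

theorem continuousOn_coeff {F : Type*} [NormedAddCommGroup F] [NormedSpace ℝ F] {k : ℕ}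
    {f : ℝ → E3 → ℝ → F} {c : Fin k → E3 → ℝ → F} (hf : S.HasExpansion f c) (hτ : S.Tube a b ε₀ C)
    (j : Fin k) : ContinuousOn (Function.uncurry (c j)) (S.spaceTimeIcc a b) :=
  (hf.coeff_smooth j).continuousOn.mono fun _ hz => ⟨hτ.mem_Ioo hz.1, hz.2⟩

theorem continuousOn_velocity {k : ℕ} {c : Fin (k + 1) → E3 → ℝ → E3} (hu : S.HasExpansion u c)
    (hτ : S.Tube a b ε₀ C) (hnormal : ∀ᶠ ε : ℝ in 𝓝[>] 0, S.Impermeable ε (u ε)) {t : ℝ}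
    (ht : t ∈ Icc a b) : ContinuousOn (fun y => S.V y t) (S.Γ t) := by
  refine ((continuousOn_slice (hu.continuousOn_coeff hτ 0) ht).inner
    (S.normalField (hτ.mem_Ioo ht)).continuousOn_normal).congr fun y hy => ?_
  simp only [S.normalAt_of_mem (hτ.mem_Icc ht) hy, Function.uncurry_apply_pair,
    hu.inner_coeff_normal hnormal (hτ.mem_Ioo ht) hy, Pi.single_eq_same]

theorem exists_bound_velocity {k : ℕ} {c : Fin (k + 1) → E3 → ℝ → E3} (hu : S.HasExpansion u c)
    (hτ : S.Tube a b ε₀ C) (hnormal : ∀ᶠ ε : ℝ in 𝓝[>] 0, S.Impermeable ε (u ε)) :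
    ∃ W, ∀ t ∈ Icc a b, ∀ y ∈ S.Γ t, |S.V y t| ≤ W := by
  obtain ⟨W, -, hW⟩ := hτ.exists_bound_of_continuousOn (hu.continuousOn_coeff hτ 0)
  refine ⟨W, fun t ht y hy => le_trans ?_ (hW t ht y hy)⟩
  have hinner := abs_real_inner_le_norm (c 0 y t) (S.ν y t)
  rwa [hu.inner_coeff_normal hnormal (hτ.mem_Ioo ht) hy, Pi.single_eq_same,
    S.norm_normal (hτ.mem_Icc ht) hy, mul_one] at hinner

section BoundaryPower

variable {c : Fin 3 → E3 → ℝ → E3} {c' : Fin 2 → E3 → ℝ → ℝ} (hu : S.HasExpansion u c)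
  (hp : S.HasExpansion p c') (hτ : S.Tube a b ε₀ C)
  (hnormal : ∀ᶠ ε : ℝ in 𝓝[>] 0, S.Impermeable ε (u ε)) (μ₀ : ℝ)
include hu hp hτ hnormal

theorem exists_two_sheets_boundaryPower_bound :
    ∃ B, ∀ᶠ ε : ℝ in 𝓝[>] 0, ∀ t ∈ Icc a b, ∀ y ∈ S.Γ t,
      |(2 * ε)⁻¹ * (displaceJac (S.weingarten t) (y, ε) *
          S.boundaryPower μ₀ (u ε) (p ε) (displace (S.normalAt t) (y, ε)) t +
        displaceJac (S.weingarten t) (y, -ε) *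
          S.boundaryPower μ₀ (u ε) (p ε) (displace (S.normalAt t) (y, -ε)) t) -
        (c' 0 y t * S.meanCurv y t - c' 1 y t) * S.V y t| ≤ ε * B := by
  obtain ⟨Q₀, -, hQ₀⟩ := hτ.exists_bound_of_continuousOn (hp.continuousOn_coeff hτ 0)
  obtain ⟨Q₁, -, hQ₁⟩ := hτ.exists_bound_of_continuousOn (hp.continuousOn_coeff hτ 1)
  obtain ⟨W, hW⟩ := hu.exists_bound_velocity hτ hnormal
  obtain ⟨K, hK₀, hK⟩ := hu.exists_normal_stress_bound μ₀ hp hτ hnormal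
  refine ⟨((1 + C) * K + C * (2 * max Q₀ Q₁ + K)) * W, ?_⟩
  filter_upwards [hK, hu.smooth, Ioo_mem_nhdsGT hτ.pos] with ε hstress hsmooth ⟨hε₀, hε⟩ t ht y hy
  have hdiff (x) (hx : x ∈ frontier (S.Ω ε t)) :
      DifferentiableAt ℝ (Function.uncurry (u ε)) (x, t) :=
    (hsmooth t (hτ.mem_Ioo ht) x (frontier_subset_closure hx)).differentiableAt (by simp)
  have hε_abs : |ε| = ε := abs_of_pos hε₀
  have hε_neg_abs : |-ε| = ε := by rwa [abs_neg]
  rw [hτ.boundaryPower_displace ht hε₀ hε.le μ₀ (p ε) hdiff hy hε_abs,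
    hτ.boundaryPower_displace ht hε₀ hε.le μ₀ (p ε) hdiff hy hε_neg_abs, neg_div,
    div_self hε₀.ne', one_mul, neg_one_mul]
  exact abs_two_sheets_sub_le hε₀ (hε.le.trans hτ.le_one) (hτ.abs_meanCurv_le t ht y hy)
    ((hQ₀ t ht y hy).trans (le_max_left _ _)) ((hQ₁ t ht y hy).trans (le_max_right _ _))
    (hW t ht y hy) hK₀ (hτ.abs_jac_sub_le t ht y hy ε (hε_abs.trans_le hε.le))
    (hτ.abs_jac_sub_le t ht y hy (-ε) (hε_neg_abs.trans_le hε.le))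
    (hstress t ht y hy ε hε_abs.le) (hstress t ht y hy (-ε) hε_neg_abs.le)

theorem tendstoUniformlyOn_boundaryPower :
    TendstoUniformlyOn
      (fun ε t =>
        (2 * ε)⁻¹ * ∫ x in frontier (S.Ω ε t), S.boundaryPower μ₀ (u ε) (p ε) x t ∂μHE[2])
      (fun t => ∫ y in S.Γ t, (c' 0 y t * S.meanCurv y t - c' 1 y t) * S.V y t ∂μHE[2])
      (𝓝[>] 0) (Icc a b) := by
  obtain ⟨B, hB⟩ := hu.exists_two_sheets_boundaryPower_bound hp hτ hnormal μ₀
  refine hτ.tendstoUniformlyOn_of_abs_sub_le fun η hη => ?_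
  have hsmall : ∀ᶠ ε : ℝ in 𝓝 0, ε * B < η :=
    ContinuousAt.eventually_lt (by fun_prop) continuousAt_const (by simpa using hη)
  filter_upwards [hB, hu.smooth, hp.smooth, nhdsWithin_le_nhds hsmall, Ioo_mem_nhdsGT hτ.pos] with
    ε hB hu_smooth hp_smooth hsmall hε t ht
  have ht' := hτ.mem_Ioo ht
  have hpower : ContinuousOn (fun x => S.boundaryPower μ₀ (u ε) (p ε) x t) (frontier (S.Ω ε t)) :=
    hτ.continuousOn_boundaryPower ht hε.1 hε.2.le μ₀
      (fun x hx => (hu_smooth t ht' x (frontier_subset_closure hx)).of_le (by simp))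
      fun x hx => (hp_smooth t ht' x (frontier_subset_closure hx)).continuousAt
  have hlimit : ContinuousOn (fun y => (c' 0 y t * S.meanCurv y t - c' 1 y t) * S.V y t) (S.Γ t) :=
    (((continuousOn_slice (hp.continuousOn_coeff hτ 0) ht).mul (continuousOn_meanCurv ht')).sub
      (continuousOn_slice (hp.continuousOn_coeff hτ 1) ht)).mul
        (hu.continuousOn_velocity hτ hnormal ht)
  exact hτ.abs_setIntegral_frontier_sub_le ht hε.1 hε.2.le hpower hlimit
    fun y hy => (hB t ht y hy).trans hsmall.le

end BoundaryPower

end HasExpansion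

end MovingSurface

end

end ThinFluid

theorem theorem5p6 {T μ₀ : ℝ} (hT : 0 < T) (hμ₀ : 0 < μ₀) (S : ThinFluid.MovingSurface T)
    (u : ℝ → ThinFluid.E3 → ℝ → ThinFluid.E3) (p : ℝ → ThinFluid.E3 → ℝ → ℝ)
    (v v1 v2 : ThinFluid.E3 → ℝ → ThinFluid.E3) (q q1 : ThinFluid.E3 → ℝ → ℝ)
    (hu : S.HasExpansion u ![v, v1, v2])
    (hp : S.HasExpansion p ![q, q1])
    (henergy : ∀ᶠ ε : ℝ in 𝓝[>] 0, S.BulkEnergyIdentity μ₀ ε (u ε) (p ε))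
    (hnormal : ∀ᶠ ε : ℝ in 𝓝[>] 0, S.Impermeable ε (u ε))
    (htan : ∀ᶠ ε : ℝ in 𝓝[>] 0, S.PerfectSlip ε (u ε)) :
    S.SurfaceEnergyIdentity μ₀ v q q1 := by
  intro t ht
  obtain ⟨a, ha, hat⟩ := exists_between ht.1
  obtain ⟨b, htb, hb⟩ := exists_between ht.2
  obtain ⟨ε₀, C, hτ⟩ := S.exists_tube ha hb
  have henergy_lim := hu.tendstoUniformlyOn_energy hτ
  have hdissipation := (uniformContinuous_const_smul (-(2 * μ₀))).comp_tendstoUniformlyOn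
    (hu.tendstoUniformlyOn_dissipation hτ hnormal htan)
  have hboundary := hu.tendstoUniformlyOn_boundaryPower hp hτ hnormal μ₀
  refine hasDerivAt_of_tendstoUniformlyOn isOpen_Ioo
    ((hdissipation.add hboundary).mono Ioo_subset_Icc_self) ?_
    (fun s hs => henergy_lim.tendsto_at (Ioo_subset_Icc_self hs)) ⟨hat, htb⟩
  filter_upwards [henergy] with ε henergy s hs
  refine ((henergy s (hτ.mem_Ioo (Ioo_subset_Icc_self hs))).const_mul (2 * ε)⁻¹).congr_deriv ?_
  rw [mul_add, mul_left_comm]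
  rfl
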